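/- **Theorem 5.4.** Let $\mathcal G=(V,E)$ be a finite simple graph with a set $V_b\subset V$ of $k\ge 2$ boundary vertices, and let $V_{int}=V\setminus V_b$ be the set of interior vertices. Assume that every edge has at least one interior endpoint and that every interior vertex is adjacent to every boundary vertex. Let $(b_v)_{v\in V_b}$ be distinct complex numbers. For $q:E\to\mathbb R$, a *realization* of $q$ (with boundary values $b$) is a map $z:V\to\mathbb C$ with $z_v=b_v$ for all $v\in V_b$, with $z_u\ne z_v$ for every edge $uv$, and with $$\sum_{v\sim u}\frac{q_{uv}}{z_u-z_v}=0\qquad\text{for every } u\in V_{int}.$$ Let $L$ be the linear space of all $q:E\to\mathbb R$ such that $\sum_{v\sim u}q_{uv}=0$ for every $u\in V_{int}$. Then for generic $q\in L$ the number of realizations of $q$ is finite and equal to $$(-1)^{|V_{int}|}\,\chi(-k+2),$$ where $\chi$ is the chromatic polynomial of the subgraph $\mathcal G_{int}$ of $\mathcal G$ induced on $V_{int}$. Here "for generic $q\in L$" means: there is a polynomial $P$ in the variables $(q_e)_{e\in E}$, with coefficients in the field $\mathbb Q(b_v: v\in V_b)$ and not vanishing identically on $L$, such that the claim holds for all $q\in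 L$ with $P(q)\ne 0$. In particular it holds for every $q\in L$ that satisfies no polynomial relation over this field except those valid on all of $L$. -/

import Mathlib

namespace HQD

open Polynomial

/-! ### The chromatic polynomial of a finite graph -/

/-- The chromatic polynomial of a finite simple graph, in subset-expansion form
`∑_{A ⊆ E} (-1)^|A| X^{c(A)}`, where `c(A)` is the number of connected components of the spanning
subgraph with edge set `A`. The theorem `eval_chromaticPolynomial` below shows that its value at a
natural number `n` is the number of proper colorings with `n` colors, which determines it. -/
noncomputable def chromaticPolynomial {V : Type*} [Finite V] (G : SimpleGraph V) : ℤ[X] :=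
  ∑ A ∈ G.edgeSet.toFinite.toFinset.powerset,
    (-1) ^ A.card * X ^ Nat.card (SimpleGraph.fromEdgeSet (A : Set (Sym2 V))).ConnectedComponent

/-- Functions that are constant along all edges of `H` are functions on the components of `H`. -/
theorem card_monochromatic {V : Type*} [Finite V] (H : SimpleGraph V) (n : ℕ) :
    Nat.card {f : V → Fin n // ∀ u v, H.Adj u v → f u = f v} = n ^ Nat.card H.ConnectedComponent := by
  have e : {f : V → Fin n // ∀ u v, H.Adj u v → f u = f v} ≃ (H.ConnectedComponent → Fin n) :=
    { toFun := fun f c => c.lift f.1 (fun u v p hp => by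
        clear hp
        induction p with
        | nil => rfl
        | cons h p ih => exact (f.2 _ _ h).trans ih)
      invFun := fun g => ⟨fun v => g (H.connectedComponentMk v), fun u v h => by
        exact congrArg g (SimpleGraph.ConnectedComponent.connectedComponentMk_eq_of_adj h)⟩
      left_inv := fun f => rfl
      right_inv := fun g => by
        funext c
        induction c using SimpleGraph.ConnectedComponent.ind with
        | _ v => rfl }
  rw [Nat.card_congr e, Nat.card_fun]
  simp

/-- The chromatic polynomial counts proper colorings. -/
theorem eval_chromaticPolynomial {V : Type*} [Finite V] (G : SimpleGraph V) (n : ℕ) :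
    (chromaticPolynomial G).eval (n : ℤ) = Nat.card (G.Coloring (Fin n)) := by
  classical
  have := Fintype.ofFinite V
  have key : ∀ f : V → Fin n,
      ∑ A ∈ G.edgeSet.toFinite.toFinset.powerset,
        ∏ e ∈ A, (-(if (e.map f).IsDiag then (1 : ℤ) else 0))
      = if (∀ u v, G.Adj u v → f u ≠ f v) then 1 else 0 := by
    intro f
    rw [← Finset.prod_one_add]
    split_ifs with h
    · apply Finset.prod_eq_one
      intro e he
      induction e using Sym2.ind with
      | _ u v =>
        have := h u v (by simpa using he)
        simp [this]
    · push Not at h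
      obtain ⟨u, v, huv, hf⟩ := h
      apply Finset.prod_eq_zero (i := s(u, v)) (by simpa using huv)
      simp [hf]
  have hcol : (Nat.card (G.Coloring (Fin n)) : ℤ)
      = ∑ f : V → Fin n, if (∀ u v, G.Adj u v → f u ≠ f v) then 1 else 0 := by
    have e : G.Coloring (Fin n) ≃ {f : V → Fin n // ∀ u v, G.Adj u v → f u ≠ f v} :=
      { toFun := fun C => ⟨C, fun u v h => C.valid h⟩
        invFun := fun f => SimpleGraph.Coloring.mk f.1 (fun {u v} h => f.2 u v h)
        left_inv := fun C => rfl
        right_inv := fun f => rfl }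
    rw [Nat.card_congr e, Nat.card_eq_fintype_card, Fintype.card_subtype]
    simp
  rw [hcol, ← Finset.sum_congr rfl (fun f _ => key f), Finset.sum_comm, chromaticPolynomial,
    Polynomial.eval_finsetSum]
  refine Finset.sum_congr rfl fun A hA => ?_
  have hmono := card_monochromatic (SimpleGraph.fromEdgeSet (A : Set (Sym2 V))) n
  have h2 : ∀ f : V → Fin n, ∏ e ∈ A, (-(if (e.map f).IsDiag then (1 : ℤ) else 0))
      = (-1) ^ A.card *
        if (∀ u v, (SimpleGraph.fromEdgeSet (A : Set (Sym2 V))).Adj u v → f u = f v)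
          then 1 else 0 := by
    intro f
    rw [Finset.prod_neg]
    congr 1
    split_ifs with h
    · apply Finset.prod_eq_one
      intro e he
      induction e using Sym2.ind with
      | _ u v =>
        by_cases huv : u = v
        · simp [huv]
        · have := h u v (by simpa [huv] using he)
          simp [this]
    · push Not at h
      obtain ⟨u, v, huv, hf⟩ := h
      apply Finset.prod_eq_zero (i := s(u, v)) (by simpa using huv.1)
      simp [hf]
  rw [Finset.sum_congr rfl (fun f _ => h2 f), ← Finset.mul_sum]
  rw [Nat.card_eq_fintype_card, Fintype.card_subtype] at hmono
  have h3 : (∑ f : V → Fin n,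
      if (∀ u v, (SimpleGraph.fromEdgeSet (A : Set (Sym2 V))).Adj u v → f u = f v)
        then (1 : ℤ) else 0)
      = (n : ℤ) ^ Nat.card (SimpleGraph.fromEdgeSet (A : Set (Sym2 V))).ConnectedComponent := by
    rw [Finset.sum_boole]
    exact_mod_cast hmono
  rw [h3]
  simp

/-! ### Holomorphic quadratic differentials

Throughout, `G` is a finite simple graph on `V`, `B` is the set of boundary vertices, and the
vertices outside `B` are the interior vertices. -/

variable {V : Type*} [Fintype V]

open Classical in
/-- The condition `∑_v q_{uv} = 0` at every interior vertex `u`, for a real function `q` on the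
unoriented edges of `G`; the sum is over the neighbors `v` of `u`. -/
def SumZero (G : SimpleGraph V) (B : Finset V) (q : G.edgeSet → ℝ) : Prop :=
  ∀ u, u ∉ B → ∑ v : G.neighborSet u, q ⟨s(u, v.1), v.2⟩ = 0

open Classical in
/-- The realizations `z : V → ℂ` of `q` with prescribed boundary values `b`: they extend `b`, the
ends of each edge have distinct values (so that no denominator vanishes), and
`∑_v q_{uv} / (z_u - z_v) = 0` at every interior vertex `u`. -/
def realizations (G : SimpleGraph V) (B : Finset V) (b : B → ℂ) (q : G.edgeSet → ℝ) :
    Set (V → ℂ) :=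
  {z | (∀ x : B, z x = b x) ∧ (∀ u v, G.Adj u v → z u ≠ z v) ∧
    ∀ u, u ∉ B → ∑ v : G.neighborSet u, (q ⟨s(u, v.1), v.2⟩ : ℂ) / (z u - z v.1) = 0}

/-- The value at `q` of a polynomial in the edge variables with coefficients in a subfield of `ℂ`. -/
noncomputable def evalAt {G : SimpleGraph V} {K : IntermediateField ℚ ℂ}
    (P : MvPolynomial G.edgeSet K) (q : G.edgeSet → ℝ) : ℂ :=
  MvPolynomial.aeval (fun e => (q e : ℂ)) P

/-- `Φ q` holds for generic `q` satisfying `SumZero`: it holds on a nonempty Zariski open subset,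
defined over the field `K`, of the linear space of all `q` satisfying `SumZero`. -/
def ForGeneric (G : SimpleGraph V) (B : Finset V) (K : IntermediateField ℚ ℂ)
    (Φ : (G.edgeSet → ℝ) → Prop) : Prop :=
  ∃ P : MvPolynomial G.edgeSet K,
    (∃ q, SumZero G B q ∧ evalAt P q ≠ 0) ∧ ∀ q, SumZero G B q → evalAt P q ≠ 0 → Φ q

/-- The values of `q` are algebraically independent over `K` modulo the linear relations `SumZero`:
the only polynomial relations over `K` among them are those valid on the whole linear space. -/
def AlgIndepModSumZero (G : SimpleGraph V) (B : Finset V) (K : IntermediateField ℚ ℂ)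
    (q : G.edgeSet → ℝ) : Prop :=
  SumZero G B q ∧
    ∀ P : MvPolynomial G.edgeSet K, evalAt P q = 0 → ∀ q', SumZero G B q' → evalAt P q' = 0

/-- What holds for generic `q` holds for every `q` whose values are algebraically independent over
`K` modulo the linear relations; so `ForGeneric` covers both descriptions of genericity. -/
theorem ForGeneric.of_algIndep {G : SimpleGraph V} {B : Finset V} {K : IntermediateField ℚ ℂ}
    {Φ : (G.edgeSet → ℝ) → Prop} (h : ForGeneric G B K Φ) {q : G.edgeSet → ℝ}
    (hq : AlgIndepModSumZero G B K q) : Φ q := by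
  obtain ⟨P, ⟨q', hq', hP⟩, hΦ⟩ := h
  exact hΦ q hq.1 fun h0 => hP (hq.2 P h0 q' hq')

end HQD

/-! The Möbius map `z ↦ 1 / (z - b_β)` sends one boundary point to infinity. Since the values of `q`
around an interior vertex sum to zero, the equations keep their shape, and realizations become
critical points of a master function `∏ (x_i - p_a) ^ c_{ia} ∏ (x_i - x_j) ^ W_{ij}`: the indices
`i`, `j` are interior, the `p_a` are the images of the other `k - 1` boundary points, and the
exponents are values of `q`. The zero sums merely determine `q` on the edges at `β`, so the
exponents are arbitrary (`sumZero_iff`, `realizations_eq_image`). A critical point with a zero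
coordinate would put a vertex at infinity, which is why `IsGood` forbids it.

The generic number of critical points satisfies deletion-contraction. Let the weight `t` of an edge
`uv` tend to `0`, and let `F_u` be the equation at `u` without this edge. For nonresonant exponents
no solution escapes to infinity, to a `p_a` or to a remaining diagonal (`sum_mul_force`,
`exists_admissible_tendsto_of_nonResonant`). Limits with `x_u ≠ x_v` are critical points for the
graph with `uv` deleted; limits with `x_u = x_v` are critical points for the graph with `uv`
contracted. Near the latter, the equation `(x_u - x_v) F_u + t = 0` with `F_u ≠ 0` fixes the small
difference `x_u - x_v`. All limits are nondegenerate, so each continues to exactly one critical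
point (`eventually_ncard_criticalPoints`). Without edges the variables separate, and each runs over
the `k - 2` zeros of some `∑ c_a / (x - p_a)`. Recursion and initial value are those of `(-1) ^ n
χ(2 - k)`: contraction loses a vertex, and the sign `(-1) ^ n` turns the difference into a sum.

The deformation only produces good exponents near special ones. However, the projection of a set
given by equations and an inequation contains a nonempty Zariski open set or misses one
(`exists_ne_zero_generic_dichotomy`), and goodness is a combination of such conditions
(`isGood_iff`). Hence it suffices to find good exponents off every given hypersurface. Real `q` are
enough in the end because a nonzero polynomial does not vanish at all rational points. -/

namespace HQD

/-! ### Specialization of algebraic points and generic fibres -/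

/-- A ring homomorphism to an algebraically closed field extends along an injective integral
extension. -/
theorem exists_ringHom_extend_of_isIntegral {R S L : Type*} [CommRing R] [CommRing S] [Algebra R S]
    [Algebra.IsIntegral R S] (hinj : Function.Injective (algebraMap R S)) [Field L] [IsAlgClosed L]
    (φ : R →+* L) : ∃ ψ : S →+* L, ψ.comp (algebraMap R S) = φ := by
  have := RingHom.ker_isPrime φ
  -- Lying over: modulo `ker φ` and a prime `Q` above it, the problem becomes extending an embedding
  -- of a domain into `L` to an integral extension domain.
  obtain ⟨Q, -, hQ, hQP⟩ := Ideal.exists_ideal_over_prime_of_isIntegral (S := S)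
    (RingHom.ker φ) ⊥ (by
      rw [Ideal.comap_bot_of_injective _ hinj]; exact bot_le)
  let P := RingHom.ker φ
  have hle : P ≤ Q.comap (algebraMap R S) := hQP.ge
  let φ' : R ⧸ P →+* L := Ideal.Quotient.lift P φ fun a ha => ha
  have hφ' : Function.Injective φ' := RingHom.kerLift_injective φ
  let _ : Algebra (R ⧸ P) L := φ'.toAlgebra
  let _ : Algebra (R ⧸ P) (S ⧸ Q) := (Ideal.quotientMap Q (algebraMap R S) hle).toAlgebra
  have hinj' : Function.Injective (algebraMap (R ⧸ P) (S ⧸ Q)) :=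
    Ideal.quotientMap_injective' hQP.le
  have : Module.IsTorsionFree (R ⧸ P) L :=
    (faithfulSMul_iff_algebraMap_injective _ _).2 hφ' |>.to_isTorsionFree
  have : Module.IsTorsionFree (R ⧸ P) (S ⧸ Q) :=
    (faithfulSMul_iff_algebraMap_injective _ _).2 hinj' |>.to_isTorsionFree
  have : Algebra.IsIntegral (R ⧸ P) (S ⧸ Q) := by
    constructor
    intro x
    obtain ⟨x, rfl⟩ := Ideal.Quotient.mk_surjective x
    obtain ⟨p, hp, hpx⟩ := Algebra.IsIntegral.isIntegral (R := R) x
    refine ⟨p.map (Ideal.Quotient.mk P), hp.map _, ?_⟩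
    have h1 : (algebraMap (R ⧸ P) (S ⧸ Q)).comp (Ideal.Quotient.mk P)
        = (Ideal.Quotient.mk Q).comp (algebraMap R S) := by
      ext r; exact Ideal.quotientMap_mk (I := Q) (f := algebraMap R S) (H := hle) (x := r)
    rw [Polynomial.eval₂_map, h1, ← Polynomial.hom_eval₂, hpx, map_zero]
  let χ : S ⧸ Q →ₐ[R ⧸ P] L := IsAlgClosed.lift
  refine ⟨χ.toRingHom.comp (Ideal.Quotient.mk Q), ?_⟩
  ext r
  have : χ (algebraMap (R ⧸ P) (S ⧸ Q) (Ideal.Quotient.mk P r)) = φ r := by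
    rw [χ.commutes]; rfl
  rw [← this]
  simp only [RingHom.comp_apply]
  congr 1

/-- Finitely many elements of an algebraic extension of a domain `A` specialize along every
homomorphism from `A` to an algebraically closed field outside a proper closed subset. -/
theorem exists_ne_zero_forall_exists_specialization {A Ω : Type*} [CommRing A] [IsDomain A]
    [Field Ω] [Algebra A Ω] (hinj : Function.Injective (algebraMap A Ω))
    {τ : Type*} [Finite τ] (y : τ → Ω) (hy : ∀ j, IsAlgebraic A (y j)) :
    ∃ a : A, a ≠ 0 ∧ ∀ {L : Type*} [Field L] [IsAlgClosed L] (φ : A →+* L), φ a ≠ 0 →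
      ∃ z : τ → L, ∀ f : MvPolynomial τ A, MvPolynomial.aeval y f = 0 →
        MvPolynomial.eval₂ φ z f = 0 := by
  classical
  cases nonempty_fintype τ
  choose d hd0 hd using fun j => (hy j).exists_integral_multiple
  -- Inverting the product of the denominators `d j` makes every `y j` integral over the
  -- localization, to which `φ` extends as soon as it does not kill the product.
  refine ⟨∏ j, d j, Finset.prod_ne_zero_iff.2 fun j _ => hd0 j, ?_⟩
  intro L _ _ φ hφ
  set a := ∏ j, d j with ha
  have ha0 : a ≠ 0 := Finset.prod_ne_zero_iff.2 fun j _ => hd0 j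
  let ι : Localization.Away a →+* Ω := IsLocalization.Away.lift a (g := algebraMap A Ω)
    (IsUnit.mk0 _ (by simpa using fun h => ha0 (hinj (by simpa using h))))
  have hι : ι.comp (algebraMap A (Localization.Away a)) = algebraMap A Ω :=
    IsLocalization.Away.lift_comp a _
  let _ : Algebra (Localization.Away a) Ω := ι.toAlgebra
  have : IsScalarTower A (Localization.Away a) Ω := IsScalarTower.of_algebraMap_eq' hι.symm
  have hιinj : Function.Injective ι := by
    refine (IsLocalization.lift_injective_iff (M := Submonoid.powers a) _).2 fun x y => ?_
    rw [(IsLocalization.injective (Localization.Away a)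
      (powers_le_nonZeroDivisors_of_noZeroDivisors ha0)).eq_iff, hinj.eq_iff]
  have hyint : ∀ j, IsIntegral (Localization.Away a) (y j) := by
    intro j
    have h1 : IsIntegral (Localization.Away a) (d j • y j) := (hd j).tower_top
    have hu : IsUnit (algebraMap A (Localization.Away a) (d j)) :=
      isUnit_of_dvd_unit (map_dvd _ (Finset.dvd_prod_of_mem d (Finset.mem_univ j)))
        (IsLocalization.Away.algebraMap_isUnit a)
    obtain ⟨u, hu⟩ := hu
    have h2 : y j = ((u⁻¹ : (Localization.Away a)ˣ) : Localization.Away a) • (d j • y j) := by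
      rw [← algebraMap_smul (Localization.Away a) (d j) (y j), ← hu, smul_smul]; simp
    rw [h2]
    exact h1.smul _
  let S := integralClosure (Localization.Away a) Ω
  let φa : Localization.Away a →+* L := IsLocalization.Away.lift a (g := φ) (IsUnit.mk0 _ hφ)
  have hφa : φa.comp (algebraMap A (Localization.Away a)) = φ := IsLocalization.Away.lift_comp a _
  obtain ⟨ψ, hψ⟩ := exists_ringHom_extend_of_isIntegral (S := S) (L := L)
    (fun x y h => hιinj (congrArg Subtype.val h)) φa
  let Y : τ → S := fun j => ⟨y j, hyint j⟩
  refine ⟨fun j => ψ (Y j), fun f hf => ?_⟩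
  have h3 : MvPolynomial.aeval Y f = 0 := by
    apply Subtype.val_injective
    have := MvPolynomial.map_aeval Y (algebraMap S Ω) f
    rw [show (MvPolynomial.aeval Y f).val = algebraMap S Ω (MvPolynomial.aeval Y f) from rfl, this]
    simp only [MvPolynomial.coe_eval₂Hom]
    rw [← IsScalarTower.algebraMap_eq]
    exact hf
  have h4 := MvPolynomial.map_aeval Y ψ f
  rw [h3, map_zero] at h4
  have h5 : ψ.comp (algebraMap A S) = φ := by
    rw [IsScalarTower.algebraMap_eq A (Localization.Away a) S, ← RingHom.comp_assoc, hψ, hφa]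
  rw [h5] at h4
  exact h4.symm

/-- The fibres of a finitely presented scheme over an integral affine base are either
generically nonempty or generically empty. -/
theorem exists_ne_zero_generic_dichotomy {A : Type*} [CommRing A] [IsDomain A] {τ : Type*} [Finite τ]
    (E : Set (MvPolynomial τ A)) (g : MvPolynomial τ A) (L : Type*) [Field L] [IsAlgClosed L] :
    ∃ a : A, a ≠ 0 ∧
      ((∀ φ : A →+* L, φ a ≠ 0 → ∃ z : τ → L,
          (∀ f ∈ E, MvPolynomial.eval₂ φ z f = 0) ∧ MvPolynomial.eval₂ φ z g ≠ 0) ∨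
       (∀ φ : A →+* L, φ a ≠ 0 → ¬ ∃ z : τ → L,
          (∀ f ∈ E, MvPolynomial.eval₂ φ z f = 0) ∧ MvPolynomial.eval₂ φ z g ≠ 0)) := by
  classical
  let F := FractionRing A
  let Ω := AlgebraicClosure F
  by_cases h : ∃ y : τ → Ω, (∀ f ∈ E, MvPolynomial.aeval y f = 0) ∧ MvPolynomial.aeval y g ≠ 0
  · obtain ⟨y, hy, hg⟩ := h
    have halg : ∀ x : Ω, IsAlgebraic A x := fun x =>
      (IsFractionRing.isAlgebraic_iff A F Ω).2 (Algebra.IsAlgebraic.isAlgebraic x)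
    -- The extra coordinate is the inverse of `g(y)`. It turns the inequation `g ≠ 0` into the
    -- equation `g * X none - 1 = 0`, which survives specialization.
    let y' : Option τ → Ω := fun o => o.elim (MvPolynomial.aeval y g)⁻¹ y
    obtain ⟨a, ha, H⟩ := exists_ne_zero_forall_exists_specialization (A := A) (Ω := Ω)
      (by
        rw [IsScalarTower.algebraMap_eq A F Ω]
        exact (algebraMap F Ω).injective.comp (IsFractionRing.injective A F)) y' (fun j => halg _)
    refine ⟨a, ha, Or.inl fun φ hφ => ?_⟩
    obtain ⟨z, hz⟩ := H φ hφ
    have hcomp : ∀ f : MvPolynomial τ A, MvPolynomial.eval₂ φ z (MvPolynomial.rename some f)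
        = MvPolynomial.eval₂ φ (fun j => z (some j)) f := fun f => by
      rw [MvPolynomial.eval₂_rename]; rfl
    have hcomp' : ∀ f : MvPolynomial τ A, MvPolynomial.aeval y' (MvPolynomial.rename some f)
        = MvPolynomial.aeval y f := fun f => by
      rw [MvPolynomial.aeval_rename]; rfl
    refine ⟨fun j => z (some j), fun f hf => ?_, fun h0 => ?_⟩
    · rw [← hcomp]
      exact hz _ (by rw [hcomp', hy f hf])
    · have := hz (MvPolynomial.rename some g * MvPolynomial.X none - 1) (by
        rw [map_sub, map_mul, hcomp']
        simp [y', mul_inv_cancel₀ hg])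
      rw [MvPolynomial.eval₂_sub, MvPolynomial.eval₂_mul, hcomp, h0] at this
      simp at this
  · push Not at h
    let ι : MvPolynomial τ A →+* MvPolynomial τ F := MvPolynomial.map (algebraMap A F)
    let I : Ideal (MvPolynomial τ F) := (Ideal.span E).map ι
    -- Without a solution over the algebraic closure, the Nullstellensatz puts a power of `g` into
    -- the ideal of the equations over the fraction field. Clearing denominators gives `a * g ^ n`
    -- in the ideal over `A`, so no solution exists wherever `a ≠ 0`.
    have hrad : ι g ∈ I.radical := by
      rw [← MvPolynomial.vanishingIdeal_zeroLocus_eq_radical (K := Ω)]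
      rw [MvPolynomial.mem_vanishingIdeal_iff]
      intro x hx
      rw [MvPolynomial.mem_zeroLocus_iff] at hx
      have e : ∀ f, MvPolynomial.aeval x (ι f) = MvPolynomial.aeval x f := fun f =>
        MvPolynomial.aeval_map_algebraMap F x f
      rw [e]
      exact h x fun f hf => by
        rw [← e]; exact hx _ (Ideal.mem_map_of_mem _ (Ideal.subset_span hf))
    obtain ⟨n, hn⟩ := hrad
    rw [← map_pow] at hn
    let _ := MvPolynomial.algebraMvPolynomial (σ := τ) (R := A) (S := F)
    have := (IsLocalization.algebraMap_mem_map_algebraMap_iff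
      ((nonZeroDivisors A).map (MvPolynomial.C (σ := τ))) (MvPolynomial τ F) (Ideal.span E) (g ^ n)).1
      (by rwa [MvPolynomial.algebraMap_def])
    obtain ⟨m, ⟨a, ha, rfl⟩, hm⟩ := this
    refine ⟨a, nonZeroDivisors.ne_zero ha, Or.inr ?_⟩
    rintro φ hφ ⟨z, hz, hzg⟩
    have hmem : Ideal.span E ≤ RingHom.ker (MvPolynomial.eval₂Hom φ z) :=
      Ideal.span_le.2 fun f hf => hz f hf
    have := hmem hm
    rw [RingHom.mem_ker, map_mul, map_pow] at this
    simp [hφ] at this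
    exact hzg this.1

end HQD

namespace HQD

/-! ### Generic points of affine space -/

/-- The filter of subsets of affine space over `ℂ` that contain a nonempty Zariski open set
defined over `K`. -/
def genericFilter (K : Type*) [Field K] [Algebra K ℂ] (σ : Type*) : Filter (σ → ℂ) where
  sets := {U | ∃ P : MvPolynomial σ K, P ≠ 0 ∧ ∀ v, MvPolynomial.aeval v P ≠ 0 → v ∈ U}
  univ_sets := ⟨1, one_ne_zero, fun _ _ => trivial⟩
  sets_of_superset := by
    rintro U W ⟨P, hP, h⟩ hUW
    exact ⟨P, hP, fun v hv => hUW (h v hv)⟩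
  inter_sets := by
    rintro U W ⟨P, hP, h⟩ ⟨Q, hQ, h'⟩
    refine ⟨P * Q, mul_ne_zero hP hQ, fun v hv => ?_⟩
    rw [map_mul] at hv
    exact ⟨h v (left_ne_zero_of_mul hv), h' v (right_ne_zero_of_mul hv)⟩

section Generic

variable {K : Type*} [Field K] [Algebra K ℂ] {σ τ κ : Type*}

theorem mem_genericFilter {U : Set (σ → ℂ)} : U ∈ genericFilter K σ ↔
    ∃ P : MvPolynomial σ K, P ≠ 0 ∧ ∀ v, MvPolynomial.aeval v P ≠ 0 → v ∈ U := Iff.rfl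

/-- A nonzero polynomial does not vanish on a product of infinite sets. -/
theorem exists_aeval_ne_zero {P : MvPolynomial σ K} (hP : P ≠ 0) (s : Set ℂ) (hs : s.Infinite) :
    ∃ v : σ → ℂ, (∀ i, v i ∈ s) ∧ MvPolynomial.aeval v P ≠ 0 := by
  by_contra! h
  have h0 : MvPolynomial.map (algebraMap K ℂ) P = 0 :=
    MvPolynomial.funext_set (fun _ => s) (fun _ => hs) fun x hx => by
      rw [MvPolynomial.eval_map, map_zero]
      exact h x fun i => hx i trivial
  exact hP (MvPolynomial.map_injective _ (algebraMap K ℂ).injective (by rw [h0, map_zero]))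

/-- A polynomial that does not vanish at a point of a polynomial curve has finitely many zeros
on it. -/
theorem finite_aeval_curve_eq_zero (P : MvPolynomial σ K) (γ : σ → Polynomial ℂ) {s₀ : ℂ}
    (h : MvPolynomial.aeval (fun j => (γ j).eval s₀) P ≠ 0) :
    {s : ℂ | MvPolynomial.aeval (fun j => (γ j).eval s) P = 0}.Finite := by
  have key : ∀ s : ℂ, (MvPolynomial.aeval γ P : Polynomial ℂ).eval s
      = MvPolynomial.aeval (fun j => (γ j).eval s) P := by
    intro s
    have := MvPolynomial.map_aeval γ (Polynomial.evalRingHom s) P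
    rw [Polynomial.coe_evalRingHom] at this
    rw [this, MvPolynomial.aeval_def, MvPolynomial.coe_eval₂Hom]
    congr 1
    ext k
    simp [Polynomial.algebraMap_apply]
  have hne : (MvPolynomial.aeval γ P : Polynomial ℂ) ≠ 0 := by
    intro h0
    apply h
    rw [← key, h0, Polynomial.eval_zero]
  refine (Polynomial.finite_setOfPred_isRoot hne).subset fun s hs => ?_
  rw [Set.mem_ofPred_eq, Polynomial.IsRoot, key]
  exact hs

variable (K)

/-- `f` is given on `T` by a quotient of polynomials over `K`. -/
def IsRationalOn (T : Set (κ → ℂ)) (f : (κ → ℂ) → ℂ) : Prop :=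
  ∃ n d : MvPolynomial κ K, ∀ v ∈ T, MvPolynomial.aeval v d ≠ 0 ∧
    f v = MvPolynomial.aeval v n / MvPolynomial.aeval v d

/-- `T` is a locally closed subset of affine space defined over `K` by equations and a single
inequation. -/
def IsBasic (T : Set (κ → ℂ)) : Prop :=
  ∃ (E : Set (MvPolynomial κ K)) (g : MvPolynomial κ K),
    T = {v | (∀ f ∈ E, MvPolynomial.aeval v f = 0) ∧ MvPolynomial.aeval v g ≠ 0}

variable {K}

namespace IsRationalOn

variable {T : Set (κ → ℂ)} {f g : (κ → ℂ) → ℂ}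

theorem congr (h : IsRationalOn K T f) (hfg : ∀ v ∈ T, g v = f v) : IsRationalOn K T g := by
  obtain ⟨n, d, H⟩ := h
  exact ⟨n, d, fun v hv => ⟨(H v hv).1, (hfg v hv).trans (H v hv).2⟩⟩

theorem const (c : K) : IsRationalOn K T fun _ => algebraMap K ℂ c :=
  ⟨MvPolynomial.C c, 1, fun v _ => by simp⟩

theorem zero : IsRationalOn K T fun _ => 0 := (const 0).congr fun _ _ => by simp

theorem one : IsRationalOn K T fun _ => 1 := (const 1).congr fun _ _ => by simp

theorem coord (i : κ) : IsRationalOn K T fun v => v i :=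
  ⟨MvPolynomial.X i, 1, fun v _ => by simp⟩

theorem add (hf : IsRationalOn K T f) (hg : IsRationalOn K T g) :
    IsRationalOn K T fun v => f v + g v := by
  obtain ⟨n, d, H⟩ := hf
  obtain ⟨n', d', H'⟩ := hg
  refine ⟨n * d' + d * n', d * d', fun v hv => ?_⟩
  obtain ⟨h1, h2⟩ := H v hv
  obtain ⟨h3, h4⟩ := H' v hv
  simp only [map_mul, map_add]
  exact ⟨mul_ne_zero h1 h3, by rw [h2, h4, div_add_div _ _ h1 h3]⟩

theorem mul (hf : IsRationalOn K T f) (hg : IsRationalOn K T g) :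
    IsRationalOn K T fun v => f v * g v := by
  obtain ⟨n, d, H⟩ := hf
  obtain ⟨n', d', H'⟩ := hg
  refine ⟨n * n', d * d', fun v hv => ?_⟩
  obtain ⟨h1, h2⟩ := H v hv
  obtain ⟨h3, h4⟩ := H' v hv
  simp only [map_mul]
  exact ⟨mul_ne_zero h1 h3, by rw [h2, h4, div_mul_div_comm]⟩

theorem neg (hf : IsRationalOn K T f) : IsRationalOn K T fun v => - f v :=
  ((const (-1)).mul hf).congr fun _ _ => by simp

theorem sub (hf : IsRationalOn K T f) (hg : IsRationalOn K T g) :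
    IsRationalOn K T fun v => f v - g v :=
  (hf.add hg.neg).congr fun _ _ => sub_eq_add_neg _ _

theorem div (hf : IsRationalOn K T f) (hg : IsRationalOn K T g) (h0 : ∀ v ∈ T, g v ≠ 0) :
    IsRationalOn K T fun v => f v / g v := by
  obtain ⟨n, d, H⟩ := hf
  obtain ⟨n', d', H'⟩ := hg
  refine ⟨n * d', d * n', fun v hv => ?_⟩
  obtain ⟨h1, h2⟩ := H v hv
  obtain ⟨h3, h4⟩ := H' v hv
  have h5 := h0 v hv
  rw [h4] at h5
  have h6 : MvPolynomial.aeval v n' ≠ 0 := fun h => h5 (by rw [h, zero_div])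
  simp only [map_mul]
  exact ⟨mul_ne_zero h1 h6, by rw [h2, h4, div_div_div_eq]⟩

theorem sum {ι : Type*} (s : Finset ι) {f : ι → (κ → ℂ) → ℂ} (h : ∀ i, IsRationalOn K T (f i)) :
    IsRationalOn K T fun v => ∑ i ∈ s, f i v := by
  classical
  induction s using Finset.induction_on with
  | empty => exact zero.congr fun _ _ => by simp
  | insert a s ha ih => exact ((h a).add ih).congr fun _ _ => Finset.sum_insert ha

theorem pow (hf : IsRationalOn K T f) (n : ℕ) : IsRationalOn K T fun v => f v ^ n := by
  induction n with
  | zero => exact one.congr fun _ _ => pow_zero _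
  | succ n ih => exact (ih.mul hf).congr fun _ _ => pow_succ _ _

theorem ite {p : Prop} {_ : Decidable p} (hf : p → IsRationalOn K T f) (hg : ¬ p → IsRationalOn K T g) :
    IsRationalOn K T fun v => if p then f v else g v := by
  split_ifs with h
  exacts [hf h, hg h]

theorem aeval {F : (κ → ℂ) → σ → ℂ} (hF : ∀ j, IsRationalOn K T fun v => F v j)
    (P : MvPolynomial σ K) : IsRationalOn K T fun v => MvPolynomial.aeval (F v) P := by
  induction P using MvPolynomial.induction_on with
  | C a => exact (const a).congr fun _ _ => by simp
  | add p q hp hq => exact (hp.add hq).congr fun _ _ => by simp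
  | mul_X p i hp => exact (hp.mul (hF i)).congr fun _ _ => by simp

/-- A rational function that is nonzero at a point is generically nonzero. -/
theorem eventually_ne_zero (h : IsRationalOn K Set.univ f) {v : κ → ℂ} (hv : f v ≠ 0) :
    ∀ᶠ v in genericFilter K κ, f v ≠ 0 := by
  obtain ⟨n, d, H⟩ := h
  refine mem_genericFilter.2 ⟨n, ?_, fun w hw => ?_⟩
  · rintro rfl
    exact hv (by rw [(H v trivial).2]; simp)
  · rw [Set.mem_ofPred_eq, (H w trivial).2]
    exact div_ne_zero hw (H w trivial).1

end IsRationalOn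

/-- A surjective map defined over `K` sends generic points to generic points. -/
theorem tendsto_genericFilter {F : (κ → ℂ) → σ → ℂ}
    (hF : ∀ j, IsRationalOn K Set.univ fun v => F v j) (hsurj : Function.Surjective F) :
    Filter.Tendsto F (genericFilter K κ) (genericFilter K σ) := by
  intro U hU
  obtain ⟨P, hP, H⟩ := mem_genericFilter.1 hU
  obtain ⟨w, -, hw⟩ := exists_aeval_ne_zero hP Set.univ Set.infinite_univ
  obtain ⟨v, rfl⟩ := hsurj w
  exact ((IsRationalOn.aeval hF P).eventually_ne_zero hw).mono fun v hv => H _ hv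

namespace IsBasic

variable {T T' : Set (κ → ℂ)}

theorem univ : IsBasic K (Set.univ : Set (κ → ℂ)) := ⟨∅, 1, by simp⟩

theorem inter (h : IsBasic K T) (h' : IsBasic K T') : IsBasic K (T ∩ T') := by
  obtain ⟨E, g, rfl⟩ := h
  obtain ⟨E', g', rfl⟩ := h'
  refine ⟨E ∪ E', g * g', ?_⟩
  ext v
  simp only [Set.mem_inter_iff, Set.mem_ofPred_eq, Set.mem_union, map_mul, mul_ne_zero_iff]
  constructor
  · rintro ⟨⟨h1, h2⟩, h3, h4⟩
    exact ⟨fun f hf => hf.elim (h1 f) (h3 f), h2, h4⟩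
  · rintro ⟨h1, h2, h3⟩
    exact ⟨⟨fun f hf => h1 f (Or.inl hf), h2⟩, fun f hf => h1 f (Or.inr hf), h3⟩

theorem sep_eq_zero (h : IsBasic K T) {f : (κ → ℂ) → ℂ} (hf : IsRationalOn K T f) :
    IsBasic K {v ∈ T | f v = 0} := by
  obtain ⟨n, d, H⟩ := hf
  have : {v ∈ T | f v = 0} = T ∩ {v | (∀ f ∈ ({n} : Set (MvPolynomial κ K)),
      MvPolynomial.aeval v f = 0) ∧ MvPolynomial.aeval v (1 : MvPolynomial κ K) ≠ 0} := by
    ext v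
    simp only [Set.mem_ofPred_eq, Set.mem_inter_iff, Set.mem_singleton_iff, forall_eq, map_one, ne_eq,
      one_ne_zero, not_false_eq_true, and_true]
    refine and_congr_right fun hv => ?_
    rw [(H v hv).2, div_eq_zero_iff]
    simp [(H v hv).1]
  rw [this]
  exact h.inter ⟨_, _, rfl⟩

theorem sep_ne_zero (h : IsBasic K T) {f : (κ → ℂ) → ℂ} (hf : IsRationalOn K T f) :
    IsBasic K {v ∈ T | f v ≠ 0} := by
  obtain ⟨n, d, H⟩ := hf
  have : {v ∈ T | f v ≠ 0} = T ∩ {v | (∀ f ∈ (∅ : Set (MvPolynomial κ K)),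
      MvPolynomial.aeval v f = 0) ∧ MvPolynomial.aeval v n ≠ 0} := by
    ext v
    simp only [Set.mem_ofPred_eq, Set.mem_inter_iff, Set.mem_empty_iff_false, false_imp_iff,
      implies_true, true_and]
    refine and_congr_right fun hv => ?_
    rw [(H v hv).2, ne_eq, div_eq_zero_iff]
    simp [(H v hv).1]
  rw [this]
  exact h.inter ⟨_, _, rfl⟩

theorem sep_forall {ι : Type*} [Finite ι] {p : ι → (κ → ℂ) → Prop} (hT : IsBasic K T)
    (h : ∀ i, IsBasic K {v ∈ T | p i v}) : IsBasic K {v ∈ T | ∀ i, p i v} := by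
  classical
  cases nonempty_fintype ι
  suffices ∀ s : Finset ι, IsBasic K {v ∈ T | ∀ i ∈ s, p i v} by simpa using this Finset.univ
  intro s
  induction s using Finset.induction_on with
  | empty => simpa using hT
  | insert a s ha ih =>
    convert (h a).inter ih using 1
    ext v
    simp only [Set.mem_ofPred_eq, Finset.mem_insert, Set.mem_inter_iff, forall_eq_or_imp]
    tauto

theorem sep_imp {q : Prop} {p : (κ → ℂ) → Prop} (hT : IsBasic K T)
    (h : q → IsBasic K {v ∈ T | p v}) : IsBasic K {v ∈ T | q → p v} := by
  by_cases hq : q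
  · simpa [hq] using h hq
  · simpa [hq] using hT

/-- The projection of a set defined by equations and inequations is either generic or
has generic complement. -/
theorem eventually_exists_or [Finite τ] {T : Set (τ ⊕ σ → ℂ)} (hT : IsBasic K T) :
    (∀ᶠ v in genericFilter K σ, ∃ y, Sum.elim y v ∈ T) ∨
      ∀ᶠ v in genericFilter K σ, ¬ ∃ y, Sum.elim y v ∈ T := by
  obtain ⟨E, g, rfl⟩ := hT
  -- Polynomials in both groups of variables are polynomials in the `τ`-variables over the domain
  -- `MvPolynomial σ K`, and a point `v` is a homomorphism from that domain to `ℂ`.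
  let e := MvPolynomial.sumAlgEquiv K τ σ
  have key : ∀ (y : τ → ℂ) (v : σ → ℂ) (f : MvPolynomial (τ ⊕ σ) K),
      MvPolynomial.eval₂ (MvPolynomial.aeval v : MvPolynomial σ K →ₐ[K] ℂ).toRingHom y (e f)
        = MvPolynomial.aeval (Sum.elim y v) f := by
    intro y v f
    induction f using MvPolynomial.induction_on with
    | C a =>
      have : e (MvPolynomial.C a) = MvPolynomial.C (MvPolynomial.C a) :=
        MvPolynomial.sumAlgEquiv_C_inl K τ σ a
      simp [this]
    | add p q hp hq => rw [map_add, MvPolynomial.eval₂_add, hp, hq, map_add]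
    | mul_X p i hp =>
      rw [map_mul, MvPolynomial.eval₂_mul, hp, map_mul]
      congr 1
      rcases i with i | i
      · have : e (MvPolynomial.X (Sum.inl i)) = MvPolynomial.X i :=
          MvPolynomial.sumAlgEquiv_X_inl K τ σ i
        simp [this]
      · have : e (MvPolynomial.X (Sum.inr i)) = MvPolynomial.C (MvPolynomial.X i) :=
          MvPolynomial.sumAlgEquiv_X_inr K τ σ i
        simp [this]
  obtain ⟨a, ha, h⟩ := exists_ne_zero_generic_dichotomy (e '' E) (e g) ℂ
  refine h.imp (fun h => mem_genericFilter.2 ⟨a, ha, fun v hv => ?_⟩)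
    (fun h => mem_genericFilter.2 ⟨a, ha, fun v hv => ?_⟩)
  · obtain ⟨z, hz, hg⟩ := h (MvPolynomial.aeval v : MvPolynomial σ K →ₐ[K] ℂ).toRingHom hv
    refine ⟨z, fun f hf => ?_, ?_⟩
    · rw [← key]; exact hz _ ⟨f, hf, rfl⟩
    · rw [← key]; exact hg
  · rintro ⟨y, hy, hg⟩
    refine h (MvPolynomial.aeval v : MvPolynomial σ K →ₐ[K] ℂ).toRingHom hv ⟨y, ?_, ?_⟩
    · rintro _ ⟨f, hf, rfl⟩
      rw [key]; exact hy f hf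
    · rw [key]; exact hg

/-- The dichotomy upgrades density to genericity: a projection that is met outside every proper
closed set contains a nonempty open set. -/
theorem eventually_exists_of_frequently [Finite τ] {T : Set (τ ⊕ σ → ℂ)} (hT : IsBasic K T)
    (h : ∃ᶠ v in genericFilter K σ, ∃ y, Sum.elim y v ∈ T) :
    ∀ᶠ v in genericFilter K σ, ∃ y, Sum.elim y v ∈ T :=
  hT.eventually_exists_or.resolve_right h

theorem eventually_not_exists_of_frequently [Finite τ] {T : Set (τ ⊕ σ → ℂ)} (hT : IsBasic K T)
    (h : ∃ᶠ v in genericFilter K σ, ¬ ∃ y, Sum.elim y v ∈ T) :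
    ∀ᶠ v in genericFilter K σ, ¬ ∃ y, Sum.elim y v ∈ T :=
  hT.eventually_exists_or.resolve_left fun h' => h (h'.mono fun _ hv hn => hn hv)

end IsBasic

end Generic

end HQD

namespace HQD

/-! ### Persistence of nondegenerate zeros -/

section Persistence

open Filter Topology

variable {E : Type*} [NormedAddCommGroup E] [NormedSpace ℂ E] [FiniteDimensional ℂ E]

/-- A nondegenerate zero of a family of equations deforms to a unique nearby zero. -/
theorem exists_nhds_existsUnique_zero {H : E × ℂ → E} {z : E} (hH : ContDiffAt ℂ 1 H (z, 0))
    (hz : H (z, 0) = 0) (hnd : ∀ ξ : E, fderiv ℂ H (z, 0) (ξ, 0) = 0 → ξ = 0)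
    {N : Set E} (hN : N ∈ 𝓝 z) :
    ∃ W ∈ 𝓝 z, W ⊆ N ∧ ∀ᶠ t : ℂ in 𝓝 0, ∃ x ∈ W, H (x, t) = 0 ∧
      ∀ y ∈ W, H (y, t) = 0 → y = x := by
  have : CompleteSpace E := FiniteDimensional.complete ℂ E
  have hs : HasStrictFDerivAt H (fderiv ℂ H (z, 0)) (z, 0) := hH.hasStrictFDerivAt one_ne_zero
  -- Recording `t` as well makes source and target equidimensional. The derivative of `Ψ` is
  -- injective because the partial derivative of `H` along `E` is, so the inverse function theorem
  -- applies.
  let Ψ : E × ℂ → E × ℂ := fun p => (H p, p.2)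
  let L : (E × ℂ) →L[ℂ] (E × ℂ) := (fderiv ℂ H (z, 0)).prod (ContinuousLinearMap.snd ℂ E ℂ)
  have hΨ : HasStrictFDerivAt Ψ L (z, 0) := hs.prodMk hasStrictFDerivAt_snd
  have hLinj : Function.Injective (L : (E × ℂ) →ₗ[ℂ] (E × ℂ)) := by
    refine (injective_iff_map_eq_zero _).2 ?_
    rintro ⟨ξ, s⟩ h
    have h1 : fderiv ℂ H (z, 0) (ξ, s) = 0 := congrArg Prod.fst h
    have h2 : s = 0 := congrArg Prod.snd h
    subst h2
    rw [hnd ξ h1]; rfl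
  let e : (E × ℂ) ≃L[ℂ] (E × ℂ) :=
    (LinearEquiv.ofInjectiveEndo (L : (E × ℂ) →ₗ[ℂ] (E × ℂ)) hLinj).toContinuousLinearEquiv
  have he : (e : (E × ℂ) →L[ℂ] (E × ℂ)) = L := by ext <;> rfl
  rw [← he] at hΨ
  let Φ := hΨ.toOpenPartialHomeomorph Ψ
  have hsrc : Φ.source ∈ 𝓝 (z, (0 : ℂ)) := Φ.open_source.mem_nhds hΨ.mem_toOpenPartialHomeomorph_source
  rw [nhds_prod_eq, mem_prod_iff] at hsrc
  obtain ⟨W₀, hW₀, T₀, hT₀, hsub⟩ := hsrc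
  refine ⟨W₀ ∩ N, inter_mem hW₀ hN, Set.inter_subset_right, ?_⟩
  have hΨz : Ψ (z, 0) = (0, 0) := by simp [Ψ, hz]
  have hinv : Tendsto (hΨ.localInverse Ψ e (z, 0)) (𝓝 (0, 0)) (𝓝 (z, 0)) := by
    have := hΨ.localInverse_tendsto
    rwa [hΨz] at this
  have hright : ∀ᶠ p in 𝓝 ((0, 0) : E × ℂ), Ψ (hΨ.localInverse Ψ e (z, 0) p) = p := by
    have := hΨ.eventually_right_inverse
    rwa [hΨz] at this
  have hline : Tendsto (fun t : ℂ => ((0 : E), t)) (𝓝 0) (𝓝 (0, 0)) :=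
    (by fun_prop : Continuous fun t : ℂ => ((0 : E), t)).tendsto' _ _ rfl
  have h3 : ∀ᶠ p in 𝓝 ((0, 0) : E × ℂ), (hΨ.localInverse Ψ e (z, 0) p).1 ∈ W₀ ∩ N :=
    ((continuous_fst.tendsto (z, (0 : ℂ))).comp hinv) (inter_mem hW₀ hN)
  filter_upwards [hline.eventually hright, hline.eventually h3, hT₀] with t h4 h5 h6
  set q := hΨ.localInverse Ψ e (z, 0) (0, t) with hq
  have h7 : H q = 0 := congrArg Prod.fst h4
  have h8 : q.2 = t := congrArg Prod.snd h4
  have h9 : q = (q.1, t) := by rw [← h8]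
  refine ⟨q.1, h5, by rwa [← h9], fun y hy hyt => ?_⟩
  have h10 : Φ (y, t) = Φ (q.1, t) := by
    change Ψ (y, t) = Ψ (q.1, t)
    rw [← h9, h4]
    exact Prod.ext hyt rfl
  have h11 : (q.1, t) ∈ Φ.source := hsub ⟨h5.1, h6⟩
  exact congrArg Prod.fst (Φ.injOn (hsub ⟨hy.1, h6⟩) h11 h10)

/-- In finite dimension an injective endomorphism is invertible, invertible operators form an open
set, and the partial derivative varies continuously. -/
theorem eventually_fderiv_injective {H : E × ℂ → E} {z : E} (hH : ContDiffAt ℂ 1 H (z, 0))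
    (hnd : ∀ ξ : E, fderiv ℂ H (z, 0) (ξ, 0) = 0 → ξ = 0) :
    ∀ᶠ p in 𝓝 (z, (0 : ℂ)), ∀ ξ : E, fderiv ℂ H p (ξ, 0) = 0 → ξ = 0 := by
  have : CompleteSpace E := FiniteDimensional.complete ℂ E
  let A : E × ℂ → (E →L[ℂ] E) := fun p => (fderiv ℂ H p).comp (ContinuousLinearMap.inl ℂ E ℂ)
  have hA : ContinuousAt A (z, 0) := (hH.continuousAt_fderiv one_ne_zero).clm_comp continuousAt_const
  have hinj : Function.Injective (A (z, 0) : E →ₗ[ℂ] E) :=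
    (injective_iff_map_eq_zero _).2 fun ξ h => hnd ξ h
  let e : E ≃L[ℂ] E := (LinearEquiv.ofInjectiveEndo (A (z, 0) : E →ₗ[ℂ] E) hinj).toContinuousLinearEquiv
  have he : (e : E →L[ℂ] E) = A (z, 0) := by ext; rfl
  have := e.nhds
  rw [he] at this
  filter_upwards [hA this] with p hp ξ hξ
  obtain ⟨e', he'⟩ := hp
  apply e'.injective
  rw [map_zero]
  change (e' : E →L[ℂ] E) ξ = 0
  rw [he']
  exact hξ

/-- If the zeros of a family at `t = 0` are nondegenerate and no zero escapes as `t → 0`, then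
the number of zeros is constant for small `t`. -/
theorem eventually_ncard_zeros_eq {H : E × ℂ → E} {D : Set E} (hD : IsOpen D)
    (hH : ∀ x ∈ D, ContDiffAt ℂ 1 H (x, 0))
    (hfin : {x ∈ D | H (x, 0) = 0}.Finite)
    (hnd : ∀ x ∈ D, H (x, 0) = 0 → ∀ ξ : E, fderiv ℂ H (x, 0) (ξ, 0) = 0 → ξ = 0)
    (hproper : ∀ U : Ultrafilter ℂ, (U : Filter ℂ) ≤ 𝓝[≠] 0 → ∀ x : ℂ → E,
      (∀ᶠ t in U, x t ∈ D ∧ H (x t, t) = 0) → ∃ z ∈ D, Tendsto x U (𝓝 z))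
    {S : Set E} (hS : IsOpen S) (hS0 : {x ∈ D | H (x, 0) = 0} ⊆ S) :
    ∀ᶠ t in 𝓝[≠] (0 : ℂ), {x ∈ D | H (x, t) = 0}.Finite ∧
      {x ∈ D | H (x, t) = 0}.ncard = {x ∈ D | H (x, 0) = 0}.ncard ∧
      ∀ x ∈ D, H (x, t) = 0 → x ∈ S ∧ ∀ ξ : E, fderiv ℂ H (x, t) (ξ, 0) = 0 → ξ = 0 := by
  classical
  set Z := {x ∈ D | H (x, 0) = 0} with hZ
  obtain ⟨V, hV, hVdisj⟩ := hfin.t2_separation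
  have hloc : ∀ z ∈ Z, ∃ W ∈ 𝓝 z, W ⊆ V z ∩ D ∩ S ∧
      (∀ᶠ t : ℂ in 𝓝 0, ∀ x ∈ W, ∀ ξ : E, fderiv ℂ H (x, t) (ξ, 0) = 0 → ξ = 0) ∧
      ∀ᶠ t : ℂ in 𝓝 0, ∃ x ∈ W, H (x, t) = 0 ∧ ∀ y ∈ W, H (y, t) = 0 → y = x := by
    intro z hz
    have h1 := eventually_fderiv_injective (hH z hz.1) (hnd z hz.1 hz.2)
    rw [nhds_prod_eq, eventually_prod_iff] at h1
    obtain ⟨pa, hpa, pb, hpb, hp⟩ := h1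
    obtain ⟨W, hW, hWN, h⟩ := exists_nhds_existsUnique_zero (hH z hz.1) hz.2 (hnd z hz.1 hz.2)
      (N := (V z ∩ D ∩ S) ∩ {x | pa x})
      (inter_mem (inter_mem (inter_mem ((hV z).2.mem_nhds (hV z).1) (hD.mem_nhds hz.1))
        (hS.mem_nhds (hS0 hz))) hpa)
    exact ⟨W, hW, fun x hx => (hWN hx).1, hpb.mono fun t ht x hx => hp (hWN hx).2 ht, h⟩
  choose! W hWn hWsub hWnd hWex using hloc
  -- Zeros avoiding all the neighborhoods `W z` for `t` arbitrarily close to `0` would converge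
  -- along an ultrafilter to a point of `D`. By continuity it is a zero at `t = 0`, hence some `z ∈
  -- Z`, and the zeros would enter `W z`.
  have hcatch : ∀ᶠ t in 𝓝[≠] (0 : ℂ), ∀ x ∈ D, H (x, t) = 0 → ∃ z ∈ Z, x ∈ W z := by
    by_contra hcon
    have hfreq : ∃ᶠ t in 𝓝[≠] (0 : ℂ), ∃ x, x ∈ D ∧ H (x, t) = 0 ∧ ∀ z ∈ Z, x ∉ W z := by
      refine (not_eventually.1 hcon).mono fun t ht => ?_
      push Not at ht
      exact ht
    have hne := Filter.frequently_iff_neBot.1 hfreq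
    let U := Ultrafilter.of (𝓝[≠] (0 : ℂ) ⊓ 𝓟 {t | ∃ x, x ∈ D ∧ H (x, t) = 0 ∧ ∀ z ∈ Z, x ∉ W z})
    have hU : (U : Filter ℂ) ≤ _ := Ultrafilter.of_le _
    have hU1 : (U : Filter ℂ) ≤ 𝓝[≠] 0 := hU.trans inf_le_left
    have hU2 : ∀ᶠ t in (U : Filter ℂ), ∃ x, x ∈ D ∧ H (x, t) = 0 ∧ ∀ z ∈ Z, x ∉ W z :=
      le_principal_iff.1 (hU.trans inf_le_right)
    obtain ⟨x, hx⟩ : ∃ x : ℂ → E, ∀ᶠ t in (U : Filter ℂ), x t ∈ D ∧ H (x t, t) = 0 ∧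
        ∀ z ∈ Z, x t ∉ W z := hU2.choice
    obtain ⟨z, hzD, hzlim⟩ := hproper U hU1 x (hx.mono fun t ht => ⟨ht.1, ht.2.1⟩)
    have hlim0 : Tendsto (fun t : ℂ => t) U (𝓝 0) := hU1.trans nhdsWithin_le_nhds
    have h1 : Tendsto (fun t => H (x t, t)) U (𝓝 (H (z, 0))) :=
      (hH z hzD).continuousAt.tendsto.comp (hzlim.prodMk_nhds hlim0)
    have h2 : H (z, 0) = 0 := tendsto_nhds_unique h1
      (tendsto_const_nhds.congr' (hx.mono fun t ht => ht.2.1.symm))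
    obtain ⟨t, ht1, ht2⟩ := (hx.and (hzlim (hWn z ⟨hzD, h2⟩))).exists
    exact ht1.2.2 z ⟨hzD, h2⟩ ht2
  have hall1 : ∀ᶠ t in 𝓝[≠] (0 : ℂ), ∀ z ∈ Z, ∀ x ∈ W z, ∀ ξ : E,
      fderiv ℂ H (x, t) (ξ, 0) = 0 → ξ = 0 :=
    (hfin.eventually_all).2 fun z hz => nhdsWithin_le_nhds (hWnd z hz)
  have hall2 : ∀ᶠ t in 𝓝[≠] (0 : ℂ), ∀ z ∈ Z, ∃ x ∈ W z, H (x, t) = 0 ∧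
      ∀ y ∈ W z, H (y, t) = 0 → y = x :=
    (hfin.eventually_all).2 fun z hz => nhdsWithin_le_nhds (hWex z hz)
  filter_upwards [hcatch, hall1, hall2] with t h1 h2 h3
  choose! f hfW hf0 hfu using h3
  have himg : {x ∈ D | H (x, t) = 0} = f '' Z := by
    ext x
    constructor
    · rintro ⟨hxD, hx0⟩
      obtain ⟨z, hz, hxz⟩ := h1 x hxD hx0
      exact ⟨z, hz, (hfu z hz x hxz hx0).symm⟩
    · rintro ⟨z, hz, rfl⟩
      exact ⟨(hWsub z hz (hfW z hz)).1.2, hf0 z hz⟩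
  have hinj : Set.InjOn f Z := by
    intro z hz w hw h
    by_contra hne
    have hd := hVdisj hz hw hne
    exact Set.disjoint_left.1 hd (hWsub z hz (hfW z hz)).1.1 (h ▸ (hWsub w hw (hfW w hw)).1.1)
  refine ⟨himg ▸ hfin.image f, by rw [himg, hinj.ncard_image], fun x hxD hx0 => ?_⟩
  obtain ⟨z, hz, hxz⟩ := h1 x hxD hx0
  exact ⟨(hWsub z hz hxz).2, h2 z hz x hxz⟩

end Persistence

end HQD

namespace HQD

/-! ### Critical points of master functions -/

section Force

open Filter Topology

variable {I A : Type*} [Fintype I] [Fintype A]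

/-- The logarithmic derivative in the `i`-th variable of the master function
`∏ (x_i - p_a) ^ c_{ia} ∏ (x_i - x_j) ^ W_{ij}`. -/
noncomputable def force (p : A → ℂ) (c : I → A → ℂ) (W : I → I → ℂ) (x : I → ℂ) (i : I) : ℂ :=
  ∑ a, c i a / (x i - p a) + ∑ j, W i j / (x i - x j)

/-- The derivative of `force` at `x` in the direction `ξ`. -/
noncomputable def forceDeriv (p : A → ℂ) (c : I → A → ℂ) (W : I → I → ℂ) (x ξ : I → ℂ) (i : I) : ℂ :=
  ∑ a, -(c i a * ξ i) / (x i - p a) ^ 2 + ∑ j, -(W i j * (ξ i - ξ j)) / (x i - x j) ^ 2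

/-- The configurations at which the equations with graph `G` are defined. -/
def admissible (G : SimpleGraph I) (p : A → ℂ) : Set (I → ℂ) :=
  {x | (∀ i a, x i ≠ p a) ∧ ∀ i j, G.Adj i j → x i ≠ x j}

theorem isOpen_admissible (G : SimpleGraph I) (p : A → ℂ) : IsOpen (admissible G p) := by
  have : admissible G p = (⋂ i, ⋂ a, {x | x i ≠ p a}) ∩
      ⋂ i, ⋂ j, ⋂ _ : G.Adj i j, {x | x i ≠ x j} := by
    ext x; simp [admissible]
  rw [this]
  refine (isOpen_iInter_of_finite fun i => isOpen_iInter_of_finite fun a => ?_).inter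
    (isOpen_iInter_of_finite fun i => isOpen_iInter_of_finite fun j =>
      isOpen_iInter_of_finite fun _ => ?_)
  · exact isOpen_ne_fun (by fun_prop) (by fun_prop)
  · exact isOpen_ne_fun (by fun_prop) (by fun_prop)

variable {p : A → ℂ} {c : I → A → ℂ} {W : I → I → ℂ}

theorem hasDerivAt_force {x : I → ℂ} (hp : ∀ i a, x i ≠ p a) (hW : ∀ i j, W i j ≠ 0 → x i ≠ x j)
    (ξ : I → ℂ) (i : I) :
    HasDerivAt (fun s : ℂ => force p c W (x + s • ξ) i) (forceDeriv p c W x ξ i) 0 := by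
  unfold force forceDeriv
  have hline : ∀ k, HasDerivAt (fun s : ℂ => (x + s • ξ) k) (ξ k) 0 := by
    intro k
    have := ((hasDerivAt_id (0 : ℂ)).mul_const (ξ k)).const_add (x k)
    simpa using this
  refine HasDerivAt.add (HasDerivAt.fun_sum fun a _ => ?_) (HasDerivAt.fun_sum fun j _ => ?_)
  · have h := (hasDerivAt_const (0 : ℂ) (c i a)).fun_div ((hline i).sub_const (p a))
      (by simpa [sub_eq_zero] using hp i a)
    simpa using h
  -- A summand of weight zero vanishes identically, so nothing is required of `x i - x j` there.
  · by_cases h0 : W i j = 0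
    · simpa [h0] using hasDerivAt_const (0 : ℂ) (0 : ℂ)
    · have h := (hasDerivAt_const (0 : ℂ) (W i j)).fun_div ((hline i).fun_sub (hline j))
        (by simpa [sub_eq_zero] using hW i j h0)
      simpa using h

theorem contDiffAt_force {x : I → ℂ} (hp : ∀ i a, x i ≠ p a) (hW : ∀ i j, W i j ≠ 0 → x i ≠ x j)
    (i : I) : ContDiffAt ℂ 1 (fun x => force p c W x i) x := by
  unfold force
  have hcoord : ∀ k, ContDiffAt ℂ 1 (fun x : I → ℂ => x k) x := fun k =>
    (contDiff_apply ℂ ℂ k).contDiffAt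
  refine ContDiffAt.add (ContDiffAt.sum fun a _ => ?_) (ContDiffAt.sum fun j _ => ?_)
  · exact contDiffAt_const.div ((hcoord i).sub contDiffAt_const) (sub_ne_zero.2 (hp i a))
  · by_cases h0 : W i j = 0
    · simpa [h0] using contDiffAt_const
    · exact contDiffAt_const.div ((hcoord i).sub (hcoord j)) (sub_ne_zero.2 (hW i j h0))

/-- The contribution to `∑_{i ∈ S} (x_i - y) force_i` of the pairs inside `S` does not depend on
`x` and `y`. -/
theorem sum_mul_force [DecidableEq I] (hsymm : ∀ i j, W i j = W j i) {x : I → ℂ}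
    (hW : ∀ i j, W i j ≠ 0 → x i ≠ x j) (S : Finset I) (y : ℂ) :
    ∑ i ∈ S, (x i - y) * force p c W x i =
      ∑ i ∈ S, (∑ a, c i a * ((x i - y) / (x i - p a)) +
        ∑ j ∈ Sᶜ, W i j * ((x i - y) / (x i - x j))) + (∑ i ∈ S, ∑ j ∈ S, W i j) / 2 := by
  have h1 : ∀ i, (x i - y) * force p c W x i = ∑ a, c i a * ((x i - y) / (x i - p a)) +
      (∑ j ∈ Sᶜ, W i j * ((x i - y) / (x i - x j)) +
       ∑ j ∈ S, W i j * ((x i - y) / (x i - x j))) := by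
    intro i
    rw [Finset.sum_compl_add_sum, force, mul_add, Finset.mul_sum, Finset.mul_sum]
    congr 1 <;> exact Finset.sum_congr rfl fun _ _ => by ring
  rw [Finset.sum_congr rfl fun i _ => h1 i]
  simp only [← add_assoc]
  rw [Finset.sum_add_distrib]
  congr 1
  have h2 : ∑ i ∈ S, ∑ j ∈ S, W i j * ((x i - y) / (x i - x j))
      = ∑ i ∈ S, ∑ j ∈ S, W i j * ((x j - y) / (x j - x i)) := by
    rw [Finset.sum_comm]
    exact Finset.sum_congr rfl fun i _ => Finset.sum_congr rfl fun j _ => by rw [hsymm]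
  -- The pairs `(i, j)` and `(j, i)` are combined: `(x_i - y) / (x_i - x_j) + (x_j - y) / (x_j -
  -- x_i) = 1`.
  have h3 : ∑ i ∈ S, ∑ j ∈ S, W i j = ∑ i ∈ S, ∑ j ∈ S, W i j * ((x i - y) / (x i - x j)) +
      ∑ i ∈ S, ∑ j ∈ S, W i j * ((x j - y) / (x j - x i)) := by
    simp only [← Finset.sum_add_distrib]
    refine Finset.sum_congr rfl fun i _ => Finset.sum_congr rfl fun j _ => ?_
    by_cases h0 : W i j = 0
    · simp [h0]
    · have h4 := sub_ne_zero.2 (hW i j h0)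
      have h5 := sub_ne_zero.2 (hW i j h0).symm
      have h6 : x j - x i = -(x i - x j) := by ring
      rw [← mul_add, h6, div_neg, ← sub_eq_add_neg, ← sub_div, sub_sub_sub_cancel_right,
        div_self h4, mul_one]
  rw [h3, ← h2]
  ring

/-- The exponents are nonresonant: no solution can escape to infinity, to a point `p_a`, or to a
diagonal `x_i = x_j` with `i`, `j` adjacent in `G`. -/
structure NonResonant [DecidableEq I] (G : SimpleGraph I) (c : I → A → ℂ) (W : I → I → ℂ) :
    Prop where
  infinity : ∀ S : Finset I, S.Nonempty →
    ∑ i ∈ S, (∑ a, c i a + ∑ j ∈ Sᶜ, W i j) + (∑ i ∈ S, ∑ j ∈ S, W i j) / 2 ≠ 0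
  point : ∀ S : Finset I, S.Nonempty → ∀ a,
    ∑ i ∈ S, c i a + (∑ i ∈ S, ∑ j ∈ S, W i j) / 2 ≠ 0
  diagonal : ∀ S : Finset I, (∃ i ∈ S, ∃ j ∈ S, G.Adj i j) → ∑ i ∈ S, ∑ j ∈ S, W i j ≠ 0

variable [DecidableEq I] {ι : Type*}

/-- If `y(t)` and the quotients below converge, the limit of the identity `sum_mul_force` holds. -/
theorem limit_sum_mul_force {U : Filter ι} [U.NeBot] {Wt : ι → I → I → ℂ}
    (hsymm : ∀ t i j, Wt t i j = Wt t j i) (hWt : ∀ i j, Tendsto (fun t => Wt t i j) U (𝓝 (W i j)))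
    {x : ι → I → ℂ} (hx : ∀ᶠ t in U, (∀ i j, Wt t i j ≠ 0 → x t i ≠ x t j) ∧
      ∀ i, force p c (Wt t) (x t) i = 0) (S : Finset I) (y : ι → ℂ)
    {α : I → A → ℂ} {β : I → I → ℂ}
    (hα : ∀ i ∈ S, ∀ a, Tendsto (fun t => (x t i - y t) / (x t i - p a)) U (𝓝 (α i a)))
    (hβ : ∀ i ∈ S, ∀ j ∉ S, Tendsto (fun t => (x t i - y t) / (x t i - x t j)) U (𝓝 (β i j))) :
    ∑ i ∈ S, (∑ a, c i a * α i a + ∑ j ∈ Sᶜ, W i j * β i j) +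
      (∑ i ∈ S, ∑ j ∈ S, W i j) / 2 = 0 := by
  have h1 : Tendsto (fun t => ∑ i ∈ S, (∑ a, c i a * ((x t i - y t) / (x t i - p a)) +
        ∑ j ∈ Sᶜ, Wt t i j * ((x t i - y t) / (x t i - x t j))) +
        (∑ i ∈ S, ∑ j ∈ S, Wt t i j) / 2) U
      (𝓝 (∑ i ∈ S, (∑ a, c i a * α i a + ∑ j ∈ Sᶜ, W i j * β i j) +
        (∑ i ∈ S, ∑ j ∈ S, W i j) / 2)) := by
    refine Tendsto.add (tendsto_finsetSum _ fun i hi => Tendsto.add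
      (tendsto_finsetSum _ fun a _ => (hα i hi a).const_mul _)
      (tendsto_finsetSum _ fun j hj => (hWt i j).mul (hβ i hi j (Finset.mem_compl.1 hj))))
      ((tendsto_finsetSum _ fun i _ => tendsto_finsetSum _ fun j _ => hWt i j).div_const _)
  refine tendsto_nhds_unique h1 (tendsto_const_nhds.congr' (hx.mono fun t ht => ?_))
  beta_reduce
  rw [← sum_mul_force (p := p) (c := c) (hsymm t) ht.1 S (y t)]
  simp [ht.2]

variable {G : SimpleGraph I} {Wt : ι → I → I → ℂ} {x : ι → I → ℂ}

/-- A bounded family converges along the ultrafilter. For an unbounded one, rescale by the norm and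
let `S` be the set of coordinates with nonzero rescaled limit. With `y = 0` all quotients in
`limit_sum_mul_force` tend to `1`, and the limit contradicts the condition `infinity`. -/
theorem exists_tendsto_of_nonResonant (hnr : NonResonant G c W) (U : Ultrafilter ι)
    (hsymm : ∀ t i j, Wt t i j = Wt t j i)
    (hWt : ∀ i j, Tendsto (fun t => Wt t i j) U (𝓝 (W i j)))
    (hx : ∀ᶠ t in U, (∀ i j, Wt t i j ≠ 0 → x t i ≠ x t j) ∧
      ∀ i, force p c (Wt t) (x t) i = 0) : ∃ z, Tendsto x U (𝓝 z) := by
  have hcompact : ∀ (y : ι → I → ℂ) (C : ℝ), (∀ᶠ t in U, ‖y t‖ ≤ C) → ∃ z, Tendsto y U (𝓝 z) := by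
    intro y C h
    obtain ⟨z, -, hz⟩ := (isCompact_closedBall (0 : I → ℂ) C).ultrafilter_le_nhds (U.map y)
      (le_principal_iff.2 (h.mono fun t ht => by simpa using ht))
    exact ⟨z, hz⟩
  by_cases hb : ∃ C, ∀ᶠ t in U, ‖x t‖ ≤ C
  · obtain ⟨C, hC⟩ := hb
    exact hcompact x C hC
  exfalso
  push Not at hb
  have hr : Tendsto (fun t => ‖x t‖) U atTop := tendsto_atTop.2 fun C =>
    (hb C).mono fun t ht => ht.le
  have hr0 : ∀ᶠ t in U, ‖x t‖ ≠ 0 := (hr.eventually_gt_atTop 0).mono fun t ht => ht.ne'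
  have hinv : Tendsto (fun t => ((‖x t‖ : ℂ))⁻¹) U (𝓝 0) := by
    have h := (Complex.continuous_ofReal.tendsto 0).comp (tendsto_inv_atTop_zero.comp hr)
    simpa [Function.comp_def] using h
  let y : ι → I → ℂ := fun t => ((‖x t‖ : ℂ))⁻¹ • x t
  have hy1 : ∀ᶠ t in U, ‖y t‖ = 1 := hr0.mono fun t ht => by
    simp [y, norm_smul, inv_mul_cancel₀ ht]
  obtain ⟨η, hη⟩ := hcompact y 1 (hy1.mono fun t ht => ht.le)
  have hη1 : ‖η‖ = 1 := tendsto_nhds_unique hη.norm (tendsto_const_nhds.congr'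
    (hy1.mono fun t ht => ht.symm))
  have hηi : ∀ i, Tendsto (fun t => (‖x t‖ : ℂ)⁻¹ * x t i) U (𝓝 (η i)) := fun i =>
    (tendsto_pi_nhds.1 hη) i
  let S : Finset I := Finset.univ.filter fun i => η i ≠ 0
  have hS : S.Nonempty := by
    by_contra h
    rw [Finset.not_nonempty_iff_eq_empty, Finset.filter_eq_empty_iff] at h
    have : η = 0 := by
      ext i
      simpa using h (Finset.mem_univ i)
    simp [this] at hη1
  have hmem : ∀ i, i ∈ S ↔ η i ≠ 0 := fun i => by simp [S]
  have hdiv : ∀ {t : ι} (a b : ℂ), ‖x t‖ ≠ 0 → a / b = ((‖x t‖ : ℂ)⁻¹ * a) / ((‖x t‖ : ℂ)⁻¹ * b) :=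
    fun a b h => (mul_div_mul_left _ _ (inv_ne_zero (by exact_mod_cast h))).symm
  refine hnr.infinity S hS ?_
  have := limit_sum_mul_force (p := p) (c := c) hsymm hWt hx S (fun _ => 0) (α := fun _ _ => 1)
    (β := fun _ _ => 1) ?_ ?_
  · simpa using this
  · intro i hi a
    have hi' := (hmem i).1 hi
    have h1 : Tendsto (fun t => ((‖x t‖ : ℂ)⁻¹ * x t i) / ((‖x t‖ : ℂ)⁻¹ * x t i - (‖x t‖ : ℂ)⁻¹ * p a))
        U (𝓝 (η i / (η i - 0 * p a))) :=
      (hηi i).div ((hηi i).sub (hinv.mul_const _)) (by simpa using hi')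
    rw [zero_mul, sub_zero, div_self hi'] at h1
    refine h1.congr' (hr0.mono fun t ht => ?_)
    beta_reduce
    rw [sub_zero, hdiv (x t i) _ ht, mul_sub]
  · intro i hi j hj
    have hi' := (hmem i).1 hi
    have hj' : η j = 0 := by simpa [S] using hj
    have h1 : Tendsto (fun t => ((‖x t‖ : ℂ)⁻¹ * x t i) / ((‖x t‖ : ℂ)⁻¹ * x t i - (‖x t‖ : ℂ)⁻¹ * x t j))
        U (𝓝 (η i / (η i - η j))) :=
      (hηi i).div ((hηi i).sub (hηi j)) (by simpa [hj'] using hi')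
    rw [hj', sub_zero, div_self hi'] at h1
    refine h1.congr' (hr0.mono fun t ht => ?_)
    beta_reduce
    rw [sub_zero, hdiv (x t i) _ ht, mul_sub]

/-- For nonresonant exponents, solutions do not escape. -/
theorem exists_admissible_tendsto_of_nonResonant (hp : Function.Injective p)
    (hnr : NonResonant G c W) (U : Ultrafilter ι)
    (hsymm : ∀ t i j, Wt t i j = Wt t j i)
    (hWt : ∀ i j, Tendsto (fun t => Wt t i j) U (𝓝 (W i j)))
    (hxp : ∀ᶠ t in U, ∀ i a, x t i ≠ p a)
    (hx : ∀ᶠ t in U, (∀ i j, Wt t i j ≠ 0 → x t i ≠ x t j) ∧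
      ∀ i, force p c (Wt t) (x t) i = 0) : ∃ z ∈ admissible G p, Tendsto x U (𝓝 z) := by
  classical
  obtain ⟨z, hz⟩ := exists_tendsto_of_nonResonant hnr U hsymm hWt hx
  have hzi : ∀ i, Tendsto (fun t => x t i) U (𝓝 (z i)) := tendsto_pi_nhds.1 hz
  have hzp : ∀ i a, z i ≠ p a := by
    intro i a hia
    -- The cluster `S` tends to `p a`. With base point `y = p a` the quotient at `a` is `1` and all
    -- other outer quotients tend to `0`, which leaves the expression in the condition `point`.
    let S : Finset I := Finset.univ.filter fun l => z l = p a
    refine hnr.point S ⟨i, by simp [S, hia]⟩ a ?_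
    have := limit_sum_mul_force (p := p) (c := c) hsymm hWt hx S (fun _ => p a)
      (α := fun _ a' => if a' = a then 1 else 0) (β := fun _ _ => 0) ?_ ?_
    · simpa using this
    · intro l hl a'
      have hl' : z l = p a := by simpa [S] using hl
      by_cases ha : a' = a
      · subst ha
        rw [if_pos rfl]
        refine tendsto_const_nhds.congr' (hxp.mono fun t ht => ?_)
        exact (div_self (sub_ne_zero.2 (ht l a'))).symm
      · rw [if_neg ha]
        have h1 := ((hzi l).sub_const (p a)).div ((hzi l).sub_const (p a'))
          (by rw [hl', sub_ne_zero]; exact fun h => ha (hp h.symm))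
        simpa [hl', Pi.div_def] using h1
    · intro l hl j hj
      have hl' : z l = p a := by simpa [S] using hl
      have hj' : z j ≠ p a := by simpa [S] using hj
      have h1 := ((hzi l).sub_const (p a)).div ((hzi l).sub (hzi j))
        (by rw [hl', sub_ne_zero]; exact hj'.symm)
      simpa [hl', Pi.div_def] using h1
  refine ⟨z, ⟨hzp, fun i j hij hzij => ?_⟩, hz⟩
  -- The cluster `S` tends to `z i`, which is now known to differ from every `p a`. With the moving
  -- base point `y = x t i` all outer quotients tend to `0`, and only the weights inside `S` remain.
  let S : Finset I := Finset.univ.filter fun l => z l = z i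
  refine hnr.diagonal S ⟨i, by simp [S], j, by simp [S, hzij], hij⟩ ?_
  have := limit_sum_mul_force (p := p) (c := c) hsymm hWt hx S (fun t => x t i)
    (α := fun _ _ => 0) (β := fun _ _ => 0) ?_ ?_
  · simpa using this
  · intro l hl a
    have hl' : z l = z i := by simpa [S] using hl
    have h1 := ((hzi l).sub (hzi i)).div ((hzi l).sub_const (p a)) (sub_ne_zero.2 (hzp l a))
    simpa [hl', Pi.div_def] using h1
  · intro l hl k hk
    have hl' : z l = z i := by simpa [S] using hl
    have hk' : z k ≠ z i := by simpa [S] using hk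
    have h1 := ((hzi l).sub (hzi i)).div ((hzi l).sub (hzi k))
      (by rw [hl', sub_ne_zero]; exact hk'.symm)
    simpa [hl', Pi.div_def] using h1

end Force

end HQD

namespace HQD

set_option linter.unusedSectionVars false

/-! ### Deletion and contraction of an edge by letting its weight tend to zero -/

section Deformation

open Filter Topology

variable {I A : Type*} [Fintype I] [Fintype A]

/-- The critical points of the master function with exponents `c`, `W`. -/
def criticalPoints (G : SimpleGraph I) (p : A → ℂ) (c : I → A → ℂ) (W : I → I → ℂ) :
    Set (I → ℂ) :=
  {x ∈ admissible G p | ∀ i, force p c W x i = 0}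

/-- The Hessian of the logarithm of the master function is nondegenerate at `x`. -/
def Nondegenerate (p : A → ℂ) (c : I → A → ℂ) (W : I → I → ℂ) (x : I → ℂ) : Prop :=
  ∀ ξ : I → ℂ, (∀ i, forceDeriv p c W x ξ i = 0) → ξ = 0

variable {p : A → ℂ} {c : I → A → ℂ} {W : I → I → ℂ}

/-- The ordered pairs of ends of the edge `uv`. -/
def IsEnds (u v i j : I) : Prop := (i = u ∧ j = v) ∨ (i = v ∧ j = u)

theorem IsEnds.symm {u v i j : I} (h : IsEnds u v i j) : IsEnds u v j i := by
  rcases h with ⟨rfl, rfl⟩ | ⟨rfl, rfl⟩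
  exacts [Or.inr ⟨rfl, rfl⟩, Or.inl ⟨rfl, rfl⟩]

open Classical in
/-- Change the weight of the edge `uv` by `t`. -/
noncomputable def addWeight (u v : I) (W : I → I → ℂ) (t : ℂ) (i j : I) : ℂ :=
  W i j + if IsEnds u v i j then t else 0

open Classical in
/-- The equations for the weight `t` on `uv`, with denominators `x_u - x_v` cleared. -/
noncomputable def deformation (p : A → ℂ) (c : I → A → ℂ) (W : I → I → ℂ) (u v : I)
    (q : (I → ℂ) × ℂ) (i : I) : ℂ :=
  if i = v then (q.1 u - q.1 v) * force p c W q.1 u + q.2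
  else if i = u then force p c W q.1 u + force p c W q.1 v
  else force p c W q.1 i

open Classical in
/-- The derivative of `deformation` in the direction `(ξ, 0)`. -/
noncomputable def deformationDeriv (p : A → ℂ) (c : I → A → ℂ) (W : I → I → ℂ) (u v : I)
    (x ξ : I → ℂ) (i : I) : ℂ :=
  if i = v then (ξ u - ξ v) * force p c W x u + (x u - x v) * forceDeriv p c W x ξ u
  else if i = u then forceDeriv p c W x ξ u + forceDeriv p c W x ξ v
  else forceDeriv p c W x ξ i

variable {u v : I}

theorem contDiffAt_deformation {x : I → ℂ} (hp : ∀ i a, x i ≠ p a)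
    (hW : ∀ i j, W i j ≠ 0 → x i ≠ x j) (t : ℂ) :
    ContDiffAt ℂ 1 (deformation p c W u v) (x, t) := by
  refine contDiffAt_pi.2 fun i => ?_
  have hF : ∀ k, ContDiffAt ℂ 1 (fun q : (I → ℂ) × ℂ => force p c W q.1 k) (x, t) := fun k =>
    ContDiffAt.comp (x, t) (contDiffAt_force hp hW k) contDiffAt_fst
  have hX : ∀ k, ContDiffAt ℂ 1 (fun q : (I → ℂ) × ℂ => q.1 k) (x, t) := fun k =>
    ContDiffAt.comp (x, t) (contDiff_apply ℂ ℂ k).contDiffAt contDiffAt_fst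
  unfold deformation
  split_ifs
  · exact (((hX u).sub (hX v)).mul (hF u)).add contDiffAt_snd
  · exact (hF u).add (hF v)
  · exact hF i

theorem fderiv_deformation {x : I → ℂ} (hp : ∀ i a, x i ≠ p a)
    (hW : ∀ i j, W i j ≠ 0 → x i ≠ x j) (t : ℂ) (ξ : I → ℂ) :
    fderiv ℂ (deformation p c W u v) (x, t) (ξ, 0) = deformationDeriv p c W u v x ξ := by
  have hdiff : HasFDerivAt (deformation p c W u v)
      (fderiv ℂ (deformation p c W u v) (x, t)) (x, t) :=
    ((contDiffAt_deformation hp hW t).differentiableAt one_ne_zero).hasFDerivAt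
  have hline : HasDerivAt (fun s : ℂ => (x + s • ξ, t)) (ξ, 0) 0 := by
    have := (((hasDerivAt_id (0 : ℂ)).smul_const ξ).const_add x).prodMk (hasDerivAt_const 0 t)
    simpa using this
  have h0 : (x, t) = (fun s : ℂ => (x + s • ξ, t)) 0 := by simp
  rw [h0] at hdiff
  have h1 := hdiff.comp_hasDerivAt (0 : ℂ) hline
  rw [← h0] at h1
  refine h1.unique (hasDerivAt_pi.2 fun i => ?_)
  have hF := fun k => hasDerivAt_force (c := c) hp hW ξ k
  have hX : ∀ k, HasDerivAt (fun s : ℂ => (x + s • ξ) k) (ξ k) 0 := by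
    intro k
    have := ((hasDerivAt_id (0 : ℂ)).mul_const (ξ k)).const_add (x k)
    simpa using this
  simp only [Function.comp_apply, deformation, deformationDeriv]
  split_ifs
  · have := (((hX u).fun_sub (hX v)).fun_mul (hF u)).add_const t
    simpa using this
  · exact (hF u).fun_add (hF v)
  · exact hF i

theorem force_addWeight (huv : u ≠ v) (t : ℂ) (x : I → ℂ) (i : I) [DecidableEq I] :
    force p c (addWeight u v W t) x i = force p c W x i +
      if i = v then t / (x v - x u) else if i = u then t / (x u - x v) else 0 := by
  classical
  have h : ∑ j, (if IsEnds u v i j then t else 0) / (x i - x j) =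
      if i = v then t / (x v - x u) else if i = u then t / (x u - x v) else 0 := by
    by_cases hv : i = v
    · subst hv
      rw [if_pos rfl, Finset.sum_eq_single u]
      · rw [if_pos (show IsEnds u i i u from Or.inr ⟨rfl, rfl⟩)]
      · intro j _ hj
        rw [if_neg, zero_div]
        rintro (⟨h, -⟩ | ⟨-, h⟩)
        exacts [huv h.symm, hj h]
      · simp
    · by_cases hu : i = u
      · subst hu
        rw [if_neg hv, if_pos rfl, Finset.sum_eq_single v]
        · rw [if_pos (show IsEnds i v i v from Or.inl ⟨rfl, rfl⟩)]
        · intro j _ hj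
          rw [if_neg, zero_div]
          rintro (⟨-, h⟩ | ⟨h, -⟩)
          exacts [hj h, huv h]
        · simp
      · rw [if_neg hv, if_neg hu]
        refine Finset.sum_eq_zero fun j _ => ?_
        rw [if_neg, zero_div]
        rintro (⟨h, -⟩ | ⟨h, -⟩)
        exacts [hu h, hv h]
  rw [← h]
  unfold force addWeight
  simp only [add_div, Finset.sum_add_distrib, add_assoc]

theorem forceDeriv_addWeight (huv : u ≠ v) (t : ℂ) (x ξ : I → ℂ) (i : I) [DecidableEq I] :
    forceDeriv p c (addWeight u v W t) x ξ i = forceDeriv p c W x ξ i +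
      if i = v then -(t * (ξ v - ξ u)) / (x v - x u) ^ 2
      else if i = u then -(t * (ξ u - ξ v)) / (x u - x v) ^ 2 else 0 := by
  classical
  have h : ∑ j, -((if IsEnds u v i j then t else 0) * (ξ i - ξ j)) / (x i - x j) ^ 2 =
      if i = v then -(t * (ξ v - ξ u)) / (x v - x u) ^ 2
      else if i = u then -(t * (ξ u - ξ v)) / (x u - x v) ^ 2 else 0 := by
    by_cases hv : i = v
    · subst hv
      rw [if_pos rfl, Finset.sum_eq_single u]
      · rw [if_pos (show IsEnds u i i u from Or.inr ⟨rfl, rfl⟩)]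
      · intro j _ hj
        rw [if_neg, zero_mul, neg_zero, zero_div]
        rintro (⟨h, -⟩ | ⟨-, h⟩)
        exacts [huv h.symm, hj h]
      · simp
    · by_cases hu : i = u
      · subst hu
        rw [if_neg hv, if_pos rfl, Finset.sum_eq_single v]
        · rw [if_pos (show IsEnds i v i v from Or.inl ⟨rfl, rfl⟩)]
        · intro j _ hj
          rw [if_neg, zero_mul, neg_zero, zero_div]
          rintro (⟨-, h⟩ | ⟨h, -⟩)
          exacts [hj h, huv h]
        · simp
      · rw [if_neg hv, if_neg hu]
        refine Finset.sum_eq_zero fun j _ => ?_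
        rw [if_neg, zero_mul, neg_zero, zero_div]
        rintro (⟨h, -⟩ | ⟨h, -⟩)
        exacts [hu h, hv h]
  rw [← h]
  unfold forceDeriv addWeight
  simp only [add_mul, neg_add, add_div, Finset.sum_add_distrib, add_assoc]

/-- The term `t / (x u - x v)` enters the equations at `u` and `v` with opposite signs. It cancels
in their sum, and multiplying the equation at `u` by `x u - x v` clears it. The resulting system
also makes sense on `x u = x v`, where the contracted configurations live. -/
theorem deformation_eq_zero_iff (huv : u ≠ v) {x : I → ℂ} {t : ℂ} (hx : x u ≠ x v) :
    deformation p c W u v (x, t) = 0 ↔ ∀ i, force p c (addWeight u v W t) x i = 0 := by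
  classical
  have h1 := sub_ne_zero.2 hx
  have h2 : x v - x u = -(x u - x v) := by ring
  simp only [force_addWeight huv, funext_iff, Pi.zero_apply]
  have key : ∀ P Q : I → Prop, (∀ i, i ≠ u → i ≠ v → (P i ↔ Q i)) →
      (P u ∧ P v ↔ Q u ∧ Q v) → ((∀ i, P i) ↔ ∀ i, Q i) := by
    intro P Q h h'
    constructor
    · intro hP i
      by_cases hu : i = u
      · subst hu; exact (h'.1 ⟨hP _, hP _⟩).1
      · by_cases hv : i = v
        · subst hv; exact (h'.1 ⟨hP _, hP _⟩).2
        · exact (h i hu hv).1 (hP i)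
    · intro hQ i
      by_cases hu : i = u
      · subst hu; exact (h'.2 ⟨hQ _, hQ _⟩).1
      · by_cases hv : i = v
        · subst hv; exact (h'.2 ⟨hQ _, hQ _⟩).2
        · exact (h i hu hv).2 (hQ i)
  refine key _ _ (fun i hu hv => by simp [deformation, hu, hv]) ?_
  simp only [deformation, huv, if_true, if_false]
  rw [h2]
  constructor
  · rintro ⟨h3, h4⟩
    have h5 : force p c W x u + t / (x u - x v) = 0 := by
      field_simp
      linear_combination h4
    refine ⟨h5, ?_⟩
    rw [div_neg]
    linear_combination h3 - h5
  · rintro ⟨h3, h4⟩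
    rw [div_neg] at h4
    refine ⟨by linear_combination h3 + h4, ?_⟩
    field_simp at h3
    linear_combination h3

/-- At a solution the force at `u` without the edge equals `-t / (x u - x v)`. Substituting this,
the derivative of the cleared equation is `x u - x v` times the derivative of the original one, so a
kernel vector for the original system is one for the cleared system. -/
theorem nondegenerate_addWeight (huv : u ≠ v) {x : I → ℂ} {t : ℂ} (hx : x u ≠ x v)
    (h0 : ∀ i, force p c (addWeight u v W t) x i = 0)
    (hnd : ∀ ξ, deformationDeriv p c W u v x ξ = 0 → ξ = 0) :
    Nondegenerate p c (addWeight u v W t) x := by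
  classical
  intro ξ hξ
  refine hnd ξ (funext fun i => ?_)
  have h1 := sub_ne_zero.2 hx
  have h2 : x v - x u = -(x u - x v) := by ring
  have hu := hξ u
  have hv := hξ v
  have h0u := h0 u
  rw [force_addWeight huv, if_neg huv, if_pos rfl] at h0u
  rw [forceDeriv_addWeight huv, if_neg huv, if_pos rfl] at hu
  rw [forceDeriv_addWeight huv, if_pos rfl, h2, neg_sq] at hv
  unfold deformationDeriv
  split_ifs with h3 h4
  · have e1 : force p c W x u = -(t / (x u - x v)) := by linear_combination h0u
    have e2 : forceDeriv p c W x ξ u = t * (ξ u - ξ v) / (x u - x v) ^ 2 := by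
      linear_combination hu
    rw [e1, e2, Pi.zero_apply]
    field_simp
    ring
  · rw [Pi.zero_apply]
    linear_combination hu + hv
  · have := hξ i
    rwa [forceDeriv_addWeight huv, if_neg h3, if_neg h4, add_zero] at this

/-- `π : I → I'` contracts the edge `uv` of `G` and nothing else, and `G''` is the contracted
graph. -/
structure IsContraction {I' : Type*} (G : SimpleGraph I) (u v : I) (π : I → I')
    (G'' : SimpleGraph I') : Prop where
  surjective : Function.Surjective π
  eq_iff : ∀ k l, π k = π l ↔ k = l ∨ IsEnds u v k l
  adj_iff : ∀ i j, G''.Adj i j ↔ i ≠ j ∧ ∃ k l, π k = i ∧ π l = j ∧ G.Adj k l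

variable {I' : Type*} [Fintype I'] {π : I → I'} {c' : I' → A → ℂ} {W' : I' → I' → ℂ}

/-- On configurations constant on the fibres of `π`, forces can be added over a fibre: equal
coordinates share their denominators, and pairs within a fibre contribute nothing. -/
theorem force_comp [DecidableEq I'] (hc : ∀ i a, c' i a = ∑ k with π k = i, c k a)
    (hW' : ∀ i j, i ≠ j → W' i j = ∑ k with π k = i, ∑ l with π l = j, W k l)
    (x : I' → ℂ) (i : I') :
    force p c' W' x i = ∑ k with π k = i, force p c W (x ∘ π) k := by
  unfold force
  rw [Finset.sum_add_distrib]
  congr 1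
  · rw [Finset.sum_comm]
    refine Finset.sum_congr rfl fun a _ => ?_
    rw [hc, Finset.sum_div]
    refine Finset.sum_congr rfl fun k hk => ?_
    rw [Function.comp_apply, (Finset.mem_filter.1 hk).2]
  · have h1 : ∀ j, W' i j / (x i - x j) =
        ∑ k with π k = i, ∑ l with π l = j, W k l / ((x ∘ π) k - (x ∘ π) l) := by
      intro j
      have h2 : ∑ k with π k = i, ∑ l with π l = j, W k l / ((x ∘ π) k - (x ∘ π) l)
          = (∑ k with π k = i, ∑ l with π l = j, W k l) / (x i - x j) := by
        simp only [Finset.sum_div]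
        refine Finset.sum_congr rfl fun k hk => Finset.sum_congr rfl fun l hl => ?_
        rw [Function.comp_apply, Function.comp_apply, (Finset.mem_filter.1 hk).2,
          (Finset.mem_filter.1 hl).2]
      rw [h2]
      -- For `i = j` both sides are quotients by `0`, hence `0`; the diagonal value `W' i i` and the
      -- weights inside a fibre play no role.
      by_cases hij : i = j
      · simp [hij]
      · rw [hW' i j hij]
    simp only [h1]
    rw [Finset.sum_comm]
    refine Finset.sum_congr rfl fun k _ => ?_
    exact Finset.sum_fiberwise _ _ _

theorem forceDeriv_comp [DecidableEq I'] (hc : ∀ i a, c' i a = ∑ k with π k = i, c k a)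
    (hW' : ∀ i j, i ≠ j → W' i j = ∑ k with π k = i, ∑ l with π l = j, W k l)
    (x ξ : I' → ℂ) (i : I') :
    forceDeriv p c' W' x ξ i = ∑ k with π k = i, forceDeriv p c W (x ∘ π) (ξ ∘ π) k := by
  unfold forceDeriv
  rw [Finset.sum_add_distrib]
  congr 1
  · rw [Finset.sum_comm]
    refine Finset.sum_congr rfl fun a _ => ?_
    rw [hc, Finset.sum_mul, ← Finset.sum_neg_distrib, Finset.sum_div]
    refine Finset.sum_congr rfl fun k hk => ?_
    rw [Function.comp_apply, Function.comp_apply, (Finset.mem_filter.1 hk).2]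
  · have h1 : ∀ j, -(W' i j * (ξ i - ξ j)) / (x i - x j) ^ 2 =
        ∑ k with π k = i, ∑ l with π l = j,
          -(W k l * ((ξ ∘ π) k - (ξ ∘ π) l)) / ((x ∘ π) k - (x ∘ π) l) ^ 2 := by
      intro j
      have h2 : ∑ k with π k = i, ∑ l with π l = j,
          -(W k l * ((ξ ∘ π) k - (ξ ∘ π) l)) / ((x ∘ π) k - (x ∘ π) l) ^ 2
          = -((∑ k with π k = i, ∑ l with π l = j, W k l) * (ξ i - ξ j)) / (x i - x j) ^ 2 := by
        simp only [Finset.sum_div, Finset.sum_mul, ← Finset.sum_neg_distrib]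
        refine Finset.sum_congr rfl fun k hk => Finset.sum_congr rfl fun l hl => ?_
        rw [Function.comp_apply, Function.comp_apply, Function.comp_apply, Function.comp_apply,
          (Finset.mem_filter.1 hk).2, (Finset.mem_filter.1 hl).2]
      rw [h2]
      by_cases hij : i = j
      · simp [hij]
      · rw [hW' i j hij]
    simp only [h1]
    rw [Finset.sum_comm]
    refine Finset.sum_congr rfl fun k _ => ?_
    exact Finset.sum_fiberwise _ _ _

namespace IsContraction

variable {G G' : SimpleGraph I} {G'' : SimpleGraph I'}

theorem sum_fiber [DecidableEq I'] (h : IsContraction G u v π G'') (huv : u ≠ v) (f : I → ℂ) :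
    ∑ k with π k = π u, f k = f u + f v := by
  classical
  have : (Finset.univ.filter fun k => π k = π u) = {u, v} := by
    ext k
    simp only [Finset.mem_filter, Finset.mem_univ, true_and, Finset.mem_insert,
      Finset.mem_singleton, h.eq_iff, IsEnds]
    have := huv.symm
    grind
  rw [this, Finset.sum_pair huv]

theorem sum_fiber_of_ne [DecidableEq I'] (h : IsContraction G u v π G'') {i : I}
    (hu : i ≠ u) (hv : i ≠ v) (f : I → ℂ) : ∑ k with π k = π i, f k = f i := by
  classical
  have : (Finset.univ.filter fun k => π k = π i) = {i} := by
    ext k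
    simp only [Finset.mem_filter, Finset.mem_univ, true_and,
      Finset.mem_singleton, h.eq_iff, IsEnds]
    grind
  rw [this, Finset.sum_singleton]

theorem apply_eq (h : IsContraction G u v π G'') : π u = π v :=
  (h.eq_iff u v).2 (Or.inr (Or.inl ⟨rfl, rfl⟩))

theorem exists_comp_eq (h : IsContraction G u v π G'') {x : I → ℂ} (hx : x u = x v) :
    ∃ y : I' → ℂ, x = y ∘ π := by
  refine ⟨fun i => x (Function.surjInv h.surjective i), funext fun k => ?_⟩
  have : π (Function.surjInv h.surjective (π k)) = π k := Function.surjInv_eq _ _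
  rcases (h.eq_iff _ _).1 this with h1 | ⟨h1, h2⟩ | ⟨h1, h2⟩
  · simp [h1]
  · simp only [Function.comp_apply, h1]; rw [h2, hx]
  · simp only [Function.comp_apply, h1]; rw [h2, hx]

theorem comp_mem_admissible_iff (h : IsContraction G u v π G'')
    (hG' : ∀ i j, G'.Adj i j ↔ G.Adj i j ∧ ¬ IsEnds u v i j) (y : I' → ℂ) :
    y ∘ π ∈ admissible G' p ↔ y ∈ admissible G'' p := by
  constructor
  · rintro ⟨h1, h2⟩
    refine ⟨fun i a => ?_, fun i j hij => ?_⟩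
    · obtain ⟨k, rfl⟩ := h.surjective i
      exact h1 k a
    · obtain ⟨hne, k, l, rfl, rfl, hkl⟩ := (h.adj_iff i j).1 hij
      exact h2 k l ((hG' k l).2 ⟨hkl, fun he => hne ((h.eq_iff k l).2 (Or.inr he))⟩)
  · rintro ⟨h1, h2⟩
    refine ⟨fun k a => h1 (π k) a, fun k l hkl => h2 _ _ ((h.adj_iff _ _).2 ⟨?_, k, l, rfl, rfl, ?_⟩)⟩
    · rw [ne_eq, h.eq_iff]
      rintro (rfl | he)
      · exact hkl.ne rfl
      · exact ((hG' k l).1 hkl).2 he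
    · exact ((hG' k l).1 hkl).1

end IsContraction

/-- Deletion and contraction: as the weight of `uv` tends to `0`, the critical points for `G`
specialize to those for `G` with `uv` deleted and to those for `G` with `uv` contracted. -/
theorem eventually_ncard_criticalPoints [DecidableEq I] [DecidableEq I'] {G G' : SimpleGraph I}
    {G'' : SimpleGraph I'} (hp : Function.Injective p) (huv : G.Adj u v)
    (hG' : ∀ i j, G'.Adj i j ↔ G.Adj i j ∧ ¬ IsEnds u v i j)
    (hπ : IsContraction G u v π G'')
    (hsymm : ∀ i j, W i j = W j i) (hW : ∀ i j, W i j ≠ 0 → G'.Adj i j)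
    (hc : ∀ i a, c' i a = ∑ k with π k = i, c k a)
    (hW' : ∀ i j, i ≠ j → W' i j = ∑ k with π k = i, ∑ l with π l = j, W k l)
    (hnr : NonResonant G' c W)
    (hfin : (criticalPoints G' p c W).Finite)
    (hgood : ∀ x ∈ criticalPoints G' p c W, (∀ i, x i ≠ 0) ∧ Nondegenerate p c W x)
    (hfin' : (criticalPoints G'' p c' W').Finite)
    (hgood' : ∀ y ∈ criticalPoints G'' p c' W', (∀ i, y i ≠ 0) ∧ Nondegenerate p c' W' y)
    (hforce : ∀ y ∈ criticalPoints G'' p c' W', force p c W (y ∘ π) u ≠ 0) :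
    ∀ᶠ t in 𝓝[≠] (0 : ℂ), (criticalPoints G p c (addWeight u v W t)).Finite ∧
      (criticalPoints G p c (addWeight u v W t)).ncard =
        (criticalPoints G' p c W).ncard + (criticalPoints G'' p c' W').ncard ∧
      ∀ x ∈ criticalPoints G p c (addWeight u v W t),
        (∀ i, x i ≠ 0) ∧ Nondegenerate p c (addWeight u v W t) x := by
  have hne : u ≠ v := huv.ne
  have hadm : ∀ {x}, x ∈ admissible G' p → (∀ i a, x i ≠ p a) ∧ ∀ i j, W i j ≠ 0 → x i ≠ x j :=
    fun hx => ⟨hx.1, fun i j h => hx.2 i j (hW i j h)⟩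
  have hadmG : ∀ x, x ∈ admissible G p ↔ x ∈ admissible G' p ∧ x u ≠ x v := by
    intro x
    constructor
    · rintro ⟨h1, h2⟩
      exact ⟨⟨h1, fun i j hij => h2 i j ((hG' i j).1 hij).1⟩, h2 u v huv⟩
    · rintro ⟨⟨h1, h2⟩, h3⟩
      refine ⟨h1, fun i j hij => ?_⟩
      by_cases he : IsEnds u v i j
      · rcases he with ⟨rfl, rfl⟩ | ⟨rfl, rfl⟩
        exacts [h3, h3.symm]
      · exact h2 i j ((hG' i j).2 ⟨hij, he⟩)
  -- On `x u = x v` the equation at `v` reads `t = 0`; so for `t ≠ 0` clearing denominators adds no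
  -- solutions.
  have hzero : ∀ x : I → ℂ, x u = x v → ∀ t, deformation p c W u v (x, t) = 0 → t = 0 := by
    intro x hx t h
    have := congrFun h v
    simpa [deformation, hx] using this
  have hsol : ∀ t : ℂ, t ≠ 0 → {x ∈ admissible G' p | deformation p c W u v (x, t) = 0} =
      criticalPoints G p c (addWeight u v W t) := by
    intro t ht
    ext x
    simp only [criticalPoints, Set.mem_ofPred_eq, hadmG]
    constructor
    · rintro ⟨h1, h2⟩
      have hx : x u ≠ x v := fun h => ht (hzero x h t h2)
      exact ⟨⟨h1, hx⟩, (deformation_eq_zero_iff hne hx).1 h2⟩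
    · rintro ⟨⟨h1, hx⟩, h2⟩
      exact ⟨h1, (deformation_eq_zero_iff hne hx).2 h2⟩
  have hcomp : ∀ y : I' → ℂ, (∀ i, force p c' W' y i = 0) ↔
      (force p c W (y ∘ π) u + force p c W (y ∘ π) v = 0 ∧
        ∀ i, i ≠ u → i ≠ v → force p c W (y ∘ π) i = 0) := by
    intro y
    constructor
    · intro h
      refine ⟨?_, fun i hu hv => ?_⟩
      · rw [← hπ.sum_fiber hne (force p c W (y ∘ π)), ← force_comp hc hW', h]
      · rw [← hπ.sum_fiber_of_ne hu hv (force p c W (y ∘ π)), ← force_comp hc hW', h]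
    · rintro ⟨h1, h2⟩ i
      obtain ⟨k, rfl⟩ := hπ.surjective i
      rw [force_comp hc hW']
      by_cases hu : k = u
      · rw [hu, hπ.sum_fiber hne, h1]
      by_cases hv : k = v
      · rw [hv, ← hπ.apply_eq, hπ.sum_fiber hne, h1]
      · rw [hπ.sum_fiber_of_ne hu hv, h2 k hu hv]
  have hdef0 : ∀ x : I → ℂ, deformation p c W u v (x, 0) = 0 ↔
      (x u - x v) * force p c W x u = 0 ∧ force p c W x u + force p c W x v = 0 ∧
        ∀ i, i ≠ u → i ≠ v → force p c W x i = 0 := by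
    intro x
    constructor
    · intro h
      have h1 := congrFun h v
      have h2 := congrFun h u
      simp only [deformation, if_pos, if_neg hne, add_zero, Pi.zero_apply] at h1 h2
      refine ⟨h1, h2, fun i hu hv => ?_⟩
      have h3 := congrFun h i
      simpa [deformation, hu, hv] using h3
    · rintro ⟨h1, h2, h3⟩
      funext i
      unfold deformation
      split_ifs with hv hu
      · simpa using h1
      · simpa using h2
      · exact h3 i hu hv
  have hπinj : Function.Injective fun y : I' → ℂ => y ∘ π := hπ.surjective.injective_comp_right
  have hmem' : ∀ y : I' → ℂ, y ∘ π ∈ admissible G' p → deformation p c W u v (y ∘ π, 0) = 0 →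
      y ∈ criticalPoints G'' p c' W' := fun y h1 h2 =>
    ⟨(hπ.comp_mem_admissible_iff hG' y).1 h1, (hcomp y).2 ((hdef0 _).1 h2).2⟩
  -- At `t = 0` the cleared equation is the product `(x u - x v) * force u = 0`. One factor gives
  -- the deleted graph, the other the contracted graph.
  have hZ : {x ∈ admissible G' p | deformation p c W u v (x, 0) = 0} =
      criticalPoints G' p c W ∪ (fun y => y ∘ π) '' criticalPoints G'' p c' W' := by
    ext x
    constructor
    · rintro ⟨h1, h2⟩
      by_cases hx : x u = x v
      · obtain ⟨y, rfl⟩ := hπ.exists_comp_eq hx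
        exact Or.inr ⟨y, hmem' y h1 h2, rfl⟩
      · left
        obtain ⟨h3, h4, h5⟩ := (hdef0 x).1 h2
        have h6 : force p c W x u = 0 := (mul_eq_zero.1 h3).resolve_left (sub_ne_zero.2 hx)
        refine ⟨h1, fun i => ?_⟩
        by_cases hu : i = u
        · rw [hu, h6]
        by_cases hv : i = v
        · rw [hv]; linear_combination h4 - h6
        · exact h5 i hu hv
    · rintro (⟨h1, h2⟩ | ⟨y, ⟨h1, h2⟩, rfl⟩)
      · exact ⟨h1, (hdef0 x).2 ⟨by rw [h2, mul_zero], by rw [h2, h2, add_zero], fun i _ _ => h2 i⟩⟩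
      · refine ⟨(hπ.comp_mem_admissible_iff hG' y).2 h1, (hdef0 _).2 ⟨?_, (hcomp y).1 h2⟩⟩
        simp [hπ.apply_eq]
  -- A common point would be a merged configuration with vanishing force at `u`, which `hforce`
  -- excludes.
  have hdisj : Disjoint (criticalPoints G' p c W)
      ((fun y => y ∘ π) '' criticalPoints G'' p c' W') := by
    rw [Set.disjoint_left]
    rintro _ ⟨-, h⟩ ⟨y, hy, rfl⟩
    exact hforce y hy (h u)
  have hmain := eventually_ncard_zeros_eq (H := deformation p c W u v) (isOpen_admissible G' p)
    (fun x hx => contDiffAt_deformation (hadm hx).1 (hadm hx).2 0)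
    (by rw [hZ]; exact hfin.union (hfin'.image _)) ?_ ?_
    -- Having no zero coordinate is an open condition that holds at all limits, so it persists for
    -- small `t`.
    (S := {x | ∀ i, x i ≠ 0}) ?_ ?_
  · filter_upwards [hmain, self_mem_nhdsWithin] with t ht ht0
    rw [hsol t ht0] at ht
    refine ⟨ht.1, ?_, fun x hx => ?_⟩
    · rw [ht.2.1, hZ, Set.ncard_union_eq hdisj hfin (hfin'.image _),
        Set.ncard_image_of_injective _ hπinj]
    · have hx' : x ∈ {x ∈ admissible G' p | deformation p c W u v (x, t) = 0} := by
        rw [hsol t ht0]; exact hx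
      obtain ⟨h1, h2⟩ := ht.2.2 x hx'.1 hx'.2
      refine ⟨h1, nondegenerate_addWeight hne ((hadmG x).1 hx.1).2 hx.2 fun ξ hξ => h2 ξ ?_⟩
      rw [fderiv_deformation (hadm hx'.1).1 (hadm hx'.1).2, hξ]
  · intro x hx hx0 ξ hξ
    rw [fderiv_deformation (hadm hx).1 (hadm hx).2] at hξ
    have hξv := congrFun hξ v
    have hξu := congrFun hξ u
    have hξi : ∀ i, i ≠ u → i ≠ v → forceDeriv p c W x ξ i = 0 := fun i hu hv => by
      simpa [deformationDeriv, hu, hv] using congrFun hξ i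
    simp only [deformationDeriv, if_pos, if_neg hne, Pi.zero_apply] at hξv hξu
    have hx1 : x ∈ {x ∈ admissible G' p | deformation p c W u v (x, 0) = 0} := ⟨hx, hx0⟩
    rw [hZ] at hx1
    by_cases hxuv : x u = x v
    · obtain ⟨y, rfl⟩ := hπ.exists_comp_eq hxuv
      have hy := hmem' y hx hx0
      -- On `x u = x v` the derivative at `v` reduces to `(ξ u - ξ v) * force u`. As the force is
      -- nonzero, `ξ` descends to the contracted graph, where nondegeneracy is known.
      rw [hxuv, sub_self, zero_mul, add_zero] at hξv
      have h3 : ξ u = ξ v :=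
        sub_eq_zero.1 ((mul_eq_zero.1 hξv).resolve_right (hforce y hy))
      obtain ⟨η, rfl⟩ := hπ.exists_comp_eq h3
      have : η = 0 := by
        refine (hgood' y hy).2 η fun i => ?_
        obtain ⟨k, rfl⟩ := hπ.surjective i
        rw [forceDeriv_comp hc hW']
        by_cases hu : k = u
        · rw [hu, hπ.sum_fiber hne, hξu]
        by_cases hv : k = v
        · rw [hv, ← hπ.apply_eq, hπ.sum_fiber hne, hξu]
        · rw [hπ.sum_fiber_of_ne hu hv, hξi k hu hv]
      rw [this]; rfl
    · rcases hx1 with hx1 | ⟨y, -, rfl⟩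
      · have h6 : forceDeriv p c W x ξ u = 0 := by
          rw [hx1.2 u, mul_zero, zero_add] at hξv
          exact (mul_eq_zero.1 hξv).resolve_left (sub_ne_zero.2 hxuv)
        refine (hgood x hx1).2 ξ fun i => ?_
        by_cases hu : i = u
        · rw [hu, h6]
        by_cases hv : i = v
        · rw [hv]; linear_combination hξu - h6
        · exact hξi i hu hv
      · exact absurd (congrArg y hπ.apply_eq) hxuv
  · intro U hU x hx
    have hU0 : ∀ᶠ t in (U : Filter ℂ), t ≠ 0 := hU self_mem_nhdsWithin
    have hlim : Tendsto (fun t : ℂ => t) U (𝓝 0) := hU.trans nhdsWithin_le_nhds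
    refine exists_admissible_tendsto_of_nonResonant (Wt := addWeight u v W) hp hnr U ?_ ?_
      (hx.mono fun t ht => ht.1.1) ?_
    · intro t i j
      unfold addWeight
      rw [hsymm i j, show IsEnds u v i j ↔ IsEnds u v j i from ⟨IsEnds.symm, IsEnds.symm⟩]
    · intro i j
      unfold addWeight
      by_cases he : IsEnds u v i j
      · simpa [he] using hlim.const_add (W i j)
      · simp [he]
    · filter_upwards [hx, hU0] with t ht ht0
      have hxt : x t ∈ criticalPoints G p c (addWeight u v W t) := by
        rw [← hsol t ht0]; exact ht
      refine ⟨fun i j hij => ?_, hxt.2⟩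
      by_cases he : IsEnds u v i j
      · have := ((hadmG _).1 hxt.1).2
        rcases he with ⟨rfl, rfl⟩ | ⟨rfl, rfl⟩
        exacts [this, this.symm]
      · simp only [addWeight, he, if_false, add_zero] at hij
        exact ht.1.2 i j (hW i j hij)
  · have : {x : I → ℂ | ∀ i, x i ≠ 0} = ⋂ i, {x | x i ≠ 0} := by ext; simp
    rw [this]
    exact isOpen_iInter_of_finite fun i => isOpen_ne_fun (by fun_prop) (by fun_prop)
  · rw [hZ]
    rintro x (hx | ⟨y, hy, rfl⟩) i
    · exact (hgood x hx).1 i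
    · exact (hgood' y hy).1 (π i)

end Deformation

end HQD

namespace HQD

set_option linter.unusedSectionVars false

/-! ### Goodness of exponents as a generic property -/

section GenericExponents

open Filter

variable {I A : Type*} [Fintype I] [Fintype A]

/-- Indices of the exponents of the master function. The exponent of `x_i - x_j` is the sum of the
coordinates at `(i, j)` and `(j, i)`. -/
abbrev ExponentIndex (I A : Type*) := (I × A) ⊕ (I × I)

/-- The exponents of the factors `x_i - p_a`. -/
def pointWeight (w : ExponentIndex I A → ℂ) (i : I) (a : A) : ℂ := w (Sum.inl (i, a))

open Classical in
/-- The exponents of the factors `x_i - x_j`. -/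
noncomputable def edgeWeight (G : SimpleGraph I) (w : ExponentIndex I A → ℂ) (i j : I) : ℂ :=
  if G.Adj i j then w (Sum.inr (i, j)) + w (Sum.inr (j, i)) else 0

theorem edgeWeight_symm (G : SimpleGraph I) (w : ExponentIndex I A → ℂ) (i j : I) :
    edgeWeight G w i j = edgeWeight G w j i := by
  by_cases h : G.Adj i j
  · rw [edgeWeight, edgeWeight, if_pos h, if_pos h.symm, add_comm]
  · rw [edgeWeight, edgeWeight, if_neg h, if_neg fun h' => h h'.symm]

theorem adj_of_edgeWeight_ne_zero {G : SimpleGraph I} {w : ExponentIndex I A → ℂ} {i j : I}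
    (h : edgeWeight G w i j ≠ 0) : G.Adj i j := by
  by_contra h'
  exact h (if_neg h')

/-- The set of critical points for the exponents `w`. -/
def criticalSet (G : SimpleGraph I) (p : A → ℂ) (w : ExponentIndex I A → ℂ) : Set (I → ℂ) :=
  criticalPoints G p (pointWeight w) (edgeWeight G w)

/-- There are exactly `N` critical points, and they are nondegenerate with nonzero coordinates. -/
def IsGood (G : SimpleGraph I) (p : A → ℂ) (N : ℕ) (w : ExponentIndex I A → ℂ) : Prop :=
  (criticalSet G p w).Finite ∧ (criticalSet G p w).ncard = N ∧
    ∀ x ∈ criticalSet G p w,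
      (∀ i, x i ≠ 0) ∧ Nondegenerate p (pointWeight w) (edgeWeight G w) x

variable {K : Type*} [Field K] [Algebra K ℂ] {κ : Type*}

/-- The rational points of `ℂ` over `K`. -/
def baseChange (K : Type*) [Field K] [Algebra K ℂ] (p : A → K) (a : A) : ℂ := algebraMap K ℂ (p a)

variable (G : SimpleGraph I) (p : A → K) (X : I → κ) (Λ : ExponentIndex I A → κ)

theorem isBasic_admissible : IsBasic K {v : κ → ℂ | v ∘ X ∈ admissible G (baseChange K p)} := by
  have h1 : IsBasic K {v ∈ (Set.univ : Set (κ → ℂ)) | ∀ i a, v (X i) - baseChange K p a ≠ 0} :=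
    IsBasic.univ.sep_forall fun i => IsBasic.univ.sep_forall fun a =>
      IsBasic.univ.sep_ne_zero ((IsRationalOn.coord _).sub (IsRationalOn.const _))
  have h2 : IsBasic K {v ∈ (Set.univ : Set (κ → ℂ)) |
      ∀ i j, G.Adj i j → v (X i) - v (X j) ≠ 0} :=
    IsBasic.univ.sep_forall fun i => IsBasic.univ.sep_forall fun j =>
      IsBasic.univ.sep_imp fun _ =>
        IsBasic.univ.sep_ne_zero ((IsRationalOn.coord _).sub (IsRationalOn.coord _))
  convert h1.inter h2 using 1
  ext v
  simp [admissible, sub_ne_zero]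

variable {T : Set (κ → ℂ)} (hT : ∀ v ∈ T, v ∘ X ∈ admissible G (baseChange K p))

include hT

theorem isRationalOn_force (i : I) : IsRationalOn K T fun v =>
    force (baseChange K p) (pointWeight (v ∘ Λ)) (edgeWeight G (v ∘ Λ)) (v ∘ X) i := by
  refine IsRationalOn.add (IsRationalOn.sum _ fun a => ?_) (IsRationalOn.sum _ fun j => ?_)
  · exact (IsRationalOn.coord _).div ((IsRationalOn.coord _).sub (IsRationalOn.const _))
      fun v hv => sub_ne_zero.2 ((hT v hv).1 i a)
  · by_cases h : G.Adj i j
    · simp only [edgeWeight, if_pos h]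
      exact ((IsRationalOn.coord _).add (IsRationalOn.coord _)).div
        ((IsRationalOn.coord _).sub (IsRationalOn.coord _))
        fun v hv => sub_ne_zero.2 ((hT v hv).2 i j h)
    · simp only [edgeWeight, if_neg h, zero_div]
      exact IsRationalOn.zero

theorem isRationalOn_forceDeriv (Y : I → κ) (i : I) : IsRationalOn K T fun v =>
    forceDeriv (baseChange K p) (pointWeight (v ∘ Λ)) (edgeWeight G (v ∘ Λ)) (v ∘ X) (v ∘ Y) i := by
  refine IsRationalOn.add (IsRationalOn.sum _ fun a => ?_) (IsRationalOn.sum _ fun j => ?_)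
  · exact ((IsRationalOn.coord _).mul (IsRationalOn.coord _)).neg.div
      (((IsRationalOn.coord _).sub (IsRationalOn.const _)).pow 2)
      fun v hv => pow_ne_zero _ (sub_ne_zero.2 ((hT v hv).1 i a))
  · by_cases h : G.Adj i j
    · simp only [edgeWeight, if_pos h]
      exact (((IsRationalOn.coord _).add (IsRationalOn.coord _)).mul
        ((IsRationalOn.coord _).sub (IsRationalOn.coord _))).neg.div
        (((IsRationalOn.coord _).sub (IsRationalOn.coord _)).pow 2)
        fun v hv => pow_ne_zero _ (sub_ne_zero.2 ((hT v hv).2 i j h))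
    · simp only [edgeWeight, if_neg h, zero_mul, neg_zero, zero_div]
      exact IsRationalOn.zero

omit hT

theorem isBasic_criticalSet :
    IsBasic K {v : κ → ℂ | v ∘ X ∈ criticalSet G (baseChange K p) (v ∘ Λ)} :=
  (isBasic_admissible G p X).sep_forall fun i => (isBasic_admissible G p X).sep_eq_zero
    (isRationalOn_force G p X Λ (fun _ hv => hv) i)

/-- The coordinates of `d` points of `I → ℂ` and of witnesses of their being distinct. -/
abbrev DistinctIndex (d : ℕ) (I : Type*) := (Fin d × I) ⊕ (Fin d × Fin d × I)

/-- The families of `d` distinct critical points. -/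
def distinctCriticalFamilies (d : ℕ) : Set (DistinctIndex d I ⊕ ExponentIndex I A → ℂ) :=
  {v | ∀ s : Fin d, (v ∘ fun i => Sum.inl (Sum.inl (s, i))) ∈
      criticalSet G (baseChange K p) (v ∘ Sum.inr)} ∩
  {v | ∀ s s' : Fin d, s ≠ s' → ∑ i, v (Sum.inl (Sum.inr (s, s', i))) *
      (v (Sum.inl (Sum.inl (s, i))) - v (Sum.inl (Sum.inl (s', i)))) - 1 = 0}

theorem isBasic_distinctCriticalFamilies (d : ℕ) :
    IsBasic K (distinctCriticalFamilies G p d) := by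
  have h1 := IsBasic.univ.sep_forall (K := K) fun s : Fin d =>
    IsBasic.univ.inter (isBasic_criticalSet G p
    (fun i => (Sum.inl (Sum.inl (s, i)) : DistinctIndex d I ⊕ ExponentIndex I A)) Sum.inr)
  have h2 : IsBasic K {v ∈ (Set.univ : Set (DistinctIndex d I ⊕ ExponentIndex I A → ℂ)) |
      ∀ s s' : Fin d, s ≠ s' → ∑ i, v (Sum.inl (Sum.inr (s, s', i))) *
      (v (Sum.inl (Sum.inl (s, i))) - v (Sum.inl (Sum.inl (s', i)))) - 1 = 0} :=
    IsBasic.univ.sep_forall fun s => IsBasic.univ.sep_forall fun s' => IsBasic.univ.sep_imp fun _ =>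
      IsBasic.univ.sep_eq_zero ((IsRationalOn.sum _ fun i => (IsRationalOn.coord _).mul
        ((IsRationalOn.coord _).sub (IsRationalOn.coord _))).sub IsRationalOn.one)
  convert h1.inter h2 using 1
  ext v
  simp [distinctCriticalFamilies]

/-- Two points are distinct exactly when some linear combination of the differences of their
coordinates is `1`. With the coefficients as extra unknowns distinctness is an equation, and having
at least `d` critical points is a projection of a basic set. -/
theorem exists_mem_distinctCriticalFamilies_iff (d : ℕ) (w : ExponentIndex I A → ℂ) :
    (∃ y, Sum.elim y w ∈ distinctCriticalFamilies G p d) ↔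
      (d : ℕ∞) ≤ (criticalSet G (baseChange K p) w).encard := by
  constructor
  · rintro ⟨y, hy, hne⟩
    have hinj : Function.Injective fun (s : Fin d) (i : I) => y (Sum.inl (s, i)) := by
      intro s s' h
      by_contra hss
      have h1 := hne s s' hss
      have h2 : ∀ i, y (Sum.inl (s, i)) = y (Sum.inl (s', i)) := fun i => congrFun h i
      simp [h2] at h1
    have h3 : (d : ℕ∞) = (Set.range fun (s : Fin d) (i : I) => y (Sum.inl (s, i))).encard := by
      rw [← Set.image_univ, hinj.encard_image, Set.encard_univ]
      simp
    rw [h3]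
    refine Set.encard_le_encard ?_
    rintro _ ⟨s, rfl⟩
    exact hy s
  · intro h
    obtain ⟨t, ht, htd⟩ := Set.exists_subset_encard_eq h
    have hfin : t.Finite := Set.finite_of_encard_eq_coe htd
    have hcard : Nat.card t = d := by
      rw [Nat.card_coe_set_eq]
      exact_mod_cast (hfin.cast_ncard_eq.trans htd)
    have := hfin.to_subtype
    let e : t ≃ Fin d := Finite.equivFinOfCardEq hcard
    have hne : ∀ s s' : Fin d, s ≠ s' → ∃ i, (e.symm s : I → ℂ) i ≠ (e.symm s' : I → ℂ) i := by
      intro s s' hss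
      by_contra! hcon
      exact hss (e.symm.injective (Subtype.ext (funext hcon)))
    choose k hk using hne
    classical
    -- The coefficients for a pair are concentrated at one coordinate where the two points differ,
    -- with the inverse of the difference as value.
    refine ⟨Sum.elim (fun q => (e.symm q.1 : I → ℂ) q.2) fun q =>
      if h : q.1 ≠ q.2.1 then if q.2.2 = k q.1 q.2.1 h then
        ((e.symm q.1 : I → ℂ) q.2.2 - (e.symm q.2.1 : I → ℂ) q.2.2)⁻¹ else 0 else 0, fun s => ?_,
      fun s s' hss => ?_⟩
    · exact ht (e.symm s).2
    · simp only [Sum.elim_inl, Sum.elim_inr, dif_pos hss, ite_mul, zero_mul]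
      rw [Finset.sum_eq_single (k s s' hss) (fun j _ hj => if_neg hj) (by simp), if_pos rfl,
        inv_mul_cancel₀ (sub_ne_zero.2 (hk s s' hss)), sub_self]

/-- The critical points whose `i`-th coordinate vanishes. -/
def criticalPointsOnHyperplane (i : I) : Set (I ⊕ ExponentIndex I A → ℂ) :=
  {v ∈ {v | (v ∘ Sum.inl) ∈ criticalSet G (baseChange K p) (v ∘ Sum.inr)} | v (Sum.inl i) = 0}

/-- The critical points with a tangent vector in the kernel of the Hessian whose `i`-th
coordinate is nonzero. -/
def degenerateCriticalPoints (i : I) : Set ((I ⊕ I) ⊕ ExponentIndex I A → ℂ) :=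
  {v ∈ {v ∈ {v | (v ∘ fun i => Sum.inl (Sum.inl i)) ∈
      criticalSet G (baseChange K p) (v ∘ Sum.inr)} |
    ∀ j, forceDeriv (baseChange K p) (pointWeight (v ∘ Sum.inr)) (edgeWeight G (v ∘ Sum.inr))
      (v ∘ fun i => Sum.inl (Sum.inl i)) (v ∘ fun i => Sum.inl (Sum.inr i)) j = 0} |
    v (Sum.inl (Sum.inr i)) ≠ 0}

theorem isBasic_criticalPointsOnHyperplane (i : I) :
    IsBasic K (criticalPointsOnHyperplane G p i) :=
  (isBasic_criticalSet G p _ _).sep_eq_zero (IsRationalOn.coord _)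

theorem isBasic_degenerateCriticalPoints (i : I) :
    IsBasic K (degenerateCriticalPoints G p i) :=
  ((isBasic_criticalSet G p _ _).sep_forall fun j => (isBasic_criticalSet G p _ _).sep_eq_zero
    (isRationalOn_forceDeriv G p _ _ (fun _ hv => hv.1) _ j)).sep_ne_zero (IsRationalOn.coord _)

/-- Finiteness with exactly `N` points means at least `N` but not at least `N + 1`. Each clause is
thus the existence or nonexistence of a point above `w` in a basic set, the form to which the
dichotomy applies. -/
theorem isGood_iff (N : ℕ) (w : ExponentIndex I A → ℂ) : IsGood G (baseChange K p) N w ↔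
    (∃ y, Sum.elim y w ∈ distinctCriticalFamilies G p N) ∧
    (¬ ∃ y, Sum.elim y w ∈ distinctCriticalFamilies G p (N + 1)) ∧
    (∀ i, ¬ ∃ y, Sum.elim y w ∈ criticalPointsOnHyperplane G p i) ∧
    ∀ i, ¬ ∃ y, Sum.elim y w ∈ degenerateCriticalPoints G p i := by
  rw [exists_mem_distinctCriticalFamilies_iff, exists_mem_distinctCriticalFamilies_iff]
  set S := criticalSet G (baseChange K p) w with hS
  have hcard : (S.Finite ∧ S.ncard = N) ↔ ((N : ℕ∞) ≤ S.encard ∧ ¬ ((N + 1 : ℕ) : ℕ∞) ≤ S.encard) := by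
    constructor
    · rintro ⟨h1, h2⟩
      rw [← h1.cast_ncard_eq, h2]
      constructor
      · exact le_rfl
      · rw [Nat.cast_le]; omega
    · rintro ⟨h1, h2⟩
      have h3 : S.encard < ((N + 1 : ℕ) : ℕ∞) := not_le.1 h2
      have h4 : S.Finite := Set.encard_lt_top_iff.1 (h3.trans (ENat.natCast_lt_top _))
      rw [← h4.cast_ncard_eq, Nat.cast_le] at h1
      rw [← h4.cast_ncard_eq, Nat.cast_lt] at h3
      exact ⟨h4, by omega⟩
  rw [IsGood, ← and_assoc, hcard, and_assoc]
  refine and_congr_right fun _ => and_congr_right fun _ => ?_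
  constructor
  · intro h
    refine ⟨?_, ?_⟩
    · rintro i ⟨y, hy, hy0⟩
      exact (h y hy).1 i hy0
    · rintro i ⟨y, ⟨hy, hd⟩, hy0⟩
      exact hy0 (congrFun ((h _ hy).2 _ hd) i)
  · rintro ⟨h1, h2⟩ x hx
    refine ⟨fun i hi => h1 i ⟨x, hx, hi⟩, fun ξ hξ => ?_⟩
    by_contra hne
    obtain ⟨i, hi⟩ := Function.ne_iff.1 hne
    exact h2 i ⟨Sum.elim x ξ, ⟨hx, hξ⟩, hi⟩

/-- If good exponents are Zariski dense, then generic exponents are good. -/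
theorem eventually_isGood_of_frequently {N : ℕ}
    (h : ∃ᶠ w in genericFilter K (ExponentIndex I A), IsGood G (baseChange K p) N w) :
    ∀ᶠ w in genericFilter K (ExponentIndex I A), IsGood G (baseChange K p) N w := by
  simp only [isGood_iff] at h ⊢
  refine ((isBasic_distinctCriticalFamilies G p N).eventually_exists_of_frequently
    (h.mono fun w hw => hw.1)).and
    (((isBasic_distinctCriticalFamilies G p (N + 1)).eventually_not_exists_of_frequently
    (h.mono fun w hw => hw.2.1)).and ((eventually_all.2 fun i => ?_).and (eventually_all.2 fun i => ?_)))
  · exact (isBasic_criticalPointsOnHyperplane G p i).eventually_not_exists_of_frequently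
      (h.mono fun w hw => hw.2.2.1 i)
  · exact (isBasic_degenerateCriticalPoints G p i).eventually_not_exists_of_frequently
      (h.mono fun w hw => hw.2.2.2 i)

end GenericExponents

end HQD

namespace HQD

set_option linter.unusedSectionVars false

/-! ### Deletion-contraction for generic exponents -/

section InductionStep

open Filter Topology

/-- Finitely many linear forms in the exponents must not vanish, and each is nonzero at a test
vector. Point exponents `1` and edge exponents `0` serve for `infinity` and `point`; the opposite
choice serves for `diagonal`. -/
theorem eventually_nonResonant {I A : Type*} [Fintype I] [Fintype A] [DecidableEq I] [Nonempty A]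
    {K : Type*} [Field K] [Algebra K ℂ] (G : SimpleGraph I) :
    ∀ᶠ w in genericFilter K (ExponentIndex I A),
      NonResonant G (pointWeight w) (edgeWeight G w) := by
  have hpt : ∀ i a, IsRationalOn K (Set.univ : Set (ExponentIndex I A → ℂ))
      fun w => pointWeight w i a := fun i a => IsRationalOn.coord _
  have hedge : ∀ i j, IsRationalOn K (Set.univ : Set (ExponentIndex I A → ℂ))
      fun w => edgeWeight G w i j := fun i j =>
    IsRationalOn.ite (fun _ => (IsRationalOn.coord _).add (IsRationalOn.coord _))
      fun _ => IsRationalOn.zero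
  have hsum : ∀ S : Finset I, IsRationalOn K (Set.univ : Set (ExponentIndex I A → ℂ))
      fun w => ∑ i ∈ S, ∑ j ∈ S, edgeWeight G w i j := fun S =>
    IsRationalOn.sum _ fun i => IsRationalOn.sum _ fun j => hedge i j
  have htwo : IsRationalOn K (Set.univ : Set (ExponentIndex I A → ℂ)) fun _ => (2 : ℂ) :=
    (IsRationalOn.const 2).congr fun _ _ => (map_ofNat (algebraMap K ℂ) 2).symm
  let w₀ : ExponentIndex I A → ℂ := Sum.elim (fun _ => 1) fun _ => 0
  let w₁ : ExponentIndex I A → ℂ := Sum.elim (fun _ => 0) fun _ => 1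
  have hw₀ : ∀ i j, edgeWeight G w₀ i j = 0 := fun i j => by simp [edgeWeight, w₀]
  have h1 : ∀ᶠ w in genericFilter K (ExponentIndex I A), ∀ S : Finset I, S.Nonempty →
      ∑ i ∈ S, (∑ a, pointWeight w i a + ∑ j ∈ Sᶜ, edgeWeight G w i j) +
        (∑ i ∈ S, ∑ j ∈ S, edgeWeight G w i j) / 2 ≠ 0 := by
    refine eventually_all.2 fun S => eventually_imp_distrib_left.2 fun hS => ?_
    refine IsRationalOn.eventually_ne_zero (v := w₀) ((IsRationalOn.sum _ fun i =>
      (IsRationalOn.sum _ fun a => hpt i a).add (IsRationalOn.sum _ fun j => hedge i j)).add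
      ((hsum S).div htwo fun _ _ => two_ne_zero)) ?_
    simp [hw₀, pointWeight, w₀, hS.ne_empty]
  have h2 : ∀ᶠ w in genericFilter K (ExponentIndex I A), ∀ S : Finset I, S.Nonempty → ∀ a,
      ∑ i ∈ S, pointWeight w i a + (∑ i ∈ S, ∑ j ∈ S, edgeWeight G w i j) / 2 ≠ 0 := by
    refine eventually_all.2 fun S => eventually_imp_distrib_left.2 fun hS =>
      eventually_all.2 fun a => ?_
    refine IsRationalOn.eventually_ne_zero (v := w₀) ((IsRationalOn.sum _ fun i => hpt i a).add
      ((hsum S).div htwo fun _ _ => two_ne_zero)) ?_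
    simp [hw₀, pointWeight, w₀, hS.ne_empty]
  have h3 : ∀ᶠ w in genericFilter K (ExponentIndex I A), ∀ S : Finset I,
      (∃ i ∈ S, ∃ j ∈ S, G.Adj i j) → ∑ i ∈ S, ∑ j ∈ S, edgeWeight G w i j ≠ 0 := by
    classical
    refine eventually_all.2 fun S => eventually_imp_distrib_left.2 ?_
    rintro ⟨i, hi, j, hj, hij⟩
    refine IsRationalOn.eventually_ne_zero (v := w₁) (hsum S) ?_
    -- Written as the image of a natural number, the sum can vanish only if every term does.
    have h4 : ∑ i ∈ S, ∑ j ∈ S, edgeWeight G w₁ i j =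
        ((∑ i ∈ S, ∑ j ∈ S, if G.Adj i j then 2 else 0 : ℕ) : ℂ) := by
      push_cast
      refine Finset.sum_congr rfl fun i _ => Finset.sum_congr rfl fun j _ => ?_
      simp only [edgeWeight, w₁, Sum.elim_inr]
      split_ifs <;> norm_num
    rw [h4, Nat.cast_ne_zero]
    intro h5
    have h6 := Finset.sum_eq_zero_iff.1 (Finset.sum_eq_zero_iff.1 h5 i hi) j hj
    simp [hij] at h6
  filter_upwards [h1, h2, h3] with w h1 h2 h3
  exact ⟨h1, h2, h3⟩

open Classical in
/-- Sums over the part of the fibres of `f` where `Q` holds. -/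
noncomputable def fiberSum {X Y : Type*} [Fintype X] (f : X → Y) (Q : X → Prop) (w : X → ℂ)
    (y : Y) : ℂ :=
  ∑ x, if f x = y ∧ Q x then w x else 0

theorem fiberSum_surjective {X Y : Type*} [Fintype X] {f : X → Y} {Q : X → Prop}
    (h : ∀ y, ∃ x, f x = y ∧ Q x) : Function.Surjective (fiberSum f Q) := by
  classical
  intro w
  choose s hs hQ using h
  refine ⟨fun x => if x = s (f x) then w (f x) else 0, funext fun y => ?_⟩
  unfold fiberSum
  rw [Finset.sum_eq_single (s y)]
  · simp [hs, hQ]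
  · intro x _ hx
    by_cases h1 : f x = y ∧ Q x
    · rw [if_pos h1]
      exact if_neg fun h2 => hx (h1.1 ▸ h2)
    · rw [if_neg h1]
  · simp

variable {I A I' : Type*} [Fintype I] [Fintype A] [Fintype I']
variable {K : Type*} [Field K] [Algebra K ℂ]

/-- The exponents induced on the contracted graph. -/
noncomputable def contractExponents (G : SimpleGraph I) (π : I → I') (G'' : SimpleGraph I')
    (w : ExponentIndex I A → ℂ) : ExponentIndex I' A → ℂ :=
  Sum.elim (fiberSum (Prod.map π id) (fun _ => True) fun q => w (Sum.inl q))
    (fiberSum (Prod.map π π) (fun q => G.Adj q.1 q.2 ∨ ¬ G''.Adj (π q.1) (π q.2))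
      fun q => w (Sum.inr q))

variable {G G' : SimpleGraph I} {G'' : SimpleGraph I'} {π : I → I'} {u v : I}

/-- The map on exponents is linear and surjective, so it respects genericity. Where `G''` has an
edge only pairs adjacent in `G` are summed. Where it has none, all pairs are admitted: those
coordinates do not affect `edgeWeight`, but surjectivity needs every fibre to contain an admitted
pair. -/
theorem tendsto_contractExponents (hπ : IsContraction G u v π G'') :
    Tendsto (contractExponents (A := A) G π G'') (genericFilter K (ExponentIndex I A))
      (genericFilter K (ExponentIndex I' A)) := by
  classical
  refine tendsto_genericFilter (fun q => ?_) fun w => ?_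
  · rcases q with q | q
    · exact IsRationalOn.sum _ fun x =>
        IsRationalOn.ite (fun _ => IsRationalOn.coord _) fun _ => IsRationalOn.zero
    · exact IsRationalOn.sum _ fun x =>
        IsRationalOn.ite (fun _ => IsRationalOn.coord _) fun _ => IsRationalOn.zero
  · obtain ⟨w₁, hw₁⟩ := fiberSum_surjective (f := Prod.map π (id : A → A)) (Q := fun _ => True)
      (fun y => by
        obtain ⟨k, hk⟩ := hπ.surjective y.1
        exact ⟨(k, y.2), Prod.ext hk rfl, trivial⟩) fun q => w (Sum.inl q)
    obtain ⟨w₂, hw₂⟩ := fiberSum_surjective (f := Prod.map π π)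
      (Q := fun q => G.Adj q.1 q.2 ∨ ¬ G''.Adj (π q.1) (π q.2)) (fun y => by
        by_cases h : G''.Adj y.1 y.2
        · obtain ⟨-, k, l, hk, hl, hkl⟩ := (hπ.adj_iff _ _).1 h
          exact ⟨(k, l), Prod.ext hk hl, Or.inl hkl⟩
        · obtain ⟨k, hk⟩ := hπ.surjective y.1
          obtain ⟨l, hl⟩ := hπ.surjective y.2
          refine ⟨(k, l), Prod.ext hk hl, Or.inr ?_⟩
          rwa [hk, hl]) fun q => w (Sum.inr q)
    refine ⟨Sum.elim w₁ w₂, funext fun q => ?_⟩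
    rcases q with q | q
    · exact congrFun hw₁ q
    · exact congrFun hw₂ q

theorem pointWeight_contractExponents [DecidableEq I'] (w : ExponentIndex I A → ℂ) (i : I')
    (a : A) : pointWeight (contractExponents G π G'' w) i a =
      ∑ k with π k = i, pointWeight w k a := by
  classical
  simp only [pointWeight, contractExponents, Sum.elim_inl, fiberSum, and_true]
  rw [Fintype.sum_prod_type, Finset.sum_filter]
  refine Finset.sum_congr rfl fun k _ => ?_
  simp only [Prod.map_apply, id, Prod.mk.injEq]
  by_cases hk : π k = i <;> simp [hk]

theorem edgeWeight_contractExponents [DecidableEq I'] (hπ : IsContraction G u v π G'')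
    (hG' : ∀ i j, G'.Adj i j ↔ G.Adj i j ∧ ¬ IsEnds u v i j)
    (w : ExponentIndex I A → ℂ) {i j : I'} (hij : i ≠ j) :
    edgeWeight G'' (contractExponents G π G'' w) i j =
      ∑ k with π k = i, ∑ l with π l = j, edgeWeight G' w k l := by
  classical
  -- The deleted edge lies inside a fibre, so `G` and `G'` agree between different fibres.
  have hadj : ∀ k l, π k = i → π l = j → (G'.Adj k l ↔ G.Adj k l) := by
    rintro k l rfl rfl
    rw [hG', and_iff_left_iff_imp]
    exact fun _ he => hij ((hπ.eq_iff k l).2 (Or.inr he))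
  have hright : ∑ k with π k = i, ∑ l with π l = j, edgeWeight G' w k l =
      ∑ k with π k = i, ∑ l with π l = j,
        if G.Adj k l then w (Sum.inr (k, l)) + w (Sum.inr (l, k)) else 0 := by
    refine Finset.sum_congr rfl fun k hk => Finset.sum_congr rfl fun l hl => ?_
    simp only [edgeWeight, hadj k l (Finset.mem_filter.1 hk).2 (Finset.mem_filter.1 hl).2]
  rw [hright]
  by_cases h : G''.Adj i j
  · have hinr : ∀ i j : I', G''.Adj i j → contractExponents G π G'' w (Sum.inr (i, j)) =
        ∑ k with π k = i, ∑ l with π l = j, if G.Adj k l then w (Sum.inr (k, l)) else 0 := by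
      intro i j h
      simp only [contractExponents, Sum.elim_inr, fiberSum]
      rw [Fintype.sum_prod_type, Finset.sum_filter]
      refine Finset.sum_congr rfl fun k _ => ?_
      rw [Finset.sum_filter]
      by_cases hk : π k = i
      · rw [if_pos hk]
        refine Finset.sum_congr rfl fun l _ => ?_
        by_cases hl : π l = j
        · simp [hk, hl, h]
        · simp [hl]
      · simp [hk]
    rw [edgeWeight, if_pos h, hinr i j h, hinr j i h.symm]
    rw [Finset.sum_comm (s := Finset.univ.filter fun k => π k = j)]
    simp only [← Finset.sum_add_distrib]
    refine Finset.sum_congr rfl fun k _ => Finset.sum_congr rfl fun l _ => ?_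
    rw [G.adj_comm l k]
    split_ifs <;> simp
  · rw [edgeWeight, if_neg h]
    refine (Finset.sum_eq_zero fun k hk => Finset.sum_eq_zero fun l hl => if_neg fun hkl => h ?_).symm
    exact (hπ.adj_iff i j).2 ⟨hij, k, l, (Finset.mem_filter.1 hk).2, (Finset.mem_filter.1 hl).2, hkl⟩

/-- The number of critical points for generic exponents satisfies deletion-contraction. -/
theorem eventually_isGood_of_delete_contract [Nonempty A] {p : A → K}
    (hp : Function.Injective p) (huv : G.Adj u v)
    (hG' : ∀ i j, G'.Adj i j ↔ G.Adj i j ∧ ¬ IsEnds u v i j) (hπ : IsContraction G u v π G'')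
    {N N' : ℕ}
    (h : ∀ᶠ w in genericFilter K (ExponentIndex I A), IsGood G' (baseChange K p) N w)
    (h' : ∀ᶠ w in genericFilter K (ExponentIndex I' A), IsGood G'' (baseChange K p) N' w) :
    ∀ᶠ w in genericFilter K (ExponentIndex I A), IsGood G (baseChange K p) (N + N') w := by
  classical
  have hpinj : Function.Injective (baseChange K p) := (algebraMap K ℂ).injective.comp hp
  -- If good exponents for `G` were not dense, some `P ≠ 0` would certify at once goodness for `G'`
  -- and `G''`, nonresonance, and failure of goodness for `G`. The deformation produces a point with
  -- `P ≠ 0` that is good for `G`.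
  refine eventually_isGood_of_frequently G p fun hcon => ?_
  obtain ⟨P, hP, H⟩ := mem_genericFilter.1 ((h.and ((tendsto_contractExponents hπ).eventually h')).and
    ((eventually_nonResonant (K := K) (A := A) G').and hcon))
  obtain ⟨w₀, -, hw₀⟩ := exists_aeval_ne_zero hP Set.univ Set.infinite_univ
  obtain ⟨a₀⟩ := ‹Nonempty A›
  have hne : u ≠ v := huv.ne
  -- The shift by `s` at `(u, a₀)` and `-s` at `(v, a₀)` leaves the edge weights and all contracted
  -- exponents fixed, but adds `s / (x u - p a₀)` to the force at `u`. Each of the finitely many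
  -- critical points of the contraction therefore rules out at most one `s`.
  let γ : ExponentIndex I A → Polynomial ℂ := fun q => Polynomial.C (w₀ q) +
    if q = Sum.inl (u, a₀) then Polynomial.X else if q = Sum.inl (v, a₀) then -Polynomial.X else 0
  let w : ℂ → ExponentIndex I A → ℂ := fun s q => (γ q).eval s
  have hw : ∀ s q, w s q = w₀ q +
      if q = Sum.inl (u, a₀) then s else if q = Sum.inl (v, a₀) then -s else 0 := by
    intro s q
    simp only [w, γ, Polynomial.eval_add, Polynomial.eval_C]
    split_ifs <;> simp
  have hw0 : w 0 = w₀ := by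
    funext q
    rw [hw]
    simp
  have hfin1 : {s | MvPolynomial.aeval (w s) P = 0}.Finite :=
    finite_aeval_curve_eq_zero P γ (s₀ := 0) (by
      change MvPolynomial.aeval (w 0) P ≠ 0
      rwa [hw0])
  have hedge : ∀ s, edgeWeight G' (w s) = edgeWeight G' w₀ := by
    intro s
    funext i j
    simp [edgeWeight, hw]
  have hpoint : ∀ s k a, pointWeight (w s) k a = pointWeight w₀ k a +
      if a = a₀ then (if k = u then s else if k = v then -s else 0) else 0 := by
    intro s k a
    simp only [pointWeight, hw, Sum.inl.injEq, Prod.mk.injEq]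
    by_cases ha : a = a₀ <;> simp [ha]
  have hcontract : ∀ s, contractExponents G π G'' (w s) = contractExponents G π G'' w₀ := by
    intro s
    funext q
    rcases q with ⟨i, a⟩ | q
    · change pointWeight (contractExponents G π G'' (w s)) i a =
        pointWeight (contractExponents G π G'' w₀) i a
      rw [pointWeight_contractExponents, pointWeight_contractExponents]
      simp only [hpoint, Finset.sum_add_distrib, add_eq_left]
      obtain ⟨k, rfl⟩ := hπ.surjective i
      by_cases hku : k = u
      · rw [hku, hπ.sum_fiber hne]
        by_cases ha : a = a₀ <;> simp [ha, hne.symm]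
      by_cases hkv : k = v
      · rw [hkv, ← hπ.apply_eq, hπ.sum_fiber hne]
        by_cases ha : a = a₀ <;> simp [ha, hne.symm]
      · rw [hπ.sum_fiber_of_ne hku hkv]
        simp [hku, hkv]
    · simp [contractExponents, hw]
  have hfinY := (H w₀ hw₀).1.2.1
  set Y := criticalSet G'' (baseChange K p) (contractExponents G π G'' w₀) with hY
  have hforce : ∀ s (x : I → ℂ), force (baseChange K p) (pointWeight (w s)) (edgeWeight G' w₀) x u =
      force (baseChange K p) (pointWeight w₀) (edgeWeight G' w₀) x u +
        s / (x u - baseChange K p a₀) := by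
    intro s x
    simp only [force, hpoint, add_div, Finset.sum_add_distrib]
    simp only [if_true, ite_div, zero_div, Finset.sum_ite_eq', Finset.mem_univ]
    ring
  have hfin2 : (⋃ y ∈ Y, {s : ℂ | force (baseChange K p) (pointWeight (w s)) (edgeWeight G' w₀)
      (y ∘ π) u = 0}).Finite := by
    refine hfinY.biUnion fun y hy => Set.Subsingleton.finite ?_
    intro s hs s' hs'
    rw [Set.mem_ofPred_eq, hforce] at hs hs'
    have h1 : s / ((y ∘ π) u - baseChange K p a₀) = s' / ((y ∘ π) u - baseChange K p a₀) := by
      linear_combination hs - hs'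
    exact (div_left_inj' (sub_ne_zero.2 (hy.1.1 (π u) a₀))).1 h1
  obtain ⟨s, hs⟩ := (hfin1.union hfin2).exists_notMem
  rw [Set.mem_union, not_or] at hs
  obtain ⟨hs1, hs2⟩ := hs
  set w₁ := w s with hw₁
  obtain ⟨⟨hgood, hgood'⟩, hnr, -⟩ := H w₁ hs1
  have hdc := eventually_ncard_criticalPoints (G := G) (G' := G') (G'' := G'')
    (p := baseChange K p) (c := pointWeight w₁) (W := edgeWeight G' w₁)
    (c' := pointWeight (contractExponents G π G'' w₁))
    (W' := edgeWeight G'' (contractExponents G π G'' w₁)) hpinj huv hG' hπ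
    (edgeWeight_symm _ _) (fun i j => adj_of_edgeWeight_ne_zero)
    (pointWeight_contractExponents _) (fun i j => edgeWeight_contractExponents hπ hG' _) hnr
    hgood.1 hgood.2.2 hgood'.1 hgood'.2.2 (fun y hy h0 => hs2 ?_)
  swap
  · refine Set.mem_biUnion (x := y) ?_ ?_
    · rw [hY, ← hcontract s]; exact hy
    · rw [Set.mem_ofPred_eq, ← hedge s]; exact h0
  -- The coordinate at `(u, v)` is chosen so that its sum with the one at `(v, u)`, the weight of
  -- the edge, is `t`. The curve passes through `w₁`, where `P ≠ 0`, so small `t ≠ 0` with `P ≠ 0`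
  -- exist.
  let δ : ExponentIndex I A → Polynomial ℂ := fun q =>
    if q = Sum.inr (u, v) then Polynomial.X - Polynomial.C (w₁ (Sum.inr (v, u)))
    else Polynomial.C (w₁ q)
  let w' : ℂ → ExponentIndex I A → ℂ := fun t q => (δ q).eval t
  have hw' : ∀ t q, w' t q = if q = Sum.inr (u, v) then t - w₁ (Sum.inr (v, u)) else w₁ q := by
    intro t q
    simp only [w', δ]
    split_ifs <;> simp
  have hfin3 : {t | MvPolynomial.aeval (w' t) P = 0}.Finite := by
    refine finite_aeval_curve_eq_zero P δ (s₀ := w₁ (Sum.inr (u, v)) + w₁ (Sum.inr (v, u))) ?_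
    have : w' (w₁ (Sum.inr (u, v)) + w₁ (Sum.inr (v, u))) = w₁ := by
      funext q
      rw [hw']
      split_ifs with hq
      · rw [hq]; ring
      · rfl
    change MvPolynomial.aeval (w' (w₁ (Sum.inr (u, v)) + w₁ (Sum.inr (v, u)))) P ≠ 0
    rw [this]
    exact hs1
  have hev : ∀ᶠ t in 𝓝[≠] (0 : ℂ), MvPolynomial.aeval (w' t) P ≠ 0 :=
    nhdsNE_le_cofinite 0 hfin3.compl_mem_cofinite
  obtain ⟨t, ht, htP⟩ := (hdc.and hev).exists
  refine (H (w' t) htP).2.2 ?_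
  have hpw : pointWeight (w' t) = pointWeight w₁ := by
    funext i a
    simp [pointWeight, hw']
  have hew : edgeWeight G (w' t) = addWeight u v (edgeWeight G' w₁) t := by
    funext i j
    simp only [edgeWeight, addWeight, hw', hG', Sum.inr.injEq, Prod.mk.injEq]
    by_cases he : IsEnds u v i j
    · have hij : G.Adj i j := by
        rcases he with ⟨rfl, rfl⟩ | ⟨rfl, rfl⟩
        exacts [huv, huv.symm]
      rw [if_pos hij, if_pos he, if_neg (c := G.Adj i j ∧ ¬ IsEnds u v i j) (fun h => h.2 he), zero_add]
      rcases he with ⟨rfl, rfl⟩ | ⟨rfl, rfl⟩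
      · simp [hne]
      · simp [hne.symm]
    · have h1 : ¬ (i = u ∧ j = v) := fun h => he (Or.inl h)
      have h2 : ¬ (j = u ∧ i = v) := fun h => he (Or.inr ⟨h.2, h.1⟩)
      rw [if_neg h1, if_neg h2, if_neg he, add_zero]
      simp only [he, not_false_eq_true, and_true]
  have hgood1 := hgood.2.1
  have hgood2 := hgood'.2.1
  unfold criticalSet at hgood1 hgood2
  change IsGood G (baseChange K p) (N + N') (w' t)
  unfold IsGood criticalSet
  rw [hpw, hew]
  exact ⟨ht.1, by rw [ht.2.1, hgood1, hgood2], ht.2.2⟩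

end InductionStep

end HQD

namespace HQD

/-! ### The base case: graphs without edges -/

section Edgeless

open Filter Topology

variable {A : Type*} [Fintype A]

/-- The critical points in one variable. -/
def residueZeros (p c : A → ℂ) : Set ℂ := {x | (∀ a, x ≠ p a) ∧ ∑ a, c a / (x - p a) = 0}

open Polynomial in
/-- The numerator of `∑ c_a / (x - p_a) ^ n`. -/
noncomputable def residueNumerator [DecidableEq A] (n : ℕ) (p c : A → ℂ) : ℂ[X] :=
  ∑ a, C (c a) * (∏ b ∈ Finset.univ.erase a, (X - C (p b))) ^ n

theorem eval_residueNumerator [DecidableEq A] (n : ℕ) {p : A → ℂ} (c : A → ℂ) {x : ℂ}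
    (hx : ∀ a, x ≠ p a) : (residueNumerator n p c).eval x =
      (∏ b, (x - p b)) ^ n * ∑ a, c a / (x - p a) ^ n := by
  rw [residueNumerator, Polynomial.eval_finsetSum, Finset.mul_sum]
  refine Finset.sum_congr rfl fun a _ => ?_
  have h := sub_ne_zero.2 (hx a)
  rw [← Finset.mul_prod_erase Finset.univ _ (Finset.mem_univ a)]
  simp only [Polynomial.eval_mul, Polynomial.eval_C, Polynomial.eval_pow, Polynomial.eval_prod,
    Polynomial.eval_sub, Polynomial.eval_X]
  field_simp
  rw [mul_pow]
  ring

theorem eval_residueNumerator_self_ne_zero [DecidableEq A] {n : ℕ} (hn : n ≠ 0) {p c : A → ℂ}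
    (hp : Function.Injective p) {a : A} (ha : c a ≠ 0) : (residueNumerator n p c).eval (p a) ≠ 0 := by
  rw [residueNumerator, Polynomial.eval_finsetSum, Finset.sum_eq_single a]
  · simp only [Polynomial.eval_mul, Polynomial.eval_C, Polynomial.eval_pow, Polynomial.eval_prod,
      Polynomial.eval_sub, Polynomial.eval_X]
    refine mul_ne_zero ha (pow_ne_zero _ (Finset.prod_ne_zero_iff.2 fun b hb => ?_))
    exact sub_ne_zero.2 fun h => Finset.ne_of_mem_erase hb (hp h).symm
  · intro b _ hb
    simp only [Polynomial.eval_mul, Polynomial.eval_C, Polynomial.eval_pow, Polynomial.eval_prod,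
      Polynomial.eval_sub, Polynomial.eval_X]
    rw [Finset.prod_eq_zero (Finset.mem_erase.2 ⟨hb.symm, Finset.mem_univ a⟩) (sub_self _),
      zero_pow hn, mul_zero]
  · simp

/-- Each summand is `c a` times a monic polynomial of degree `|A| - 1`, so the coefficient in this
degree is `∑ c a`. -/
theorem natDegree_residueNumerator [DecidableEq A] {p c : A → ℂ} (hc : ∑ a, c a ≠ 0) :
    (residueNumerator 1 p c).natDegree = Fintype.card A - 1 := by
  have hmonic : ∀ a : A, (∏ b ∈ Finset.univ.erase a,
      (Polynomial.X - Polynomial.C (p b))).Monic := fun a =>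
    Polynomial.monic_prod_of_monic _ _ fun b _ => Polynomial.monic_X_sub_C _
  have hdeg : ∀ a : A, (∏ b ∈ Finset.univ.erase a,
      (Polynomial.X - Polynomial.C (p b))).natDegree = Fintype.card A - 1 := by
    intro a
    rw [Polynomial.natDegree_prod_of_monic _ _ fun b _ => Polynomial.monic_X_sub_C _]
    simp [Finset.card_erase_of_mem]
  refine le_antisymm ?_ (Polynomial.le_natDegree_of_ne_zero ?_)
  · refine Polynomial.natDegree_sum_le_of_forall_le _ _ fun a _ => ?_
    rw [pow_one]
    exact (Polynomial.natDegree_C_mul_le _ _).trans (hdeg a).le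
  · rw [residueNumerator, Polynomial.finsetSum_coeff]
    have : ∀ a ∈ Finset.univ, (Polynomial.C (c a) * (∏ b ∈ Finset.univ.erase a,
        (Polynomial.X - Polynomial.C (p b))) ^ 1).coeff (Fintype.card A - 1) = c a := by
      intro a _
      rw [pow_one, Polynomial.coeff_C_mul]
      have h := (hmonic a).coeff_natDegree
      rw [hdeg a] at h
      rw [h, mul_one]
    rwa [Finset.sum_congr rfl this]

/-- The zeros are the roots of the numerator: no pole is a root, since every `c a` is nonzero. At a
zero the derivative of the sum is `-∑ c a / (x - p a) ^ 2`, so `hsimple` makes all roots simple and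
their number is the degree. -/
theorem residueZeros_finite_ncard {p c : A → ℂ} (hp : Function.Injective p) (hc : ∀ a, c a ≠ 0)
    (hsum : ∑ a, c a ≠ 0) (hsimple : ∀ x ∈ residueZeros p c, ∑ a, c a / (x - p a) ^ 2 ≠ 0) :
    (residueZeros p c).Finite ∧ (residueZeros p c).ncard = Fintype.card A - 1 := by
  classical
  set f := residueNumerator 1 p c with hf
  have hf0 : f ≠ 0 := by
    intro h
    obtain ⟨a⟩ : Nonempty A := by
      by_contra hA
      rw [not_nonempty_iff] at hA
      simp at hsum
    exact eval_residueNumerator_self_ne_zero one_ne_zero hp (hc a) (by rw [← hf, h]; simp)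
  have hprod : ∀ x, (∀ a, x ≠ p a) → ∏ b, (x - p b) ≠ 0 := fun x hx =>
    Finset.prod_ne_zero_iff.2 fun b _ => sub_ne_zero.2 (hx b)
  have hroot : ∀ x, f.IsRoot x ↔ x ∈ residueZeros p c := by
    intro x
    constructor
    · intro h
      have hx : ∀ a, x ≠ p a := fun a ha =>
        eval_residueNumerator_self_ne_zero one_ne_zero hp (hc a) (ha ▸ h)
      refine ⟨hx, ?_⟩
      rw [Polynomial.IsRoot, hf, eval_residueNumerator 1 c hx, pow_one] at h
      simpa using (mul_eq_zero.1 h).resolve_left (hprod x hx)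
    · rintro ⟨hx, h⟩
      rw [Polynomial.IsRoot, hf, eval_residueNumerator 1 c hx]
      simp [h]
  have hset : residueZeros p c = (f.roots.toFinset : Set ℂ) := by
    ext x
    rw [← hroot]
    simp [hf0]
  have hderiv : ∀ x ∈ residueZeros p c, ¬ f.derivative.IsRoot x := by
    rintro x hx h
    have hne : ∀ a, x - p a ≠ 0 := fun a => sub_ne_zero.2 (hx.1 a)
    have hφ : HasDerivAt (fun y => ∑ a, c a / (y - p a)) (∑ a, -c a / (x - p a) ^ 2) x := by
      refine HasDerivAt.fun_sum fun a _ => ?_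
      have := (hasDerivAt_const x (c a)).fun_div ((hasDerivAt_id x).sub_const (p a)) (hne a)
      simpa using this
    obtain ⟨g', hg'⟩ : ∃ g', HasDerivAt (fun y => ∏ b, (y - p b)) g' x := by
      have : DifferentiableAt ℂ (fun y => ∏ b, (y - p b)) x :=
        DifferentiableAt.fun_finsetProd fun b _ => by fun_prop
      exact ⟨_, this.hasDerivAt⟩
    have hmul := hg'.fun_mul hφ
    have hev : (fun y => (∏ b, (y - p b)) * ∑ a, c a / (y - p a)) =ᶠ[𝓝 x] fun y => f.eval y := by
      have : ∀ᶠ y in 𝓝 x, ∀ a, y ≠ p a := eventually_all.2 fun a =>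
        isOpen_ne.mem_nhds (hx.1 a)
      filter_upwards [this] with y hy
      rw [hf, eval_residueNumerator 1 c hy]
      simp
    have h2 := (hmul.congr_of_eventuallyEq hev.symm).unique (f.hasDerivAt x)
    rw [Polynomial.IsRoot] at h
    rw [h, hx.2, mul_zero, zero_add] at h2
    refine hsimple x hx ?_
    have h3 := (mul_eq_zero.1 h2).resolve_left (hprod x hx.1)
    simp only [neg_div, Finset.sum_neg_distrib, neg_eq_zero] at h3
    exact h3
  have hnodup : f.roots.Nodup := by
    rw [Multiset.nodup_iff_count_le_one]
    intro x
    rw [Polynomial.count_roots]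
    by_contra hlt
    obtain ⟨h1, h2⟩ := (Polynomial.one_lt_rootMultiplicity_iff_isRoot hf0).1 (not_le.1 hlt)
    exact hderiv x ((hroot x).1 h1) h2
  refine ⟨hset ▸ Finset.finite_toSet _, ?_⟩
  rw [hset, Set.ncard_coe_finset, Multiset.toFinset_card_of_nodup hnodup,
    ← natDegree_residueNumerator (p := p) hsum, ← hf]
  exact (IsAlgClosed.splits f).natDegree_eq_card_roots.symm

/-- Along a coordinate direction, all but finitely many residues have simple nonzero zeros. -/
theorem finite_degenerate_residues [DecidableEq A] {p c : A → ℂ} (hp : Function.Injective p)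
    (hc : ∀ a, c a ≠ 0) (a₀ : A) :
    {s : ℂ | ¬ ((∀ a, c a + (if a = a₀ then s else 0) ≠ 0) ∧
      ∑ a, (c a + if a = a₀ then s else 0) ≠ 0 ∧
      ∀ x ∈ residueZeros p fun a => c a + if a = a₀ then s else 0, x ≠ 0 ∧
        ∑ a, (c a + if a = a₀ then s else 0) / (x - p a) ^ 2 ≠ 0)}.Finite := by
  -- At a double zero, `(x - p a₀) * ∑ c_a / (x - p_a) ^ 2 - ∑ c_a / (x - p_a)` vanishes. It equals
  -- `∑ c_a (p_a - p a₀) / (x - p_a) ^ 2`, from which the residue at `a₀`, and with it `s`, has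
  -- dropped out. If `a₀` is the only index this numerator is identically zero, hence the second
  -- clause.
  let B : Set ℂ := {x | (residueNumerator 2 p fun a => c a * (p a - p a₀)).eval x = 0 ∧
    (∃ a, a ≠ a₀)}
  have hB : B.Finite := by
    by_cases h : ∃ a, a ≠ a₀
    · obtain ⟨a, ha⟩ := h
      have hne : (residueNumerator 2 p fun a => c a * (p a - p a₀)) ≠ 0 := by
        intro h0
        refine eval_residueNumerator_self_ne_zero two_ne_zero hp (c := fun a => c a * (p a - p a₀))
          (a := a) (mul_ne_zero (hc a) (sub_ne_zero.2 fun h => ha (hp h))) ?_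
        rw [h0, Polynomial.eval_zero]
      exact (Polynomial.finite_setOfPred_isRoot hne).subset fun x hx => hx.1
    · exact Set.finite_empty.subset fun x hx => h hx.2
  -- The excluded values make the residue at `a₀` or the total residue zero, or give a zero `x` in
  -- `B ∪ {0}`; solving the equation at `x` for `s` gives the formula.
  have hfin : ({-c a₀} ∪ {-∑ a, c a} ∪
      (fun x => -(x - p a₀) * ∑ a, c a / (x - p a)) '' (B ∪ {0})).Finite :=
    ((Set.finite_singleton _).union (Set.finite_singleton _)).union
      ((hB.union (Set.finite_singleton 0)).image _)
  refine hfin.subset fun s hs => ?_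
  by_contra hcon
  simp only [Set.mem_union, Set.mem_singleton_iff, not_or] at hcon
  obtain ⟨⟨h1, h2⟩, h3⟩ := hcon
  refine hs ⟨fun a => ?_, ?_, fun x hx => ?_⟩
  · split_ifs with ha
    · subst ha
      exact fun h => h1 (by linear_combination h)
    · simpa using hc a
  · simp only [Finset.sum_add_distrib, Finset.sum_ite_eq', Finset.mem_univ, if_true]
    exact fun h => h2 (by linear_combination h)
  · have hne : ∀ a, x - p a ≠ 0 := fun a => sub_ne_zero.2 (hx.1 a)
    have hsum : ∀ n, ∑ a, (c a + if a = a₀ then s else 0) / (x - p a) ^ n =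
        ∑ a, c a / (x - p a) ^ n + s / (x - p a₀) ^ n := by
      intro n
      simp only [add_div, Finset.sum_add_distrib, ite_div, zero_div, Finset.sum_ite_eq',
        Finset.mem_univ, if_true]
    have hx0 : ∑ a, c a / (x - p a) + s / (x - p a₀) = 0 := by
      have := hsum 1
      simp only [pow_one] at this
      rw [← this]
      exact hx.2
    have hs' : s = -(x - p a₀) * ∑ a, c a / (x - p a) := by
      have := hne a₀
      field_simp at hx0
      linear_combination hx0
    have hxB : x ∉ B ∪ {0} := fun h => h3 ⟨x, h, hs'.symm⟩
    rw [Set.mem_union, not_or] at hxB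
    refine ⟨hxB.2, fun h4 => hxB.1 ⟨?_, ?_⟩⟩
    · rw [eval_residueNumerator 2 _ hx.1]
      rw [hsum 2] at h4
      have h5 : ∑ a, c a * (p a - p a₀) / (x - p a) ^ 2 =
          (x - p a₀) * (∑ a, c a / (x - p a) ^ 2 + s / (x - p a₀) ^ 2) -
            (∑ a, c a / (x - p a) + s / (x - p a₀)) := by
        have h6 : s / (x - p a₀) = (x - p a₀) * (s / (x - p a₀) ^ 2) := by
          have := hne a₀
          field_simp
        rw [h6, mul_add, add_sub_add_right_eq_sub, Finset.mul_sum, ← Finset.sum_sub_distrib]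
        refine Finset.sum_congr rfl fun a _ => ?_
        have := hne a
        field_simp
        ring
      rw [h5, h4, hx0]
      simp
    · by_contra! hall
      have : ∀ a, c a / (x - p a) = if a = a₀ then c a₀ / (x - p a₀) else 0 := fun a => by
        rw [hall a, if_pos rfl]
      rw [Finset.sum_congr rfl fun a _ => this a] at hx0
      simp only [Finset.sum_ite_eq', Finset.mem_univ, if_true] at hx0
      rw [← add_div, div_eq_zero_iff] at hx0
      exact h1 (by linear_combination hx0.resolve_right (hne a₀))

variable {I : Type*} [Fintype I] {K : Type*} [Field K] [Algebra K ℂ]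

/-- The variables separate: the critical set is a product of zero sets in one variable with `|A| -
1` elements each, and the Hessian is diagonal. Shifting all exponents at one `a₀` by the same `s`
avoids the finitely many degenerate values for all variables at once. -/
theorem eventually_isGood_bot [Nonempty A] {p : A → K} (hp : Function.Injective p) :
    ∀ᶠ w in genericFilter K (ExponentIndex I A),
      IsGood (⊥ : SimpleGraph I) (baseChange K p) ((Fintype.card A - 1) ^ Fintype.card I) w := by
  classical
  have hpinj : Function.Injective (baseChange K p) := (algebraMap K ℂ).injective.comp hp
  refine eventually_isGood_of_frequently ⊥ p fun hcon => ?_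
  have hne : ∀ᶠ w in genericFilter K (ExponentIndex I A), ∀ i a, pointWeight w i a ≠ 0 :=
    eventually_all.2 fun i => eventually_all.2 fun a =>
      IsRationalOn.eventually_ne_zero (v := fun _ => 1) (IsRationalOn.coord _) one_ne_zero
  obtain ⟨P, hP, H⟩ := mem_genericFilter.1 (hne.and hcon)
  obtain ⟨w₀, -, hw₀⟩ := exists_aeval_ne_zero hP Set.univ Set.infinite_univ
  obtain ⟨a₀⟩ := ‹Nonempty A›
  let γ : ExponentIndex I A → Polynomial ℂ := fun q => Polynomial.C (w₀ q) +
    Sum.elim (fun q : I × A => if q.2 = a₀ then Polynomial.X else 0) (fun _ => 0) q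
  let w : ℂ → ExponentIndex I A → ℂ := fun s q => (γ q).eval s
  have hw : ∀ s i a, pointWeight (w s) i a = pointWeight w₀ i a + if a = a₀ then s else 0 := by
    intro s i a
    simp only [pointWeight, w, γ, Sum.elim_inl, Polynomial.eval_add, Polynomial.eval_C]
    split_ifs <;> simp
  have hw0 : w 0 = w₀ := by
    funext q
    rcases q with q | q <;> simp [w, γ]
    split_ifs <;> simp
  have hfin1 : {s | MvPolynomial.aeval (w s) P = 0}.Finite :=
    finite_aeval_curve_eq_zero P γ (s₀ := 0) (by
      change MvPolynomial.aeval (w 0) P ≠ 0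
      rwa [hw0])
  have hfin2 := Set.finite_iUnion fun i => finite_degenerate_residues hpinj ((H w₀ hw₀).1 i) a₀
  obtain ⟨s, hs⟩ := (hfin1.union hfin2).exists_notMem
  rw [Set.mem_union, not_or, Set.mem_iUnion, not_exists] at hs
  obtain ⟨hs1, hs2⟩ := hs
  refine (H (w s) hs1).2 ?_
  change IsGood ⊥ _ _ (w s)
  have hgood : ∀ i, (∀ a, pointWeight (w s) i a ≠ 0) ∧ ∑ a, pointWeight (w s) i a ≠ 0 ∧
      ∀ x ∈ residueZeros (baseChange K p) (pointWeight (w s) i), x ≠ 0 ∧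
        ∑ a, pointWeight (w s) i a / (x - baseChange K p a) ^ 2 ≠ 0 := by
    intro i
    have h := not_not.1 (hs2 i)
    simp only [← hw] at h
    exact h
  have hcount := fun i => residueZeros_finite_ncard hpinj (hgood i).1 (hgood i).2.1
    fun x hx => ((hgood i).2.2 x hx).2
  have hedge : ∀ i j, edgeWeight (⊥ : SimpleGraph I) (w s) i j = 0 := fun i j => by
    simp [edgeWeight]
  have hset : criticalSet (⊥ : SimpleGraph I) (baseChange K p) (w s) =
      (Fintype.piFinset fun i => (hcount i).1.toFinset : Set (I → ℂ)) := by
    ext x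
    simp only [criticalSet, criticalPoints, admissible, force, hedge, residueZeros,
      SimpleGraph.bot_adj, Set.mem_ofPred_eq, zero_div, Finset.sum_const_zero, add_zero,
      Finset.mem_coe, Fintype.mem_piFinset, Set.Finite.mem_toFinset, forall_and,
      false_imp_iff, implies_true, and_true]
  refine ⟨hset ▸ Finset.finite_toSet _, ?_, fun x hx => ?_⟩
  · rw [hset, Set.ncard_coe_finset, Fintype.card_piFinset]
    rw [Finset.prod_congr rfl fun i _ => by
      rw [← Set.ncard_eq_toFinset_card _ (hcount i).1, (hcount i).2]]
    simp
  · rw [hset] at hx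
    have hxi : ∀ i, x i ∈ residueZeros (baseChange K p) (pointWeight (w s) i) := by
      simpa using hx
    refine ⟨fun i => ((hgood i).2.2 _ (hxi i)).1, fun ξ hξ => funext fun i => ?_⟩
    have h1 := hξ i
    simp only [forceDeriv, hedge, zero_mul, neg_zero, zero_div, Finset.sum_const_zero, add_zero] at h1
    have h2 : ∑ a, -(pointWeight (w s) i a * ξ i) / (x i - baseChange K p a) ^ 2 =
        -ξ i * ∑ a, pointWeight (w s) i a / (x i - baseChange K p a) ^ 2 := by
      rw [Finset.mul_sum]
      exact Finset.sum_congr rfl fun a _ => by ring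
    rw [h2] at h1
    simpa using (mul_eq_zero.1 h1).resolve_right ((hgood i).2.2 _ (hxi i)).2

end Edgeless

end HQD

namespace HQD

/-! ### Deletion-contraction for the chromatic polynomial -/

section Chromatic

/-- Proper colorings as a set of functions. -/
def properColorings {V : Type*} (G : SimpleGraph V) (n : ℕ) : Set (V → Fin n) :=
  {f | ∀ i j, G.Adj i j → f i ≠ f j}

theorem eval_chromaticPolynomial_eq_ncard {V : Type*} [Finite V] (G : SimpleGraph V) (n : ℕ) :
    (chromaticPolynomial G).eval (n : ℤ) = (properColorings G n).ncard := by
  rw [eval_chromaticPolynomial, ← Nat.card_coe_set_eq]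
  congr 1
  exact Nat.card_congr
    { toFun := fun C => ⟨C, fun i j h => C.valid h⟩
      invFun := fun f => SimpleGraph.Coloring.mk f.1 (fun {i j} h => f.2 i j h)
      left_inv := fun C => rfl
      right_inv := fun f => rfl }

theorem polynomial_eq_of_eval_natCast {P Q : Polynomial ℤ}
    (h : ∀ n : ℕ, P.eval (n : ℤ) = Q.eval (n : ℤ)) : P = Q := by
  refine Polynomial.eq_of_infinite_eval_eq P Q
    ((Set.infinite_range_of_injective (Nat.cast_injective (R := ℤ))).mono ?_)
  rintro _ ⟨n, rfl⟩
  exact h n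

theorem chromaticPolynomial_bot {V : Type*} [Fintype V] :
    chromaticPolynomial (⊥ : SimpleGraph V) = Polynomial.X ^ Fintype.card V := by
  refine polynomial_eq_of_eval_natCast fun n => ?_
  have : properColorings (⊥ : SimpleGraph V) n = Set.univ := by
    ext f; simp [properColorings]
  rw [eval_chromaticPolynomial_eq_ncard, this, Set.ncard_univ, Nat.card_fun]
  simp

/-- Among proper colorings of `G'`, those with different colors at `u` and `v` are the proper
colorings of `G`, and those with equal colors are pulled back from `G''`. -/
theorem chromaticPolynomial_delete_contract {I I' : Type*} [Fintype I] [Fintype I']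
    {G G' : SimpleGraph I} {G'' : SimpleGraph I'} {π : I → I'} {u v : I} (huv : G.Adj u v)
    (hG' : ∀ i j, G'.Adj i j ↔ G.Adj i j ∧ ¬ IsEnds u v i j) (hπ : IsContraction G u v π G'') :
    chromaticPolynomial G = chromaticPolynomial G' - chromaticPolynomial G'' := by
  refine polynomial_eq_of_eval_natCast fun n => ?_
  rw [Polynomial.eval_sub, eval_chromaticPolynomial_eq_ncard, eval_chromaticPolynomial_eq_ncard,
    eval_chromaticPolynomial_eq_ncard, eq_sub_iff_add_eq]
  have hunion : properColorings G' n =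
      properColorings G n ∪ (fun f => f ∘ π) '' properColorings G'' n := by
    ext f
    constructor
    · intro hf
      by_cases hfuv : f u = f v
      · right
        have hconst : ∀ k l, π k = π l → f k = f l := by
          intro k l h
          rcases (hπ.eq_iff k l).1 h with rfl | ⟨rfl, rfl⟩ | ⟨rfl, rfl⟩
          exacts [rfl, hfuv, hfuv.symm]
        have hsec : ∀ i, π (Function.surjInv hπ.surjective i) = i := Function.surjInv_eq _
        refine ⟨fun i => f (Function.surjInv hπ.surjective i), fun i j hij => ?_,
          funext fun k => hconst _ _ (hsec _)⟩
        obtain ⟨hne, k, l, rfl, rfl, hkl⟩ := (hπ.adj_iff i j).1 hij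
        beta_reduce
        rw [hconst _ k (hsec _), hconst _ l (hsec _)]
        exact hf k l ((hG' k l).2 ⟨hkl, fun he => hne ((hπ.eq_iff k l).2 (Or.inr he))⟩)
      · left
        intro i j hij
        by_cases he : IsEnds u v i j
        · rcases he with ⟨rfl, rfl⟩ | ⟨rfl, rfl⟩
          exacts [hfuv, fun h => hfuv h.symm]
        · exact hf i j ((hG' i j).2 ⟨hij, he⟩)
    · rintro (hf | ⟨f, hf, rfl⟩) i j hij
      · exact hf i j ((hG' i j).1 hij).1
      · refine hf _ _ ((hπ.adj_iff _ _).2 ⟨?_, i, j, rfl, rfl, ((hG' i j).1 hij).1⟩)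
        rw [ne_eq, hπ.eq_iff]
        rintro (rfl | he)
        · exact hij.ne rfl
        · exact ((hG' i j).1 hij).2 he
  have hdisj : Disjoint (properColorings G n) ((fun f => f ∘ π) '' properColorings G'' n) := by
    rw [Set.disjoint_left]
    rintro _ hf ⟨f, -, rfl⟩
    exact hf u v huv (congrArg f hπ.apply_eq)
  rw [hunion, Set.ncard_union_eq hdisj (Set.toFinite _) (Set.toFinite _),
    Set.ncard_image_of_injective _ hπ.surjective.injective_comp_right]
  push_cast
  rfl

end Chromatic

/-! ### The generic number of critical points -/

section Count

open Filter

/-- The graph obtained by contracting along `π`. -/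
def contractGraph {I I' : Type*} (G : SimpleGraph I) (π : I → I') : SimpleGraph I' where
  Adj i j := i ≠ j ∧ ∃ k l, π k = i ∧ π l = j ∧ G.Adj k l
  symm := ⟨fun _ _ ⟨hne, k, l, hk, hl, h⟩ => ⟨hne.symm, l, k, hl, hk, h.symm⟩⟩
  loopless := ⟨fun _ h => h.1 rfl⟩

open Classical in
/-- The contraction of the edge `uv` onto `u`. -/
noncomputable def contractionMap {I : Type*} {u v : I} (huv : u ≠ v) (k : I) : {k : I // k ≠ v} :=
  if h : k = v then ⟨u, huv⟩ else ⟨k, h⟩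

theorem isContraction_contractionMap {I : Type*} [Fintype I] (G : SimpleGraph I) {u v : I}
    (huv : u ≠ v) :
    IsContraction G u v (contractionMap huv) (contractGraph G (contractionMap huv)) where
  surjective := fun ⟨k, hk⟩ => ⟨k, by simp [contractionMap, hk]⟩
  eq_iff k l := by
    unfold contractionMap IsEnds
    split_ifs with hk hl hl
    · simp [hk, hl]
    · simp only [Subtype.mk.injEq]
      grind
    · simp only [Subtype.mk.injEq]
      grind
    · simp only [Subtype.mk.injEq]
      grind
  adj_iff _ _ := Iff.rfl

universe u

variable {A : Type*} [Fintype A] [Nonempty A] {K : Type*} [Field K] [Algebra K ℂ]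

/-- The number of critical points for generic exponents is given by the chromatic polynomial. -/
theorem exists_eventually_isGood {p : A → K} (hp : Function.Injective p) (n : ℕ) :
    ∀ (I : Type u) [Fintype I] (G : SimpleGraph I), Fintype.card I = n →
      ∃ N : ℕ, (N : ℤ) = (-1) ^ n * (chromaticPolynomial G).eval (1 - (Fintype.card A : ℤ)) ∧
        ∀ᶠ w in genericFilter K (ExponentIndex I A), IsGood G (baseChange K p) N w := by
  classical
  -- The outer induction on the number of vertices handles contraction, the inner one on the number
  -- of edges handles deletion.
  induction n using Nat.strong_induction_on with
  | _ n ihn =>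
  intro I _ G hI
  induction hm : G.edgeSet.ncard using Nat.strong_induction_on generalizing G with
  | _ m ihm =>
  by_cases hG : G = ⊥
  · subst hG
    refine ⟨(Fintype.card A - 1) ^ Fintype.card I, ?_, eventually_isGood_bot hp⟩
    rw [chromaticPolynomial_bot, Polynomial.eval_pow, Polynomial.eval_X, hI, ← mul_pow]
    push_cast [Nat.cast_sub (Fintype.card_pos (α := A))]
    ring
  · obtain ⟨u, v, huv⟩ := SimpleGraph.ne_bot_iff_exists_adj.1 hG
    let G' := G.deleteEdges {s(u, v)}
    have hG' : ∀ i j, G'.Adj i j ↔ G.Adj i j ∧ ¬ IsEnds u v i j := by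
      intro i j
      simp only [G', SimpleGraph.deleteEdges_adj, Set.mem_singleton_iff, Sym2.eq_iff, IsEnds]
    have hlt : G'.edgeSet.ncard < m := by
      rw [← hm]
      refine Set.ncard_lt_ncard (Set.ssubset_iff_subset_ne.2
        ⟨SimpleGraph.edgeSet_mono (G.deleteEdges_le _), fun h => ?_⟩) (Set.toFinite _)
      have h1 : s(u, v) ∈ G'.edgeSet := h ▸ huv
      exact ((hG' u v).1 h1).2 (Or.inl ⟨rfl, rfl⟩)
    have hπ := isContraction_contractionMap G huv.ne
    have hcard : Fintype.card {k : I // k ≠ v} + 1 = n := by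
      have hpos : 0 < Fintype.card I := Fintype.card_pos_iff.2 ⟨v⟩
      rw [← hI, Fintype.card_subtype_compl]
      simp
      omega
    obtain ⟨N, hN, h⟩ := ihm _ hlt G' rfl
    obtain ⟨N', hN', h'⟩ := ihn (Fintype.card {k : I // k ≠ v}) (by omega) {k : I // k ≠ v}
      (contractGraph G (contractionMap huv.ne)) rfl
    refine ⟨N + N', ?_, eventually_isGood_of_delete_contract hp huv hG' hπ h h'⟩
    push_cast
    -- The contracted graph has one vertex less, so the minus sign in the recursion is absorbed by
    -- the factor `(-1) ^ n`.
    rw [hN, hN', chromaticPolynomial_delete_contract huv hG' hπ, Polynomial.eval_sub, ← hcard,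
      pow_succ]
    ring

end Count

end HQD

namespace HQD

set_option linter.unusedSectionVars false

/-! ### From realizations to critical points by inversion -/

section Realizations

open Filter
open scoped Classical

variable {V : Type*} [Fintype V] {G : SimpleGraph V} {B : Finset V}

/-- The interior vertices. -/
abbrev Interior (B : Finset V) := {v : V | v ∉ B}

/-- The boundary vertices other than `β`. -/
abbrev OtherBoundary (B : Finset V) (β : B) := {a : B // a ≠ β}

/-- The neighbors of an interior vertex are the boundary vertices and the adjacent interior
vertices. -/
theorem sum_neighborSet {M : Type*} [AddCommMonoid M]
    (hJoin : ∀ u, u ∉ B → ∀ v, v ∈ B → G.Adj u v) (β : B) {u : V} (hu : u ∉ B)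
    [Fintype (G.neighborSet u)] (f : V → M) :
    ∑ v : G.neighborSet u, f v = f β + ∑ a : OtherBoundary B β, f a.1 +
      ∑ j : Interior B, if G.Adj u j then f j else 0 := by
  have h1 : ∑ v : G.neighborSet u, f v = ∑ v, if G.Adj u v then f v else 0 := by
    rw [← Finset.sum_filter]
    exact (Finset.sum_subtype _ (fun v => by simp) f).symm
  rw [h1, ← Fintype.sum_subtype_add_sum_subtype (fun v => v ∈ B)]
  congr 1
  rw [← Fintype.sum_eq_add_sum_subtype_ne (fun a : B => f a) β]
  have h2 : (fun a : B => if G.Adj u a then f a else 0) = fun a : B => f a :=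
    funext fun a => if_pos (hJoin u hu a a.2)
  rw [← h2]
  congr!

/-- The values of a function on the edges, extended by zero. -/
noncomputable def edgeValue {R : Type*} [Zero R] (q : G.edgeSet → R) (u v : V) : R :=
  if h : G.Adj u v then q ⟨s(u, v), h⟩ else 0

theorem edgeValue_of_adj {R : Type*} [Zero R] (q : G.edgeSet → R) {u v : V} (h : G.Adj u v) :
    edgeValue q u v = q ⟨s(u, v), h⟩ := dif_pos h

/-- With `β` singled out, the condition at `u` determines the value on the edge from `u` to `β` by
the others. The remaining values can serve as free exponents. -/
theorem sumZero_iff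
    (hJoin : ∀ u, u ∉ B → ∀ v, v ∈ B → G.Adj u v) (β : B) (q : G.edgeSet → ℝ) :
    SumZero G B q ↔ ∀ u, u ∉ B → edgeValue q u β + ∑ a : OtherBoundary B β, edgeValue q u a.1 +
      ∑ j : Interior B, (if G.Adj u j then edgeValue q u j else 0) = 0 := by
  unfold SumZero
  refine forall_congr' fun u => forall_congr' fun hu => ?_
  rw [← sum_neighborSet hJoin β hu (fun v => edgeValue q u v)]
  refine Eq.congr (Fintype.sum_congr _ _ fun v => ?_) rfl
  exact (edgeValue_of_adj q v.2).symm

/-- The configuration obtained from the coordinates `x = 1 / (z - b_β)` of the interior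
vertices. -/
noncomputable def configuration (b : B → ℂ) (β : B) (x : Interior B → ℂ) (v : V) : ℂ :=
  if h : v ∈ B then b ⟨v, h⟩ else b β + (x ⟨v, h⟩)⁻¹

theorem configuration_boundary (b : B → ℂ) (β : B) (x : Interior B → ℂ) (a : B) :
    configuration b β x a = b a := dif_pos a.2

theorem configuration_interior (b : B → ℂ) (β : B) (x : Interior B → ℂ) (i : Interior B) :
    configuration b β x i = b β + (x i)⁻¹ := dif_neg i.2

theorem configuration_injective (b : B → ℂ) (β : B) :
    Function.Injective (configuration b β) := by
  intro x y h
  funext i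
  have := congrFun h i
  rw [configuration_interior, configuration_interior] at this
  exact inv_injective (add_left_cancel this)

/-- The images of the boundary points other than `b_β` under `z ↦ 1 / (z - b_β)`. -/
noncomputable def invertedPoint (b : B → ℂ) (β : B) (a : OtherBoundary B β) : ℂ :=
  (b a.1 - b β)⁻¹

/-- This is the effect of the inversion on one term: up to the factor `-x ^ 2` its shape is
preserved, and the correction `x * c` disappears after summing over all neighbors. -/
theorem div_sub_inv {x y c : ℂ} (hx : x ≠ 0) (hy : y ≠ 0) (hxy : x ≠ y) :
    c / (x⁻¹ - y⁻¹) = x * c - x ^ 2 * (c / (x - y)) := by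
  have h1 := sub_ne_zero.2 hxy
  have h2 : x⁻¹ - y⁻¹ = -(x - y) / (x * y) := by field_simp; ring
  rw [h2]
  field_simp
  ring

/-- The inversion `z ↦ 1 / (z - b_β)` turns realizations into critical points. -/
theorem configuration_mem_realizations_iff
    (hEdge : ∀ u v, G.Adj u v → u ∉ B ∨ v ∉ B) (hJoin : ∀ u, u ∉ B → ∀ v, v ∈ B → G.Adj u v)
    {b : B → ℂ} (hb : Function.Injective b) (β : B) {q : G.edgeSet → ℝ} (hq : SumZero G B q)
    {c : Interior B → OtherBoundary B β → ℂ} {W : Interior B → Interior B → ℂ}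
    (hc : ∀ i a, c i a = ((edgeValue q (i : V) a.1 : ℝ) : ℂ))
    (hW : ∀ i j, W i j = ((edgeValue q (i : V) j : ℝ) : ℂ))
    {x : Interior B → ℂ} (hx : ∀ i, x i ≠ 0) :
    configuration b β x ∈ realizations G B b q ↔
      x ∈ criticalPoints (G.induce (Interior B)) (invertedPoint b β) c W := by
  have hp0 : ∀ a, invertedPoint b β a ≠ 0 := fun a =>
    inv_ne_zero (sub_ne_zero.2 fun h => a.2 (hb h))
  have hba : ∀ a : OtherBoundary B β, b a.1 = b β + (invertedPoint b β a)⁻¹ := fun a => by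
    rw [invertedPoint, inv_inv]; ring
  have hadm : (∀ u v, G.Adj u v → configuration b β x u ≠ configuration b β x v) ↔
      x ∈ admissible (G.induce (Interior B)) (invertedPoint b β) := by
    constructor
    · intro h
      refine ⟨fun i a hia => h i a.1 (hJoin _ i.2 _ a.1.2) ?_, fun i j hij hxij => h i j hij ?_⟩
      · rw [configuration_interior, configuration_boundary, hba a, hia]
      · rw [configuration_interior, configuration_interior, hxij]
    · rintro ⟨h1, h2⟩
      have key : ∀ (i : Interior B) (v : V), G.Adj i v →
          configuration b β x i ≠ configuration b β x v := by
        intro i v hiv h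
        rw [configuration_interior] at h
        by_cases hv : v ∈ B
        · rw [configuration_boundary b β x ⟨v, hv⟩] at h
          by_cases hvβ : (⟨v, hv⟩ : B) = β
          · rw [hvβ] at h
            exact inv_ne_zero (hx i) (by linear_combination h)
          · refine h1 i ⟨⟨v, hv⟩, hvβ⟩ ?_
            have h3 := hba ⟨⟨v, hv⟩, hvβ⟩
            exact inv_injective (by linear_combination h + h3)
        · rw [configuration_interior b β x ⟨v, hv⟩] at h
          exact h2 i ⟨v, hv⟩ hiv (inv_injective (by linear_combination h))
      intro u v huv
      by_cases hu : u ∈ B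
      · exact (key ⟨v, (hEdge u v huv).resolve_left (not_not.2 hu)⟩ u huv.symm).symm
      · exact key ⟨u, hu⟩ v huv
  have hforce : x ∈ admissible (G.induce (Interior B)) (invertedPoint b β) → ∀ i : Interior B,
      ∑ v : G.neighborSet (i : V), (q ⟨s((i : V), v.1), v.2⟩ : ℂ) /
        (configuration b β x i - configuration b β x v.1) =
      -(x i) ^ 2 * force (invertedPoint b β) c W x i := by
    intro hxa i
    have h0 := (sumZero_iff hJoin β q).1 hq i i.2
    have h0' : ((edgeValue q (i : V) β : ℝ) : ℂ) + ∑ a, c i a + ∑ j, W i j = 0 := by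
      have h2 := congrArg (fun r : ℝ => (r : ℂ)) h0
      push_cast at h2
      rw [← h2]
      congr 1
      · simp only [hc]
      · refine Finset.sum_congr rfl fun j _ => ?_
        rw [hW]
        by_cases hij : G.Adj i j
        · simp [hij]
        · simp [hij, edgeValue]
    have h1 : ∑ v : G.neighborSet (i : V), (q ⟨s((i : V), v.1), v.2⟩ : ℂ) /
        (configuration b β x i - configuration b β x v.1) =
        ∑ v : G.neighborSet (i : V), (fun v => ((edgeValue q (i : V) v : ℝ) : ℂ) /
          (configuration b β x i - configuration b β x v)) v :=
      Finset.sum_congr rfl fun v _ => by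
        beta_reduce
        rw [edgeValue_of_adj q v.2]
    rw [h1, sum_neighborSet hJoin β i.2 (fun v => ((edgeValue q (i : V) v : ℝ) : ℂ) /
          (configuration b β x i - configuration b β x v))]
    have hβ : ((edgeValue q (i : V) β : ℝ) : ℂ) / (configuration b β x i - configuration b β x β) =
        x i * ((edgeValue q (i : V) β : ℝ) : ℂ) := by
      rw [configuration_interior, configuration_boundary, add_sub_cancel_left, div_inv_eq_mul,
        mul_comm]
    have hA : ∀ a : OtherBoundary B β, ((edgeValue q (i : V) a.1 : ℝ) : ℂ) /
        (configuration b β x i - configuration b β x a.1) =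
        x i * c i a - (x i) ^ 2 * (c i a / (x i - invertedPoint b β a)) := by
      intro a
      rw [configuration_interior, configuration_boundary, hba a, add_sub_add_left_eq_sub, hc,
        div_sub_inv (hx i) (hp0 a) (hxa.1 i a)]
    have hI : ∀ j : Interior B, (if G.Adj i j then ((edgeValue q (i : V) j : ℝ) : ℂ) /
        (configuration b β x i - configuration b β x j) else 0) =
        x i * W i j - (x i) ^ 2 * (W i j / (x i - x j)) := by
      intro j
      by_cases hij : G.Adj i j
      · rw [if_pos hij, configuration_interior, configuration_interior, add_sub_add_left_eq_sub, hW,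
          div_sub_inv (hx i) (hx j) (hxa.2 i j hij)]
      · have : W i j = 0 := by rw [hW]; simp [edgeValue, hij]
        rw [if_neg hij, this]
        simp
    rw [hβ, Finset.sum_congr rfl fun a _ => hA a, Finset.sum_congr rfl fun j _ => hI j]
    simp only [Finset.sum_sub_distrib, ← Finset.mul_sum, force]
    -- The vertex `β`, now at infinity, contributes only a correction term, and all corrections add
    -- up to `x i` times the zero sum of `q`.
    linear_combination (x i) * h0'
  constructor
  · rintro ⟨-, h1, h2⟩
    have hxa := hadm.1 h1
    refine ⟨hxa, fun i => ?_⟩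
    have h3 := h2 i i.2
    have h4 := hforce hxa i
    have h5 : -(x i) ^ 2 * force (invertedPoint b β) c W x i = 0 := by
      rw [← h4, ← h3]
    exact (mul_eq_zero.1 h5).resolve_left (neg_ne_zero.2 (pow_ne_zero _ (hx i)))
  · rintro ⟨hxa, h2⟩
    refine ⟨configuration_boundary b β x, hadm.2 hxa, fun u hu => ?_⟩
    have h4 := hforce hxa ⟨u, hu⟩
    rw [h2, mul_zero] at h4
    rw [← h4]

/-- The edges to `β` keep every interior `z i` away from `b β`, so each realization has finite
nonzero inverted coordinates. Conversely, `hne` rules out critical points corresponding to a vertex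
at infinity. -/
theorem realizations_eq_image
    (hEdge : ∀ u v, G.Adj u v → u ∉ B ∨ v ∉ B) (hJoin : ∀ u, u ∉ B → ∀ v, v ∈ B → G.Adj u v)
    {b : B → ℂ} (hb : Function.Injective b) (β : B) {q : G.edgeSet → ℝ} (hq : SumZero G B q)
    {c : Interior B → OtherBoundary B β → ℂ} {W : Interior B → Interior B → ℂ}
    (hc : ∀ i a, c i a = ((edgeValue q (i : V) a.1 : ℝ) : ℂ))
    (hW : ∀ i j, W i j = ((edgeValue q (i : V) j : ℝ) : ℂ))
    (hne : ∀ x ∈ criticalPoints (G.induce (Interior B)) (invertedPoint b β) c W, ∀ i, x i ≠ 0) :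
    realizations G B b q = configuration b β ''
      criticalPoints (G.induce (Interior B)) (invertedPoint b β) c W := by
  ext z
  constructor
  · intro hz
    have hzβ : ∀ i : Interior B, z i - b β ≠ 0 := fun i => by
      rw [← hz.1 β]
      exact sub_ne_zero.2 (hz.2.1 i β (hJoin i i.2 β β.2))
    have hconf : configuration b β (fun i => (z i - b β)⁻¹) = z := by
      funext v
      by_cases hv : v ∈ B
      · rw [configuration_boundary b β _ ⟨v, hv⟩]
        exact (hz.1 ⟨v, hv⟩).symm
      · rw [configuration_interior b β _ ⟨v, hv⟩, inv_inv]
        ring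
    refine ⟨_, (configuration_mem_realizations_iff hEdge hJoin hb β hq hc hW
      fun i => inv_ne_zero (hzβ i)).1 ?_, hconf⟩
    rw [hconf]
    exact hz
  · rintro ⟨x, hx, rfl⟩
    exact (configuration_mem_realizations_iff hEdge hJoin hb β hq hc hW (hne x hx)).2 hx

/-- The half of the edge function with prescribed exponents that belongs to the ordered edge
`(u, v)`; it is supported on the edges with `u` interior. -/
noncomputable def halfEdgeValue (G : SimpleGraph V) (β : B)
    (r : ExponentIndex (Interior B) (OtherBoundary B β) → ℚ) (u v : V) : ℚ :=
  if hu : u ∈ B then 0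
  else if hv : v ∈ B then
    if hβ : (⟨v, hv⟩ : B) = β then
      -∑ a, r (Sum.inl (⟨u, hu⟩, a)) - ∑ j : Interior B,
        if G.Adj u j then r (Sum.inr (⟨u, hu⟩, j)) + r (Sum.inr (j, ⟨u, hu⟩)) else 0
    else r (Sum.inl (⟨u, hu⟩, ⟨⟨v, hv⟩, hβ⟩))
  else r (Sum.inr (⟨u, hu⟩, ⟨v, hv⟩))

/-- The edge function in the space `SumZero` with prescribed exponents. -/
noncomputable def edgeFunction (G : SimpleGraph V) (β : B)
    (r : ExponentIndex (Interior B) (OtherBoundary B β) → ℚ) (e : G.edgeSet) : ℚ :=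
  Sym2.lift ⟨fun u v => halfEdgeValue G β r u v + halfEdgeValue G β r v u,
    fun _ _ => add_comm _ _⟩ e.1

variable {β : B} {r : ExponentIndex (Interior B) (OtherBoundary B β) → ℚ}

theorem edgeValue_edgeFunction_other (hJoin : ∀ u, u ∉ B → ∀ v, v ∈ B → G.Adj u v)
    (i : Interior B) (a : OtherBoundary B β) :
    edgeValue (edgeFunction G β r) (i : V) a.1 = r (Sum.inl (i, a)) := by
  rw [edgeValue_of_adj _ (hJoin i i.2 a.1 a.1.2)]
  have h1 : (i : V) ∉ B := i.2
  simp [edgeFunction, halfEdgeValue, h1, a.2]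

theorem edgeValue_edgeFunction_interior {i j : Interior B} (h : G.Adj i j) :
    edgeValue (edgeFunction G β r) (i : V) j = r (Sum.inr (i, j)) + r (Sum.inr (j, i)) := by
  rw [edgeValue_of_adj _ h]
  have h1 : (i : V) ∉ B := i.2
  have h2 : (j : V) ∉ B := j.2
  simp [edgeFunction, halfEdgeValue, h1, h2]

theorem sumZero_edgeFunction (hJoin : ∀ u, u ∉ B → ∀ v, v ∈ B → G.Adj u v) :
    SumZero G B fun e => (edgeFunction G β r e : ℝ) := by
  rw [sumZero_iff hJoin β]
  intro u hu
  have hcast : ∀ v, edgeValue (fun e => (edgeFunction G β r e : ℝ)) u v =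
      ((edgeValue (edgeFunction G β r) u v : ℚ) : ℝ) := by
    intro v
    unfold edgeValue
    split_ifs <;> simp
  have hβ : edgeValue (edgeFunction G β r) u β = -∑ a, r (Sum.inl (⟨u, hu⟩, a)) -
      ∑ j : Interior B,
        if G.Adj u j then r (Sum.inr (⟨u, hu⟩, j)) + r (Sum.inr (j, ⟨u, hu⟩)) else 0 := by
    rw [edgeValue_of_adj _ (hJoin u hu β β.2)]
    simp [edgeFunction, halfEdgeValue, hu]
  simp only [hcast]
  have h1 : ∀ a : OtherBoundary B β, edgeValue (edgeFunction G β r) u a.1 =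
      r (Sum.inl (⟨u, hu⟩, a)) := fun a => edgeValue_edgeFunction_other hJoin ⟨u, hu⟩ a
  have h2 : ∀ j : Interior B, (if G.Adj u j then edgeValue (edgeFunction G β r) u j else 0) =
      if G.Adj u j then r (Sum.inr (⟨u, hu⟩, j)) + r (Sum.inr (j, ⟨u, hu⟩)) else 0 := by
    intro j
    split_ifs with h
    · exact edgeValue_edgeFunction_interior (i := ⟨u, hu⟩) h
    · rfl
  have h3 : edgeValue (edgeFunction G β r) u β +
      ∑ a : OtherBoundary B β, edgeValue (edgeFunction G β r) u a.1 +
      ∑ j : Interior B, (if G.Adj u j then edgeValue (edgeFunction G β r) u j else 0) = 0 := by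
    rw [hβ, Finset.sum_congr rfl fun a _ => h1 a, Finset.sum_congr rfl fun j _ => h2 j]
    ring
  have h4 := congrArg (fun t : ℚ => (t : ℝ)) h3
  push_cast at h4
  simpa only [apply_ite (fun t : ℚ => (t : ℝ)), Rat.cast_zero] using h4

/-- For generic edge functions the number of realizations is given by the chromatic polynomial of
the interior graph. -/
theorem forGeneric_ncard_realizations (hB : 2 ≤ B.card)
    (hEdge : ∀ u v, G.Adj u v → u ∉ B ∨ v ∉ B)
    (hJoin : ∀ u, u ∉ B → ∀ v, v ∈ B → G.Adj u v)
    (b : B → ℂ) (hb : Function.Injective b) :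
    ForGeneric G B (IntermediateField.adjoin ℚ (Set.range b)) fun q =>
      (realizations G B b q).Finite ∧
        ((realizations G B b q).ncard : ℤ) =
          (-1) ^ Nat.card {v : V // v ∉ B} *
            (chromaticPolynomial (G.induce {v : V | v ∉ B})).eval (-(B.card : ℤ) + 2) := by
  obtain ⟨β⟩ : Nonempty B := by
    rw [← Fintype.card_pos_iff, Fintype.card_coe]; omega
  have hcardA : Fintype.card (OtherBoundary B β) + 1 = B.card := by
    have : Fintype.card (OtherBoundary B β) = Fintype.card B - 1 := by
      convert Set.card_ne_eq β
      rfl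
    rw [Fintype.card_coe] at this
    omega
  have : Nonempty (OtherBoundary B β) := Fintype.card_pos_iff.1 (by omega)
  set K := IntermediateField.adjoin ℚ (Set.range b) with hK
  have hbK : ∀ a, b a ∈ K := fun a => IntermediateField.subset_adjoin ℚ _ ⟨a, rfl⟩
  let p : OtherBoundary B β → K := fun a => ((⟨b a.1, hbK _⟩ : K) - ⟨b β, hbK β⟩)⁻¹
  have hpb : baseChange K p = invertedPoint b β := by
    funext a
    simp [baseChange, p, invertedPoint]
  have hp : Function.Injective p := by
    intro a a' h
    have h1 := inv_injective h
    have h2 : (⟨b a.1, hbK _⟩ : K) = ⟨b a'.1, hbK _⟩ := sub_left_injective h1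
    exact Subtype.ext (hb (congrArg Subtype.val h2))
  obtain ⟨N, hN, hgood⟩ := exists_eventually_isGood hp (Fintype.card (Interior B)) (Interior B)
    (G.induce (Interior B)) rfl
  obtain ⟨P, hP, H⟩ := mem_genericFilter.1 hgood
  -- Rational exponents come from a real edge function, and their values may be used as coefficients
  -- in `K`.
  obtain ⟨w₀, hw₀Q, hw₀⟩ := exists_aeval_ne_zero hP (Set.range ((↑) : ℚ → ℂ))
    (Set.infinite_range_of_injective Rat.cast_injective)
  choose r hr using hw₀Q
  -- An edge function knows only the sum of the coordinates at `(i, j)` and `(j, i)`. Starting from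
  -- `r`, half the deviation from the reference edge function is added to each. The sum is then the
  -- value of `q`, and the reference function itself maps to `w₀`, where `P ≠ 0`.
  let F : ExponentIndex (Interior B) (OtherBoundary B β) → MvPolynomial G.edgeSet K :=
    Sum.elim (fun t => MvPolynomial.X ⟨s((t.1 : V), t.2.1), hJoin _ t.1.2 _ t.2.1.2⟩)
      fun t => MvPolynomial.C (r (Sum.inr t) : K) + if h : G.Adj (t.1 : V) t.2 then
        MvPolynomial.C (1 / 2 : K) * (MvPolynomial.X ⟨s((t.1 : V), (t.2 : V)), h⟩ -
          MvPolynomial.C (edgeFunction G β r ⟨s((t.1 : V), (t.2 : V)), h⟩ : K)) else 0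
  let w : (G.edgeSet → ℝ) → ExponentIndex (Interior B) (OtherBoundary B β) → ℂ := fun q t =>
    MvPolynomial.aeval (fun e => (q e : ℂ)) (F t)
  have hcomp : ∀ q, evalAt (MvPolynomial.bind₁ F P) q = MvPolynomial.aeval (w q) P := fun q => by
    rw [evalAt, MvPolynomial.aeval_bind₁]
  have hwl : ∀ q i a, w q (Sum.inl (i, a)) = ((edgeValue q (i : V) a.1 : ℝ) : ℂ) := by
    intro q i a
    rw [edgeValue_of_adj q (hJoin _ i.2 _ a.1.2)]
    simp [w, F]
  have hwr : ∀ q (i j : Interior B), w q (Sum.inr (i, j)) = (r (Sum.inr (i, j)) : ℂ) +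
      if G.Adj i j then (1 / 2 : ℂ) * (((edgeValue q (i : V) j : ℝ) : ℂ) -
        (r (Sum.inr (i, j)) + r (Sum.inr (j, i)))) else 0 := by
    intro q i j
    by_cases h : G.Adj i j
    · have h1 := edgeValue_edgeFunction_interior (β := β) (r := r) h
      rw [edgeValue_of_adj _ h] at h1
      rw [if_pos h, edgeValue_of_adj q h]
      simp [w, F, h, h1]
      exact Or.inl rfl
    · simp [w, F, h]
  refine ⟨MvPolynomial.bind₁ F P, ⟨fun e => (edgeFunction G β r e : ℝ),
    sumZero_edgeFunction hJoin, ?_⟩, fun q hq hqP => ?_⟩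
  · have hcast : ∀ u v, edgeValue (fun e => (edgeFunction G β r e : ℝ)) u v =
        ((edgeValue (edgeFunction G β r) u v : ℚ) : ℝ) := by
      intro u v
      unfold edgeValue
      split_ifs <;> simp
    have : w (fun e => (edgeFunction G β r e : ℝ)) = w₀ := by
      funext t
      rcases t with ⟨i, a⟩ | ⟨i, j⟩
      · rw [hwl, hcast, edgeValue_edgeFunction_other hJoin, ← hr]
        push_cast
        rfl
      · rw [hwr, ← hr]
        by_cases h : G.Adj i j
        · rw [if_pos h, hcast, edgeValue_edgeFunction_interior h]
          push_cast
          ring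
        · rw [if_neg h, add_zero]
    rw [hcomp, this]
    exact hw₀
  · rw [hcomp] at hqP
    obtain ⟨h1, h2, h3⟩ := H _ hqP
    have hc : ∀ i a, pointWeight (w q) i a = ((edgeValue q (i : V) a.1 : ℝ) : ℂ) := hwl q
    have hW : ∀ i j, edgeWeight (G.induce (Interior B)) (w q) i j = ((edgeValue q (i : V) j : ℝ) : ℂ) := by
      intro i j
      by_cases h : G.Adj i j
      · have hsymm : edgeValue q (j : V) i = edgeValue q (i : V) j := by
          rw [edgeValue_of_adj q h, edgeValue_of_adj q h.symm]
          congr 2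
          exact Sym2.eq_swap
        rw [edgeWeight, if_pos (show (G.induce (Interior B)).Adj i j from h), hwr, hwr, if_pos h,
          if_pos h.symm, hsymm]
        ring
      · rw [edgeWeight, if_neg (show ¬ (G.induce (Interior B)).Adj i j from h)]
        simp [edgeValue, h]
    rw [hpb] at h1 h2 h3
    have himg := realizations_eq_image hEdge hJoin hb β hq hc hW fun x hx => (h3 x hx).1
    have hfin : (criticalPoints (G.induce (Interior B)) (invertedPoint b β) (pointWeight (w q))
      (edgeWeight (G.induce (Interior B)) (w q))).Finite := h1
    rw [himg]
    refine ⟨hfin.image _, ?_⟩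
    rw [Set.ncard_image_of_injective _ (configuration_injective b β)]
    change ((criticalSet (G.induce (Interior B)) (invertedPoint b β) (w q)).ncard : ℤ) = _
    rw [h2, hN, Fintype.card_eq_nat_card]
    congr 2
    rw [← hcardA]
    push_cast
    ring

end Realizations

end HQD

theorem theorem5p4 {V : Type*} [Fintype V] (G : SimpleGraph V) (B : Finset V)
    (hB : 2 ≤ B.card)
    (hEdge : ∀ u v, G.Adj u v → u ∉ B ∨ v ∉ B)
    (hJoin : ∀ u, u ∉ B → ∀ v, v ∈ B → G.Adj u v)
    (b : B → ℂ) (hb : Function.Injective b) :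
    HQD.ForGeneric G B (IntermediateField.adjoin ℚ (Set.range b)) fun q =>
      (HQD.realizations G B b q).Finite ∧
        ((HQD.realizations G B b q).ncard : ℤ) =
          (-1) ^ Nat.card {v : V // v ∉ B} *
            (HQD.chromaticPolynomial (G.induce {v : V | v ∉ B})).eval (-(B.card : ℤ) + 2) :=
  HQD.forGeneric_ncard_realizations hB hEdge hJoin b hb
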